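/- Let $k\ge 1$ be an integer, $\lambda>0$ and $\epsilon,s\in(0,1)$ be constants. Write $\mathrm U_n$ for the set of unordered pairs of distinct elements of $[n]=\{1,\dots,n\}$, and identify a graph on $[n]$ with its adjacency matrix. **Models.** Let $\sigma$ be a uniform labeling in $[k]^n$ and, given $\sigma$, let $(G_{i,j})_{(i,j)\in \mathrm U_n}$ be independent Bernoulli variables with $\Pr(G_{i,j}=1)=\frac{(1+(k-1)\epsilon)\lambda}{n}$ if $\sigma(i)=\sigma(j)$ and $\frac{(1-\epsilon)\lambda}{n}$ otherwise. Independently, let $\pi$ be a uniform permutation of $[n]$ and let $J_{i,j},K_{i,j}$, $(i,j)\in \mathrm U_n$, be independent Bernoulli variables with parameter $s$. Put $A_{i,j}=G_{i,j}J_{i,j}$ and $B_{i,j}=G_{\pi^{-1}(i),\pi^{-1}(j)}K_{i,j}$. Let $\mathbb P=\mathbb P_n$ be the law of $(A,B)$, and let $\mathbb Q=\mathbb Q_n$ be the law of two independent Erdős–Rényi graphs on $[n]$ with edge density $\frac{\lambda s}{n}$. (For the finitely many $n$ for which one of these edge probabilities exceeds $1$, it is replaced by $1$.) **Statistic.** Let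 $\mathcal T_m$ be the set of unlabeled trees (isomorphism classes of trees) with $m$ edges, and let $\alpha\approx 0.338$ be Otter's constant, $\alpha^{-1}=\lim_{m\to\infty}|\mathcal T_m|^{1/m}$. Let $\aleph=\aleph_n$ be a sequence of nonnegative integers with $\aleph_n\to\infty$ and $\aleph_n=o\big(\frac{\log n}{\log\log n}\big)$. For subgraphs $S_1,S_2$ of the complete graph $\mathcal K_n$ on $[n]$ let $$\phi_{S_1,S_2}(A,B)=\Big(\tfrac{\lambda s}{n}\big(1-\tfrac{\lambda s}{n}\big)\Big)^{-\frac{|E(S_1)|+|E(S_2)|}{2}}\prod_{(i,j)\in E(S_1)}\Big(A_{i,j}-\tfrac{\lambda s}{n}\Big)\prod_{(i,j)\in E(S_2)}\Big(B_{i,j}-\tfrac{\lambda s}{n}\Big)$$ and $$f_{\mathcal T}(A,B)=\sum_{\mathbf H\in\mathcal T_{\aleph}}\frac{s^{\aleph}\operatorname{Aut}(\mathbf H)(n-\aleph-1)!}{n!}\sum_{S_1,S_2\cong\mathbf H}\phi_{S_1,S_2}(A,B),$$ where $\operatorname{Aut}(\mathbf H)$ is the number of automorphisms of $\mathbf H$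 and the inner sum is over subgraphs $S_1,S_2\subset\mathcal K_n$ isomorphic to $\mathbf H$ (it is empty if $n<\aleph+1$). **Proposition.** Assume that $\frac{1}{\lambda\epsilon^2}\ge s>\sqrt{\alpha}$. Then: 1. $\mathbb E_{\mathbb Q}[f_{\mathcal T}]=0$ for every $n\ge\lambda s$ with $\aleph_n\ge 1$ (in particular for all large $n$); moreover $\mathbb E_{\mathbb P}[f_{\mathcal T}]\ne 0$ for all large $n$, and $\frac{\operatorname{Var}_{\mathbb Q}[f_{\mathcal T}]}{(\mathbb E_{\mathbb P}[f_{\mathcal T}])^2}\to 0$ as $n\to\infty$; 2. $\frac{\operatorname{Var}_{\mathbb P}[f_{\mathcal T}]}{(\mathbb E_{\mathbb P}[f_{\mathcal T}])^2}\to 0$ as $n\to\infty$. Consequently $f_{\mathcal T}$ strongly separates $\mathbb P$ and $\mathbb Q$, that is, as $n\to\infty$, $$\sqrt{\max\{\operatorname{Var}_{\mathbb P}[f_{\mathcal T}],\operatorname{Var}_{\mathbb Q}[f_{\mathcal T}]\}}=o\big(\big|\mathbb E_{\mathbb P}[f_{\mathcal T}]-\mathbb E_{\mathbb Q}[f_{\mathcal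 T}]\big|\big).$$ -/

import Mathlib

open Filter Topology MeasureTheory ProbabilityTheory Asymptotics

noncomputable section

namespace CorrSBM

/-! ### Unlabeled trees and Otter's constant -/

/-- Labeled trees with `N` edges; they have `N + 1` vertices, taken to be `0, …, N`. -/
abbrev LabeledTree (N : ℕ) : Type :=
  {T : SimpleGraph (Fin (N + 1)) // T.IsTree}

/-- Two labeled trees are identified if they are isomorphic as graphs. -/
instance treeSetoid (N : ℕ) : Setoid (LabeledTree N) where
  r T T' := Nonempty (T.1 ≃g T'.1)
  iseqv :=
    ⟨fun _ => ⟨SimpleGraph.Iso.refl⟩, fun ⟨f⟩ => ⟨f.symm⟩, fun ⟨f⟩ ⟨g⟩ => ⟨f.trans g⟩⟩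

/-- The set `𝒯_N` of unlabeled trees with `N` edges, i.e. isomorphism classes of such trees. -/
abbrev UnlabeledTree (N : ℕ) : Type := Quotient (treeSetoid N)

instance (N : ℕ) : Fintype (UnlabeledTree N) := Fintype.ofFinite _

/-- A tree on `{0, …, N}` representing an unlabeled tree. Everything below depends on this
graph through its isomorphism class only. -/
def UnlabeledTree.graph {N : ℕ} (H : UnlabeledTree N) : SimpleGraph (Fin (N + 1)) :=
  (Quotient.out H).1

/-- Otter's constant `α ≈ 0.338`: the inverse of the exponential growth rate of the number of
unlabeled trees with `m` edges. (The sequence `|𝒯_m|^(1/m)` is bounded, by `4`, and it converges,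
so that the upper limit is its limit.) -/
def otterConstant : ℝ :=
  (limsup (fun m : ℕ => (Nat.card (UnlabeledTree m) : ℝ) ^ (1 / (m : ℝ))) atTop)⁻¹

/-! ### The two models -/

/-- The set `U_n` of unordered pairs of distinct elements of `[n]`. -/
abbrev Pair (n : ℕ) : Type := {e : Sym2 (Fin n) // ¬ e.IsDiag}

/-- A graph on `[n]`, identified with its adjacency matrix `(G_{i,j})`, `(i,j) ∈ U_n`. -/
abbrev Graph (n : ℕ) : Type := Pair n → Bool

/-- The pair `{π(i), π(j)}`. -/
def Pair.perm {n : ℕ} (π : Equiv.Perm (Fin n)) (e : Pair n) : Pair n :=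
  ⟨e.1.map π, fun h => e.2 ((Sym2.isDiag_map π.injective).1 h)⟩

instance permMeasurableSpace (n : ℕ) : MeasurableSpace (Equiv.Perm (Fin n)) := ⊤

/-- The Bernoulli law with parameter `p`; `p` is truncated to `[0, 1]`, which changes nothing
if it already lies there. -/
def bern (p : ℝ) : Measure Bool :=
  bernoulliMeasure true false (Set.projIcc (0 : ℝ) 1 zero_le_one p)

/-- The law of a random graph on `[n]` with independent edges, `e` being present with
probability `p e`. -/
def indepEdges {n : ℕ} (p : Pair n → ℝ) : Measure (Graph n) :=
  Measure.pi fun e => bern (p e)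

/-- The edge probability of the stochastic block model `𝒮(n, lam / n; k, ε)`, given the labeling
`σ`: the two cases are `σ(i) = σ(j)` and `σ(i) ≠ σ(j)`. -/
def sbmProb {n k : ℕ} (lam ε : ℝ) (σ : Fin n → Fin k) (e : Pair n) : ℝ :=
  open scoped Classical in
  if (e.1.map σ).IsDiag then (1 + ((k : ℝ) - 1) * ε) * lam / n else (1 - ε) * lam / n

/-- The joint law of `(σ, π, G, A, B)` in the correlated stochastic block models: `σ` is a uniform
labeling, `G` given `σ` is a stochastic block model, `π` is a uniform permutation, `J` and `K` are
families of independent Bernoulli variables with parameter `s`,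
`A_{i,j} = G_{i,j} J_{i,j}` and `B_{i,j} = G_{π⁻¹(i),π⁻¹(j)} K_{i,j}`. -/
def jointLaw (n k : ℕ) (lam ε s : ℝ) :
    Measure ((Fin n → Fin k) × Equiv.Perm (Fin n) × Graph n × Graph n × Graph n) :=
  (uniformOn (Set.univ : Set (Fin n → Fin k))).bind fun σ =>
    ((uniformOn (Set.univ : Set (Equiv.Perm (Fin n)))).prod
      ((indepEdges (sbmProb lam ε σ)).prod
        ((indepEdges fun _ => s).prod (indepEdges fun _ => s)))).map
      fun (π, G, J, K) =>
        (σ, π, G, fun e => G e && J e, fun e => G (e.perm π⁻¹) && K e)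

/-- The planted law `ℙ_n`: the law of `(A, B)` in the correlated stochastic block models. -/
def lawP (n k : ℕ) (lam ε s : ℝ) : Measure (Graph n × Graph n) :=
  (jointLaw n k lam ε s).map fun (_, _, _, A, B) => (A, B)

/-- The null law `ℚ_n`: the law of two independent Erdős–Rényi graphs with edge density
`lam * s / n`. -/
def lawQ (n : ℕ) (lam s : ℝ) : Measure (Graph n × Graph n) :=
  (indepEdges fun _ => lam * s / n).prod (indepEdges fun _ => lam * s / n)

/-! ### The tree-counting statistic -/

/-- The entries of the adjacency matrix as real numbers `0`, `1`. -/
def entry {n : ℕ} (G : Graph n) (e : Pair n) : ℝ := if G e then 1 else 0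

/-- Subgraphs of the complete graph `𝒦_n` on `[n]`. -/
abbrev Sub (n : ℕ) : Type := (⊤ : SimpleGraph (Fin n)).Subgraph

/-- The edges of a subgraph of `𝒦_n`, as elements of `U_n`. -/
def Sub.edges {n : ℕ} (S : Sub n) : Finset (Pair n) :=
  open scoped Classical in Finset.univ.filter fun e => e.1 ∈ SimpleGraph.Subgraph.edgeSet S

/-- The polynomial `φ_{S₁,S₂}` in the entries `a`, `b` of the two adjacency matrices. -/
def phi {n : ℕ} (lam s : ℝ) (S₁ S₂ : Sub n) (a b : Pair n → ℝ) : ℝ :=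
  ((lam * s / n) * (1 - lam * s / n)) ^ (-(((S₁.edges.card : ℝ) + (S₂.edges.card : ℝ)) / 2)) *
    (∏ e ∈ S₁.edges, (a e - lam * s / n)) * ∏ e ∈ S₂.edges, (b e - lam * s / n)

/-- The set of all subgraphs `S ⊂ 𝒦_n` with `S ≅ H`. -/
def copies (n : ℕ) {m : ℕ} (H : SimpleGraph (Fin m)) : Finset (Sub n) :=
  (Set.toFinite {S : Sub n | Nonempty (S.coe ≃g H)}).toFinset

/-- `Aut(H)`, the number of automorphisms of `H`. -/
def autCount {m : ℕ} (H : SimpleGraph (Fin m)) : ℕ := Nat.card (H ≃g H)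

/-- The statistic `f_𝒯`, built from the unlabeled trees with `N` edges, as a polynomial in the
entries `a`, `b` of the two adjacency matrices. (If `n < N + 1` there are no copies of such a tree
in `𝒦_n`, and the sum is zero.) -/
def treePoly (n N : ℕ) (lam s : ℝ) (a b : Pair n → ℝ) : ℝ :=
  ∑ H : UnlabeledTree N,
    (s ^ N * (autCount H.graph : ℝ) * ((n - N - 1).factorial : ℝ) / (n.factorial : ℝ)) *
      ∑ S₁ ∈ copies n H.graph, ∑ S₂ ∈ copies n H.graph, phi lam s S₁ S₂ a b

/-- The value of `f_𝒯` at a pair of graphs. -/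
def treeStat (n N : ℕ) (lam s : ℝ) (x : Graph n × Graph n) : ℝ :=
  treePoly n N lam s (entry x.1) (entry x.2)

/-- `f` strongly separates `P` and `Q`:
`√(max (Var_P f) (Var_Q f)) = o(|E_P f - E_Q f|)` as `n → ∞`. -/
def StronglySeparates (P Q : (n : ℕ) → Measure (Graph n × Graph n))
    (f : (n : ℕ) → Graph n × Graph n → ℝ) : Prop :=
  (fun n => Real.sqrt (max (variance (f n) (P n)) (variance (f n) (Q n)))) =o[atTop]
    fun n => |(∫ x, f n x ∂(P n)) - ∫ x, f n x ∂(Q n)|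

end CorrSBM

end

/-! Write p = λs/n. The statistic is a sum over pairs of copies of the same tree of products of
centered entries, and its coefficient is s^N divided by the number of copies, up to the variance
normalization (`coeff_eq_weight`). Under the null law distinct pairs of copies are orthogonal, so
for large n the variance is exactly D = |𝒯_N| s^(2N) (`integral_lawQ_sq_eq`). Under the planted law
the statistic does not see the permutation (`treeStat_perm`), and pairs of equal copies contribute
D·r with r = (`corr`/s)^N → 1 to the mean (`mean_ge`).

The community labels enter only through the centered variables `omega`. Resampling the label of a
vertex that lies on a single relevant edge averages `omega` to zero. Hence on a forest the labels
disappear (`moment_eq_prod`), and a moment vanishes as soon as some leaf is covered by one tree only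
(`moment_eq_zero_of_isLeaf`). By `four_trees`, four trees without such a leaf either form two
disjoint pairs of equal trees, or their union has at most one more vertex than edges. The first kind
gives at most (D r)² + 2D in the second moment (`second_le`). For the second kind with v vertices
and e edges, the two coefficients are of order n^(-2), there are about n^v placements, and the
moment is of order n^(-e). Since v ≤ e + 1 this leaves 1/n times (C(N+1))^(17(N+1))
(`exists_error_bound`), which tends to zero because N log N = o(log n). The mean has an error of the
same form.

It remains to see that D → ∞. Otter's constant, defined by an upper limit, only provides infinitely
many sizes m at which |𝒯_m| is large. Joining two rooted trees of different sizes at a new root is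
injective (`rootedCount_mul_le`), and this supermultiplicativity spreads the growth to every size
(`tendsto_card_mul_pow`). With D → ∞, `second_moment_method` makes both variances negligible against
the squared planted mean. -/

noncomputable section

namespace CorrSBM

/-! ### Finite sets of edges -/

section TreeSets

open scoped Classical

variable {n : ℕ}

/-- The vertices covered by a set of edges. -/
def supp (F : Finset (Pair n)) : Finset (Fin n) :=
  Finset.univ.filter fun v => ∃ e ∈ F, v ∈ e.1

theorem mem_supp {F : Finset (Pair n)} {v : Fin n} : v ∈ supp F ↔ ∃ e ∈ F, v ∈ e.1 := by
  simp [supp]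

theorem supp_mono {F F' : Finset (Pair n)} (h : F ⊆ F') : supp F ⊆ supp F' := by
  intro v hv
  obtain ⟨e, he, hve⟩ := mem_supp.1 hv
  exact mem_supp.2 ⟨e, h he, hve⟩

theorem supp_union (F F' : Finset (Pair n)) : supp (F ∪ F') = supp F ∪ supp F' := by
  ext v
  simp only [mem_supp, Finset.mem_union]
  constructor
  · rintro ⟨e, he | he, hv⟩
    · exact Or.inl ⟨e, he, hv⟩
    · exact Or.inr ⟨e, he, hv⟩
  · rintro (⟨e, he, hv⟩ | ⟨e, he, hv⟩)
    · exact ⟨e, Or.inl he, hv⟩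
    · exact ⟨e, Or.inr he, hv⟩

/-- The edge sets of trees with at least one edge. -/
structure IsTreeSet (F : Finset (Pair n)) : Prop where
  nonempty : F.Nonempty
  card_supp : (supp F).card = F.card + 1
  sparse : ∀ F' ⊆ F, F'.Nonempty → F'.card + 1 ≤ (supp F').card

/-- The vertex `u` belongs to exactly one edge of `F`, namely `e`. -/
def IsLeaf (F : Finset (Pair n)) (u : Fin n) (e : Pair n) : Prop :=
  e ∈ F ∧ u ∈ e.1 ∧ ∀ e' ∈ F, u ∈ e'.1 → e' = e

theorem card_filter_mem (e : Pair n) : (Finset.univ.filter fun v => v ∈ e.1).card = 2 := by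
  have h := Sym2.card_toFinset_of_not_isDiag e.1 e.2
  rw [← h]
  congr 1
  ext v
  simp

theorem sum_deg (F : Finset (Pair n)) (D : Finset (Fin n)) :
    ∑ u ∈ D, (F.filter fun e => u ∈ e.1).card = ∑ e ∈ F, (D.filter fun u => u ∈ e.1).card := by
  simp only [Finset.card_filter]
  exact Finset.sum_comm

/-- The sum counts incidences with D, so some vertex of D has degree below 2; lying in the support,
it has degree exactly 1. -/
theorem exists_isLeaf_of_sum_lt {F : Finset (Pair n)} {D : Finset (Fin n)} (hD : D ⊆ supp F)
    (h : ∑ e ∈ F, (D.filter fun u => u ∈ e.1).card < 2 * D.card) :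
    ∃ u ∈ D, ∃ e, IsLeaf F u e := by
  rw [← sum_deg] at h
  obtain ⟨u, hu, hlt⟩ : ∃ u ∈ D, (F.filter fun e => u ∈ e.1).card < 2 := by
    by_contra! hcon
    have := Finset.sum_le_sum hcon
    simp only [Finset.sum_const, smul_eq_mul] at this
    omega
  obtain ⟨e, he, hue⟩ := mem_supp.1 (hD hu)
  have hpos : 0 < (F.filter fun e => u ∈ e.1).card :=
    Finset.card_pos.2 ⟨e, Finset.mem_filter.2 ⟨he, hue⟩⟩
  refine ⟨u, hu, e, he, hue, fun e' he' hue' => ?_⟩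
  exact Finset.card_le_one.1 (by omega : (F.filter fun e => u ∈ e.1).card ≤ 1) e'
    (Finset.mem_filter.2 ⟨he', hue'⟩) e (Finset.mem_filter.2 ⟨he, hue⟩)

/-- A set `D` of vertices of a tree which touches at most `|D|` edges contains a leaf. -/
theorem IsTreeSet.exists_isLeaf {F : Finset (Pair n)} (hF : IsTreeSet F) {D : Finset (Fin n)}
    (hD : D ⊆ supp F) (hne : D.Nonempty)
    (hcard : (F.filter fun e => ∃ u ∈ D, u ∈ e.1).card ≤ D.card) :
    ∃ u ∈ D, ∃ e, IsLeaf F u e := by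
  apply exists_isLeaf_of_sum_lt hD
  -- An edge meeting D is counted once, and once more if both its ends lie in D. By sparsity there
  -- are fewer than |D| edges of the latter kind, so the incidences stay below 2|D|.
  set F₂ := F.filter fun e => ∀ u ∈ e.1, u ∈ D
  have hF₂ : F₂.card < D.card := by
    rcases F₂.eq_empty_or_nonempty with h0 | h0
    · rw [h0]; simpa using hne.card_pos
    · have h1 := hF.sparse F₂ (Finset.filter_subset _ _) h0
      have h2 : supp F₂ ⊆ D := by
        intro v hv
        obtain ⟨e, he, hve⟩ := mem_supp.1 hv
        exact (Finset.mem_filter.1 he).2 v hve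
      have := Finset.card_le_card h2
      omega
  have key : ∀ e ∈ F, (D.filter fun u => u ∈ e.1).card ≤
      (if ∃ u ∈ D, u ∈ e.1 then 1 else 0) + (if ∀ u ∈ e.1, u ∈ D then 1 else 0) := by
    intro e _
    have hsub : (D.filter fun u => u ∈ e.1) ⊆ Finset.univ.filter fun u => u ∈ e.1 :=
      Finset.filter_subset_filter _ (Finset.subset_univ _)
    have h2 := Finset.card_le_card hsub
    rw [card_filter_mem] at h2
    by_cases h1 : ∃ u ∈ D, u ∈ e.1
    · rw [if_pos h1]
      by_cases h3 : ∀ u ∈ e.1, u ∈ D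
      · rw [if_pos h3]; omega
      · rw [if_neg h3]
        push Not at h3
        obtain ⟨u, hu, huD⟩ := h3
        have hss : (D.filter fun u => u ∈ e.1) ⊂ Finset.univ.filter fun u => u ∈ e.1 := by
          refine Finset.ssubset_iff_subset_ne.2 ⟨hsub, fun heq => huD ?_⟩
          have : u ∈ Finset.univ.filter fun u => u ∈ e.1 := by simp [hu]
          rw [← heq] at this
          exact (Finset.mem_filter.1 this).1
        have := Finset.card_lt_card hss
        rw [card_filter_mem] at this
        omega
    · have : (D.filter fun u => u ∈ e.1) = ∅ :=
        Finset.filter_eq_empty_iff.2 fun u hu hue => h1 ⟨u, hu, hue⟩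
      rw [this]; simp
  have hsum := Finset.sum_le_sum key
  rw [Finset.sum_add_distrib, ← Finset.card_filter, ← Finset.card_filter] at hsum
  change _ ≤ _ + F₂.card at hsum
  omega

/-- Every tree has a leaf. -/
theorem IsTreeSet.exists_leaf {F : Finset (Pair n)} (hF : IsTreeSet F) :
    ∃ u ∈ supp F, ∃ e, IsLeaf F u e := by
  refine hF.exists_isLeaf subset_rfl ?_ ?_
  · rw [← Finset.card_pos, hF.card_supp]; omega
  · rw [hF.card_supp]
    exact (Finset.card_filter_le _ _).trans (Nat.le_succ _)

/-- A nonempty set of edges of a tree has a leaf. -/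
theorem IsTreeSet.exists_isLeaf_of_subset {X F : Finset (Pair n)} (hX : IsTreeSet X)
    (hF : F ⊆ X) (hne : F.Nonempty) : ∃ u ∈ supp F, ∃ e, IsLeaf F u e := by
  have h1 := hX.sparse _ hF hne
  refine exists_isLeaf_of_sum_lt subset_rfl ?_
  have : ∑ e ∈ F, ((supp F).filter fun u => u ∈ e.1).card ≤ ∑ e ∈ F, 2 :=
    Finset.sum_le_sum fun e _ => by
      rw [← card_filter_mem e]
      exact Finset.card_le_card (Finset.filter_subset_filter _ (Finset.subset_univ _))
  simp only [Finset.sum_const, smul_eq_mul] at this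
  omega

/-- A nonempty subset of the union of two disjoint trees has a leaf. -/
theorem exists_isLeaf_of_subset_union {X Z F : Finset (Pair n)} (hX : IsTreeSet X)
    (hZ : IsTreeSet Z) (hd : Disjoint (supp X) (supp Z)) (hF : F ⊆ X ∪ Z) (hne : F.Nonempty) :
    ∃ u e, IsLeaf F u e := by
  wlog h : (F ∩ X).Nonempty generalizing X Z
  · refine this hZ hX hd.symm (by rwa [Finset.union_comm]) ?_
    obtain ⟨e, he⟩ := hne
    refine ⟨e, Finset.mem_inter.2 ⟨he, (Finset.mem_union.1 (hF he)).resolve_left fun heX => ?_⟩⟩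
    exact h ⟨e, Finset.mem_inter.2 ⟨he, heX⟩⟩
  obtain ⟨u, hu, e, he, hue, huni⟩ := hX.exists_isLeaf_of_subset Finset.inter_subset_right h
  refine ⟨u, e, (Finset.mem_inter.1 he).1, hue, fun e' he' hue' => ?_⟩
  refine huni e' (Finset.mem_inter.2 ⟨he', ?_⟩) hue'
  refine (Finset.mem_union.1 (hF he')).resolve_right fun heZ => ?_
  exact Finset.disjoint_left.1 hd (supp_mono Finset.inter_subset_right hu)
    (mem_supp.2 ⟨e', heZ, hue'⟩)

/-- The common edges form a forest supported on the common vertices. If there are no common edges,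
one shared vertex is enough. -/
theorem IsTreeSet.card_inter_lt {X Y : Finset (Pair n)} (hX : IsTreeSet X)
    (h : ¬ Disjoint (supp X) (supp Y)) : (X ∩ Y).card + 1 ≤ (supp X ∩ supp Y).card := by
  rcases (X ∩ Y).eq_empty_or_nonempty with h0 | h0
  · rw [h0, Finset.card_empty, zero_add]
    exact Finset.card_pos.2 (Finset.not_disjoint_iff_nonempty_inter.1 h)
  · refine (hX.sparse _ Finset.inter_subset_left h0).trans (Finset.card_le_card ?_)
    exact Finset.subset_inter (supp_mono Finset.inter_subset_left)
      (supp_mono Finset.inter_subset_right)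

/-- Inclusion–exclusion on vertices and on edges: attaching a tree along at least one vertex does
not increase the excess of vertices over edges. -/
theorem IsTreeSet.card_supp_union_le {X : Finset (Pair n)} (Y : Finset (Pair n))
    (hX : IsTreeSet X) (h : ¬ Disjoint (supp X) (supp Y)) :
    (supp (X ∪ Y)).card + Y.card ≤ (supp Y).card + (X ∪ Y).card := by
  have h1 := hX.card_inter_lt h
  have h2 := Finset.card_union_add_card_inter X Y
  have h3 := Finset.card_union_add_card_inter (supp X) (supp Y)
  have h4 := hX.card_supp
  rw [supp_union]
  omega

/-- Two different trees of the same size which meet in a tree: the first has a leaf outside of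
the second. -/
theorem IsTreeSet.exists_isLeaf_notMem {X Y : Finset (Pair n)} (hX : IsTreeSet X)
    (hXY : X ≠ Y) (hcard : X.card = Y.card)
    (hint : (supp X ∩ supp Y).card ≤ (X ∩ Y).card + 1) :
    ∃ u e, IsLeaf X u e ∧ u ∉ supp Y := by
  have hs := hX.card_supp
  have h1 := Finset.card_sdiff_add_card_inter (supp X) (supp Y)
  have h2 := Finset.card_sdiff_add_card_inter X Y
  -- The vertices of X outside Y form a nonempty set, since otherwise X and Y would share all edges.
  -- They touch only edges of X \ Y, and `hint` says that there are at most as many of these as such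
  -- vertices.
  obtain ⟨u, hu, e, he⟩ := hX.exists_isLeaf (D := supp X \ supp Y) Finset.sdiff_subset (by
    rw [← Finset.card_pos]
    by_contra h0
    have h3 : X.card ≤ (X ∩ Y).card := by omega
    have h4 : X ∩ Y = X := Finset.eq_of_subset_of_card_le Finset.inter_subset_left h3
    exact hXY (Finset.eq_of_subset_of_card_le (Finset.inter_eq_left.1 h4) hcard.ge)) (by
    have : (X.filter fun e => ∃ u ∈ supp X \ supp Y, u ∈ e.1) ⊆ X \ Y := by
      intro e he
      obtain ⟨heX, u, hu, hue⟩ := Finset.mem_filter.1 he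
      refine Finset.mem_sdiff.2 ⟨heX, fun heY => (Finset.mem_sdiff.1 hu).2 ?_⟩
      exact mem_supp.2 ⟨e, heY, hue⟩
    have := Finset.card_le_card this
    omega)
  exact ⟨u, e, he, (Finset.mem_sdiff.1 hu).2⟩

/-- The relation of sharing a vertex. -/
def Touch (X Y : Finset (Pair n)) : Prop := ¬ Disjoint (supp X) (supp Y)

theorem Touch.union_left {X Y : Finset (Pair n)} (Z : Finset (Pair n)) (h : Touch X Y) :
    Touch X (Y ∪ Z) := fun h' =>
  h (h'.mono_right (supp_mono Finset.subset_union_left))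

theorem Touch.union_right {X Z : Finset (Pair n)} (Y : Finset (Pair n)) (h : Touch X Z) :
    Touch X (Y ∪ Z) := fun h' =>
  h (h'.mono_right (supp_mono Finset.subset_union_right))

/-- A single tree has excess one, and each of the three successive attachments keeps the excess from
growing. -/
theorem card_supp_le_of_touch {X Y Z W : Finset (Pair n)} (hX : IsTreeSet X) (hY : IsTreeSet Y)
    (hZ : IsTreeSet Z) (hW : IsTreeSet W) (hXY : Touch X Y) (hZ' : Touch Z (X ∪ Y))
    (hW' : Touch W (Z ∪ (X ∪ Y))) :
    (supp (W ∪ (Z ∪ (X ∪ Y)))).card ≤ (W ∪ (Z ∪ (X ∪ Y))).card + 1 := by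
  have h1 := hX.card_supp_union_le Y hXY
  have h2 := hZ.card_supp_union_le _ hZ'
  have h3 := hW.card_supp_union_le _ hW'
  have h4 := hY.card_supp
  omega

/-- Four trees, each of which meets another one, and of which the first two meet: either the
excess of vertices over edges of the union is at most one, or they form two disjoint pairs. -/
theorem four_trees_aux {X Y Z W : Finset (Pair n)} (hX : IsTreeSet X) (hY : IsTreeSet Y)
    (hZ : IsTreeSet Z) (hW : IsTreeSet W) (hXY : Touch X Y)
    (hZt : Touch Z X ∨ Touch Z Y ∨ Touch Z W) (hWt : Touch W X ∨ Touch W Y ∨ Touch W Z) :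
    (supp (X ∪ Y ∪ Z ∪ W)).card ≤ (X ∪ Y ∪ Z ∪ W).card + 1 ∨
      (Touch Z W ∧ Disjoint (supp (X ∪ Y)) (supp (Z ∪ W))) := by
  have e1 : X ∪ Y ∪ Z ∪ W = W ∪ (Z ∪ (X ∪ Y)) := by
    rw [Finset.union_comm (X ∪ Y) Z, Finset.union_comm _ W]
  have e2 : X ∪ Y ∪ Z ∪ W = Z ∪ (W ∪ (X ∪ Y)) := by
    rw [e1, Finset.union_left_comm]
  by_cases hZ1 : Touch Z (X ∪ Y)
  · left
    rw [e1]
    refine card_supp_le_of_touch hX hY hZ hW hXY hZ1 ?_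
    rcases hWt with h | h | h
    · exact (h.union_left Y).union_right Z
    · exact (h.union_right X).union_right Z
    · exact h.union_left _
  · by_cases hW1 : Touch W (X ∪ Y)
    · left
      rw [e2]
      refine card_supp_le_of_touch hX hY hW hZ hXY hW1 ?_
      rcases hZt with h | h | h
      · exact (h.union_left Y).union_right W
      · exact (h.union_right X).union_right W
      · exact h.union_left _
    · right
      refine ⟨?_, ?_⟩
      · rcases hZt with h | h | h
        · exact absurd (h.union_left Y) hZ1
        · exact absurd (h.union_right X) hZ1
        · exact h
      · rw [supp_union Z W, Finset.disjoint_union_right]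
        exact ⟨(not_not.1 hZ1).symm, (not_not.1 hW1).symm⟩

/-- For two disjoint pairs of meeting trees, the excess is at most one unless both pairs
meet in a tree. -/
theorem pairs_aux {X Y Z W : Finset (Pair n)} (hX : IsTreeSet X) (hY : IsTreeSet Y)
    (hZ : IsTreeSet Z) (hW : IsTreeSet W) (hXY : Touch X Y) (hZW : Touch Z W)
    (hd : Disjoint (supp (X ∪ Y)) (supp (Z ∪ W))) :
    (supp (X ∪ Y ∪ Z ∪ W)).card ≤ (X ∪ Y ∪ Z ∪ W).card + 1 ∨
      ((supp X ∩ supp Y).card ≤ (X ∩ Y).card + 1 ∧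
        (supp Z ∩ supp W).card ≤ (Z ∩ W).card + 1) := by
  have hd' : Disjoint (X ∪ Y) (Z ∪ W) := by
    rw [Finset.disjoint_left]
    intro e he he'
    obtain ⟨v, hv⟩ : ∃ v, v ∈ e.1 := ⟨e.1.out.1, Sym2.out_fst_mem _⟩
    exact Finset.disjoint_left.1 hd (mem_supp.2 ⟨e, he, hv⟩) (mem_supp.2 ⟨e, he', hv⟩)
  rw [Finset.union_assoc (X ∪ Y), supp_union (X ∪ Y), Finset.card_union_of_disjoint hd,
    Finset.card_union_of_disjoint hd', supp_union, supp_union]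
  -- Each pair has excess at most one, so the total exceeds one only if both pairs attain equality.
  have h1 := hX.card_inter_lt hXY
  have h2 := Finset.card_union_add_card_inter X Y
  have h3 := Finset.card_union_add_card_inter (supp X) (supp Y)
  have h4 := hX.card_supp
  have h5 := hY.card_supp
  have h1' := hZ.card_inter_lt hZW
  have h2' := Finset.card_union_add_card_inter Z W
  have h3' := Finset.card_union_add_card_inter (supp Z) (supp W)
  have h4' := hZ.card_supp
  have h5' := hW.card_supp
  omega

end TreeSets

/-! ### Expectations under the two laws -/

theorem integral_bind_finite {α β : Type*} [Finite α] [Finite β] [MeasurableSpace α]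
    [MeasurableSingletonClass α] [MeasurableSpace β] [MeasurableSingletonClass β]
    (m : Measure α) [IsFiniteMeasure m] (f : α → Measure β) [∀ a, IsProbabilityMeasure (f a)]
    (g : β → ℝ) : ∫ x, g x ∂(m.bind f) = ∫ a, ∫ x, g x ∂(f a) ∂m := by
  have := Fintype.ofFinite α
  have := Fintype.ofFinite β
  have hf : AEMeasurable f m := Measurable.of_discrete.aemeasurable
  have hfin : IsFiniteMeasure (m.bind f) := ⟨by
    rw [Measure.bind_apply MeasurableSet.univ hf]
    simp⟩
  rw [integral_fintype Integrable.of_finite, integral_fintype Integrable.of_finite]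
  simp_rw [integral_fintype Integrable.of_finite, Finset.smul_sum]
  rw [Finset.sum_comm]
  refine Finset.sum_congr rfl fun x _ => ?_
  rw [Measure.real, Measure.bind_apply (measurableSet_singleton x) hf, lintegral_fintype,
    ENNReal.toReal_sum (fun a _ => ENNReal.mul_ne_top (measure_ne_top _ _) (measure_ne_top _ _)),
    Finset.sum_smul]
  refine Finset.sum_congr rfl fun a _ => ?_
  rw [ENNReal.toReal_mul, mul_comm, mul_smul]
  rfl

instance (p : ℝ) : IsProbabilityMeasure (bern p) := by
  unfold bern; infer_instance

instance {n : ℕ} (p : Pair n → ℝ) : IsProbabilityMeasure (indepEdges p) := by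
  unfold indepEdges; infer_instance

theorem integral_bern {p : ℝ} (hp : 0 ≤ p ∧ p ≤ 1) (f : Bool → ℝ) :
    ∫ b, f b ∂(bern p) = p * f true + (1 - p) * f false := by
  rw [bern, integral_bernoulliMeasure, Set.projIcc_of_mem zero_le_one (Set.mem_Icc.2 hp)]
  rfl

theorem integral_indepEdges_prod {n : ℕ} {p : Pair n → ℝ} (hp : ∀ e, 0 ≤ p e ∧ p e ≤ 1)
    (f : Pair n → Bool → ℝ) :
    ∫ G, ∏ e, f e (G e) ∂(indepEdges p) = ∏ e, (p e * f e true + (1 - p e) * f e false) := by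
  rw [indepEdges, integral_fintype_prod_eq_prod]
  exact Finset.prod_congr rfl fun e _ => integral_bern (hp e) _

theorem Pair.perm_perm_inv {n : ℕ} (π : Equiv.Perm (Fin n)) (e : Pair n) :
    (e.perm π).perm π⁻¹ = e := by
  apply Subtype.ext
  simp [Pair.perm, Sym2.map_map]

theorem Pair.perm_inv_perm {n : ℕ} (π : Equiv.Perm (Fin n)) (e : Pair n) :
    (e.perm π⁻¹).perm π = e := by
  simpa using Pair.perm_perm_inv π⁻¹ e

/-- The action of a permutation of the vertices on the pairs. -/
def Pair.permEquiv {n : ℕ} (π : Equiv.Perm (Fin n)) : Equiv.Perm (Pair n) where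
  toFun e := e.perm π
  invFun e := e.perm π⁻¹
  left_inv := Pair.perm_perm_inv π
  right_inv := Pair.perm_inv_perm π

/-- The mean of `F (g && j) (g && k)` for independent Bernoulli variables `g`, `j`, `k` with
parameters `q`, `s`, `s`. -/
def edgeMean (s q : ℝ) (F : Bool → Bool → ℝ) : ℝ :=
  q * (s * (s * F true true + (1 - s) * F true false) +
    (1 - s) * (s * F false true + (1 - s) * F false false)) + (1 - q) * F false false

/-- As π permutes the pairs, the triples (G e, J e, K (π e)) are independent over e, and the
integral factorizes over the edges of the parent graph. -/
theorem integral_edges {n : ℕ} {q : Pair n → ℝ} {s : ℝ} (hq : ∀ e, 0 ≤ q e ∧ q e ≤ 1)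
    (hs : 0 ≤ s ∧ s ≤ 1) (π : Equiv.Perm (Fin n)) (F : Pair n → Bool → Bool → ℝ) :
    ∫ x, ∏ e, F e (x.1 e && x.2.1 e) (x.1 e && x.2.2 (e.perm π))
      ∂((indepEdges q).prod ((indepEdges fun _ => s).prod (indepEdges fun _ => s))) =
      ∏ e, edgeMean s (q e) (F e) := by
  rw [integral_prod _ Integrable.of_finite]
  have h1 : ∀ G : Graph n, (∫ y, ∏ e, F e (G e && y.1 e) (G e && y.2 (e.perm π))
      ∂((indepEdges fun _ : Pair n => s).prod (indepEdges fun _ => s))) =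
      ∏ e, (s * (s * F e (G e && true) (G e && true) + (1 - s) * F e (G e && true) (G e && false))
        + (1 - s) * (s * F e (G e && false) (G e && true) +
          (1 - s) * F e (G e && false) (G e && false))) := by
    intro G
    rw [integral_prod _ Integrable.of_finite]
    have h2 : ∀ J : Graph n, (∫ K, ∏ e, F e (G e && J e) (G e && K (e.perm π))
        ∂(indepEdges fun _ : Pair n => s)) =
        ∏ e, (s * F e (G e && J e) (G e && true) + (1 - s) * F e (G e && J e) (G e && false)) := by
      intro J
      have h3 : ∀ K : Graph n, ∏ e, F e (G e && J e) (G e && K (e.perm π)) =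
          ∏ e, (fun b => F (e.perm π⁻¹) (G (e.perm π⁻¹) && J (e.perm π⁻¹))
            (G (e.perm π⁻¹) && b)) (K e) := by
        intro K
        rw [← Equiv.prod_comp (Pair.permEquiv π) fun e => (fun b => F (e.perm π⁻¹)
          (G (e.perm π⁻¹) && J (e.perm π⁻¹)) (G (e.perm π⁻¹) && b)) (K e)]
        refine Finset.prod_congr rfl fun e _ => ?_
        simp only [Pair.permEquiv, Equiv.coe_fn_mk, Pair.perm_perm_inv]
      simp_rw [h3]
      rw [integral_indepEdges_prod (fun _ => hs) fun e b => F (e.perm π⁻¹)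
        (G (e.perm π⁻¹) && J (e.perm π⁻¹)) (G (e.perm π⁻¹) && b),
        ← Equiv.prod_comp (Pair.permEquiv π)]
      refine Finset.prod_congr rfl fun e _ => ?_
      simp only [Pair.permEquiv, Equiv.coe_fn_mk, Pair.perm_perm_inv]
    simp_rw [h2]
    exact integral_indepEdges_prod (fun _ => hs) fun e b =>
      s * F e (G e && b) (G e && true) + (1 - s) * F e (G e && b) (G e && false)
  simp_rw [h1]
  rw [integral_indepEdges_prod hq fun e b =>
    (s * (s * F e (b && true) (b && true) + (1 - s) * F e (b && true) (b && false))
        + (1 - s) * (s * F e (b && false) (b && true) +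
          (1 - s) * F e (b && false) (b && false)))]
  refine Finset.prod_congr rfl fun e _ => ?_
  simp only [edgeMean, Bool.and_true, Bool.and_false]
  ring

instance {n k : ℕ} [NeZero k] (lam ε s : ℝ) : IsProbabilityMeasure (lawP n k lam ε s) := by
  unfold lawP
  have : IsProbabilityMeasure (jointLaw n k lam ε s) := by
    unfold jointLaw
    refine isProbabilityMeasure_bind Measurable.of_discrete.aemeasurable (ae_of_all _ fun σ => ?_)
    exact Measure.isProbabilityMeasure_map Measurable.of_discrete.aemeasurable
  exact Measure.isProbabilityMeasure_map Measurable.of_discrete.aemeasurable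

instance {n : ℕ} (lam s : ℝ) : IsProbabilityMeasure (lawQ n lam s) := by
  unfold lawQ; infer_instance

theorem integral_lawP {n k : ℕ} [NeZero k] (lam ε s : ℝ) (g : Graph n × Graph n → ℝ) :
    ∫ x, g x ∂(lawP n k lam ε s) =
      ∫ σ, ∫ π, ∫ x, g (fun e => x.1 e && x.2.1 e, fun e => x.1 (e.perm π⁻¹) && x.2.2 e)
        ∂((indepEdges (sbmProb lam ε σ)).prod
        ((indepEdges fun _ => s).prod (indepEdges fun _ => s)))
        ∂(uniformOn (Set.univ : Set (Equiv.Perm (Fin n))))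
        ∂(uniformOn (Set.univ : Set (Fin n → Fin k))) := by
  rw [lawP, integral_map Measurable.of_discrete.aemeasurable
    Measurable.of_discrete.aestronglyMeasurable, jointLaw]
  have : ∀ σ : Fin n → Fin k, IsProbabilityMeasure
    (((uniformOn (Set.univ : Set (Equiv.Perm (Fin n)))).prod
      ((indepEdges (sbmProb lam ε σ)).prod
        ((indepEdges fun _ => s).prod (indepEdges fun _ => s)))).map
      fun ((π, G, J, K) : Equiv.Perm (Fin n) × Graph n × Graph n × Graph n) =>
        ((σ, π, G, fun e => G e && J e, fun e => G (e.perm π⁻¹) && K e) :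
          (Fin n → Fin k) × Equiv.Perm (Fin n) × Graph n × Graph n × Graph n)) := fun σ =>
    Measure.isProbabilityMeasure_map Measurable.of_discrete.aemeasurable
  rw [integral_bind_finite]
  refine integral_congr_ae (ae_of_all _ fun σ => ?_)
  dsimp only
  rw [integral_map Measurable.of_discrete.aemeasurable
    Measurable.of_discrete.aestronglyMeasurable, integral_prod _ Integrable.of_finite]

/-- The expectation under the planted law of a sum of products over the edges which is invariant
under relabeling the vertices of the second graph. -/
theorem integral_lawP_sum {n k : ℕ} [NeZero k] {lam ε s : ℝ} (hs : 0 ≤ s ∧ s ≤ 1)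
    (hq : ∀ (σ : Fin n → Fin k) e, 0 ≤ sbmProb lam ε σ e ∧ sbmProb lam ε σ e ≤ 1)
    {ι : Type*} (I : Finset ι) (w : ι → ℝ) (F : ι → Pair n → Bool → Bool → ℝ)
    (g : Graph n × Graph n → ℝ)
    (hg : ∀ A B, g (A, B) = ∑ i ∈ I, w i * ∏ e, F i e (A e) (B e))
    (hinv : ∀ A B (π : Equiv.Perm (Fin n)), g (A, fun e => B (e.perm π)) = g (A, B)) :
    ∫ x, g x ∂(lawP n k lam ε s) =
      ∑ i ∈ I, w i * ∫ σ, ∏ e, edgeMean s (sbmProb lam ε σ e) (F i e)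
        ∂(uniformOn (Set.univ : Set (Fin n → Fin k))) := by
  rw [integral_lawP]
  have h : ∀ (σ : Fin n → Fin k) (π : Equiv.Perm (Fin n)),
      (∫ x, g (fun e => x.1 e && x.2.1 e, fun e => x.1 (e.perm π⁻¹) && x.2.2 e)
        ∂((indepEdges (sbmProb lam ε σ)).prod
        ((indepEdges fun _ => s).prod (indepEdges fun _ => s)))) =
      ∑ i ∈ I, w i * ∏ e, edgeMean s (sbmProb lam ε σ e) (F i e) := by
    intro σ π
    have h1 : ∀ x : Graph n × Graph n × Graph n,
        g (fun e => x.1 e && x.2.1 e, fun e => x.1 (e.perm π⁻¹) && x.2.2 e) =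
          ∑ i ∈ I, w i * ∏ e, F i e (x.1 e && x.2.1 e) (x.1 e && x.2.2 (e.perm π)) := by
      intro x
      -- Invariance allows reading the second graph in the vertex names of the parent graph, so the
      -- result no longer depends on π.
      rw [← hinv _ _ π, hg]
      simp only [Pair.perm_perm_inv]
    simp_rw [h1]
    rw [integral_finsetSum _ fun _ _ => Integrable.of_finite]
    refine Finset.sum_congr rfl fun i _ => ?_
    rw [integral_const_mul, integral_edges (hq σ) hs π (F i)]
  simp_rw [h, integral_const, probReal_univ, one_smul]
  rw [integral_finsetSum _ fun _ _ => Integrable.of_finite]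
  simp_rw [integral_const_mul]

theorem integral_lawQ_prod {n : ℕ} {lam s : ℝ} (hp : 0 ≤ lam * s / n ∧ lam * s / n ≤ 1)
    (F F' : Pair n → Bool → ℝ) :
    ∫ x, (∏ e, F e (x.1 e)) * ∏ e, F' e (x.2 e) ∂(lawQ n lam s) =
      (∏ e, (lam * s / n * F e true + (1 - lam * s / n) * F e false)) *
        ∏ e, (lam * s / n * F' e true + (1 - lam * s / n) * F' e false) := by
  rw [lawQ, integral_prod_mul (fun A : Graph n => ∏ e, F e (A e))
    (fun B : Graph n => ∏ e, F' e (B e)), integral_indepEdges_prod (fun _ => hp),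
    integral_indepEdges_prod (fun _ => hp)]

/-! ### Averaging over the labeling -/

section Labeling

open scoped Classical

variable {n k : ℕ}

/-- The centered agreement of the labels of the two ends of an edge. -/
def omega (σ : Fin n → Fin k) (e : Pair n) : ℝ :=
  if (e.1.map σ).IsDiag then (k : ℝ) - 1 else -1

/-- Isolates the label dependence of the edge probability in a centered term added to the mean λ/n.
-/
theorem sbmProb_eq (lam ε : ℝ) (σ : Fin n → Fin k) (e : Pair n) :
    sbmProb lam ε σ e = lam / n + omega σ e * (ε * lam / n) := by
  unfold sbmProb omega
  split_ifs <;> ring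

/-- The average over a uniform labeling. -/
def labelMean (R : (Fin n → Fin k) → ℝ) : ℝ :=
  ∫ σ, R σ ∂(uniformOn (Set.univ : Set (Fin n → Fin k)))

theorem labelMean_const [NeZero k] (c : ℝ) : labelMean (fun _ : Fin n → Fin k => c) = c := by
  simp [labelMean]

theorem abs_labelMean_le [NeZero k] {R : (Fin n → Fin k) → ℝ} {c : ℝ} (h : ∀ σ, |R σ| ≤ c) :
    |labelMean R| ≤ c := by
  have := norm_integral_le_of_norm_le_const
    (μ := uniformOn (Set.univ : Set (Fin n → Fin k))) (f := R) (C := c) (ae_of_all _ fun σ => h σ)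
  simpa [labelMean] using this

theorem labelMean_sum {ι : Type*} (I : Finset ι) (R : ι → (Fin n → Fin k) → ℝ) [NeZero k] :
    labelMean (fun σ => ∑ i ∈ I, R i σ) = ∑ i ∈ I, labelMean (R i) :=
  integral_finsetSum _ fun _ _ => Integrable.of_finite

theorem labelMean_eq_sum [NeZero k] (R : (Fin n → Fin k) → ℝ) :
    labelMean R = (∑ σ, R σ) / (k : ℝ) ^ n := by
  rw [labelMean, integral_fintype Integrable.of_finite, Finset.sum_div]
  refine Finset.sum_congr rfl fun σ _ => ?_
  rw [Measure.real, uniformOn_univ, Measure.count_singleton]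
  simp [div_eq_inv_mul]

/-- Exactly one of the k labels at u agrees with that of v: its value k - 1 cancels the k - 1 values
-1. -/
theorem sum_omega_update [NeZero k] {u v : Fin n} (huv : u ≠ v) (σ : Fin n → Fin k)
    (h : ¬ (s(u, v) : Sym2 (Fin n)).IsDiag) :
    ∑ c : Fin k, omega (Function.update σ u c) ⟨s(u, v), h⟩ = 0 := by
  have h1 : ∀ c : Fin k, omega (Function.update σ u c) ⟨s(u, v), h⟩ =
      (if c = σ v then (k : ℝ) else 0) - 1 := by
    intro c
    simp only [omega, Sym2.map_mk, Sym2.mk_isDiag_iff, Function.update_self,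
      Function.update_of_ne huv.symm]
    split_ifs <;> ring
  simp only [h1, Finset.sum_sub_distrib, Finset.sum_ite_eq', Finset.mem_univ, if_true,
    Finset.sum_const, Finset.card_univ, Fintype.card_fin, nsmul_eq_mul, mul_one, sub_self]

theorem labelMean_omega_mul [NeZero k] {u : Fin n} {e : Pair n} (hu : u ∈ e.1)
    {R : (Fin n → Fin k) → ℝ} (hR : ∀ σ c, R (Function.update σ u c) = R σ) :
    labelMean (fun σ => omega σ e * R σ) = 0 := by
  obtain ⟨e, he⟩ := e
  obtain ⟨v, rfl⟩ := hu
  have huv : u ≠ v := fun h => he (by simp [h])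
  rw [labelMean_eq_sum, div_eq_zero_iff]
  left
  -- Shifting the label of u by c is a bijection of the labelings which fixes R. Averaging over all
  -- c resamples this label and leaves a sum of `omega` over all labels at u.
  have h1 : ∀ c : Fin k, ∑ σ : Fin n → Fin k, omega σ ⟨s(u, v), he⟩ * R σ =
      ∑ σ : Fin n → Fin k, omega (Function.update σ u (σ u + c)) ⟨s(u, v), he⟩ * R σ := by
    intro c
    have hbij : Function.Bijective
        (fun σ : Fin n → Fin k => Function.update σ u (σ u + c)) := by
      refine Function.bijective_iff_has_inverse.2
        ⟨fun σ => Function.update σ u (σ u - c), fun σ => ?_, fun σ => ?_⟩ <;> simp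
    rw [← hbij.sum_comp]
    simp only [hR]
  have h2 : (k : ℝ) * ∑ σ : Fin n → Fin k, omega σ ⟨s(u, v), he⟩ * R σ = 0 := by
    have : ∑ c : Fin k, ∑ σ : Fin n → Fin k, omega σ ⟨s(u, v), he⟩ * R σ = 0 := by
      rw [Finset.sum_congr rfl fun c _ => h1 c, Finset.sum_comm]
      refine Finset.sum_eq_zero fun σ _ => ?_
      rw [← Finset.sum_mul]
      have := Equiv.sum_comp (Equiv.addLeft (σ u))
        fun c => omega (Function.update σ u c) ⟨s(u, v), he⟩
      simp only [Equiv.coe_addLeft] at this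
      rw [this, sum_omega_update huv, zero_mul]
    simpa using this
  exact (mul_eq_zero.1 h2).resolve_left (Nat.cast_ne_zero.2 (NeZero.ne k))

theorem omega_update_of_notMem {u : Fin n} {e : Pair n} (hu : u ∉ e.1) (σ : Fin n → Fin k)
    (c : Fin k) : omega (Function.update σ u c) e = omega σ e := by
  have : e.1.map (Function.update σ u c) = e.1.map σ :=
    Sym2.map_congr fun x hx => Function.update_of_ne (by rintro rfl; exact hu hx) _ _
  simp only [omega, this]

theorem labelMean_prod_omega [NeZero k] {F : Finset (Pair n)} {u : Fin n} {e : Pair n}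
    (h : IsLeaf F u e) (c : Pair n → ℝ) (C : ℝ) :
    labelMean (fun σ : Fin n → Fin k => C * ∏ e ∈ F, (omega σ e * c e)) = 0 := by
  have h1 : ∀ σ : Fin n → Fin k, C * ∏ e ∈ F, (omega σ e * c e) =
      omega σ e * (C * c e * ∏ e ∈ F.erase e, (omega σ e * c e)) := by
    intro σ
    rw [← Finset.mul_prod_erase F _ h.1]
    ring
  simp_rw [h1]
  refine labelMean_omega_mul h.2.1 fun σ x => ?_
  congr 1
  refine Finset.prod_congr rfl fun e' he' => ?_
  rw [omega_update_of_notMem]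
  exact fun hu => (Finset.mem_erase.1 he').1 (h.2.2 e' (Finset.mem_erase.1 he').2 hu)

/-- If the edges which depend on the labels form a forest then they are independent. -/
theorem labelMean_prod_eq [NeZero k] {U : Finset (Pair n)}
    (hU : ∀ F ⊆ U, F.Nonempty → ∃ u e, IsLeaf F u e) (a b : Pair n → ℝ)
    (hb : ∀ e ∉ U, b e = 0) :
    labelMean (fun σ : Fin n → Fin k => ∏ e, (omega σ e * b e + a e)) = ∏ e, a e := by
  -- Expand over the set F of edges from which the label-dependent term is taken. A nonempty F
  -- inside U has a leaf and averages to zero, an F leaving U contains a zero factor, and only F = ∅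
  -- survives.
  simp_rw [Finset.prod_add]
  rw [labelMean_sum, Finset.sum_eq_single ∅]
  · simp [labelMean_const]
  · intro F _ hF
    by_cases hFU : F ⊆ U
    · obtain ⟨u, e, he⟩ := hU F hFU (Finset.nonempty_iff_ne_empty.2 hF)
      have := labelMean_prod_omega (k := k) he b (∏ i ∈ Finset.univ \ F, a i)
      simpa only [mul_comm] using this
    · obtain ⟨e, heF, heU⟩ := Finset.not_subset.1 hFU
      have : ∀ σ : Fin n → Fin k,
          (∏ i ∈ F, omega σ i * b i) * ∏ i ∈ Finset.univ \ F, a i = 0 := by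
        intro σ
        rw [Finset.prod_eq_zero heF (by rw [hb e heU, mul_zero]), zero_mul]
      simp_rw [this]
      exact labelMean_const 0
  · simp

/-- The mean vanishes if some vertex belongs to a single edge which depends on the labels, and
if the factor of this edge is centered. -/
theorem labelMean_prod_eq_zero [NeZero k] {u : Fin n} {e : Pair n} (hu : u ∈ e.1)
    (a b : Pair n → ℝ) (ha : a e = 0) (hb : ∀ e', u ∈ e'.1 → e' ≠ e → b e' = 0) :
    labelMean (fun σ : Fin n → Fin k => ∏ e, (omega σ e * b e + a e)) = 0 := by
  have h1 : ∀ σ : Fin n → Fin k, ∏ e, (omega σ e * b e + a e) =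
      omega σ e * (b e * ∏ e' ∈ Finset.univ.erase e, (omega σ e' * b e' + a e')) := by
    intro σ
    rw [← Finset.mul_prod_erase Finset.univ _ (Finset.mem_univ e), ha]
    ring
  simp_rw [h1]
  refine labelMean_omega_mul hu fun σ x => ?_
  congr 1
  refine Finset.prod_congr rfl fun e' he' => ?_
  by_cases hu' : u ∈ e'.1
  · rw [hb e' hu' (Finset.mem_erase.1 he').1, mul_zero, mul_zero]
  · rw [omega_update_of_notMem hu']

end Labeling

/-! ### Mixed moments along four sets of edges -/

section Moments

open scoped Classical

variable {n : ℕ}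

/-- The multiplicity of an edge in two sets of edges. -/
def mult (X Y : Finset (Pair n)) (e : Pair n) : ℕ :=
  (if e ∈ X then 1 else 0) + if e ∈ Y then 1 else 0

theorem mult_comm (X Y : Finset (Pair n)) : mult X Y = mult Y X := by
  ext e; exact Nat.add_comm _ _

/-- A Boolean as a real number. -/
def bit (b : Bool) : ℝ := if b then 1 else 0

/-- The factor of an edge with multiplicities `a` and `b` in the two graphs. -/
def edgeFactor (p : ℝ) (a b : ℕ) (x y : Bool) : ℝ := (bit x - p) ^ a * (bit y - p) ^ b

theorem prod_mult (p : ℝ) (X Y : Finset (Pair n)) (G : Graph n) :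
    ∏ e, (bit (G e) - p) ^ mult X Y e =
      (∏ e ∈ X, (entry G e - p)) * ∏ e ∈ Y, (entry G e - p) := by
  simp only [mult, pow_add, Finset.prod_mul_distrib, pow_ite, pow_one, pow_zero,
    Finset.prod_ite_mem, Finset.univ_inter]
  rfl

/-- The mean of the product of the centered entries of `A` along `X₁`, `Y₁` and of `B` along
`X₂`, `Y₂`. -/
def moment (k : ℕ) (lam ε s : ℝ) (X₁ X₂ Y₁ Y₂ : Finset (Pair n)) : ℝ :=
  labelMean fun σ : Fin n → Fin k => ∏ e, edgeMean s (sbmProb lam ε σ e)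
    (edgeFactor (lam * s / n) (mult X₁ Y₁ e) (mult X₂ Y₂ e))

theorem edgeMean_affine (s q r : ℝ) (F : Bool → Bool → ℝ) :
    edgeMean s (q + r) F = edgeMean s q F + r * (edgeMean s 1 F - F false false) := by
  unfold edgeMean; ring

theorem edgeMean_zero_zero (s q p : ℝ) : edgeMean s q (edgeFactor p 0 0) = 1 := by
  simp only [edgeMean, edgeFactor, pow_zero]; ring

theorem edgeMean_comm (s q p : ℝ) (a b : ℕ) :
    edgeMean s q (edgeFactor p a b) = edgeMean s q (edgeFactor p b a) := by
  simp only [edgeMean, edgeFactor]; ring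

theorem moment_swap_left (k : ℕ) (lam ε s : ℝ) (X₁ X₂ Y₁ Y₂ : Finset (Pair n)) :
    moment k lam ε s X₁ X₂ Y₁ Y₂ = moment k lam ε s Y₁ X₂ X₁ Y₂ := by
  simp only [moment, mult_comm X₁ Y₁]

theorem moment_swap_right (k : ℕ) (lam ε s : ℝ) (X₁ X₂ Y₁ Y₂ : Finset (Pair n)) :
    moment k lam ε s X₁ X₂ Y₁ Y₂ = moment k lam ε s X₁ Y₂ Y₁ X₂ := by
  simp only [moment, mult_comm X₂ Y₂]

theorem moment_swap (k : ℕ) (lam ε s : ℝ) (X₁ X₂ Y₁ Y₂ : Finset (Pair n)) :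
    moment k lam ε s X₁ X₂ Y₁ Y₂ = moment k lam ε s X₂ X₁ Y₂ Y₁ := by
  simp only [moment, fun q e => edgeMean_comm s q (lam * s / n) (mult X₁ Y₁ e) (mult X₂ Y₂ e)]

/-- The edge mean is affine in the edge probability, which is affine in `omega`; this yields the
form required for averaging over the labels. -/
theorem moment_eq (k : ℕ) (lam ε s : ℝ) (X₁ X₂ Y₁ Y₂ : Finset (Pair n)) :
    moment k lam ε s X₁ X₂ Y₁ Y₂ = labelMean fun σ : Fin n → Fin k => ∏ e, (omega σ e *
      (ε * lam / n * (edgeMean s 1 (edgeFactor (lam * s / n) (mult X₁ Y₁ e) (mult X₂ Y₂ e)) -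
        edgeFactor (lam * s / n) (mult X₁ Y₁ e) (mult X₂ Y₂ e) false false)) +
      edgeMean s (lam / n) (edgeFactor (lam * s / n) (mult X₁ Y₁ e) (mult X₂ Y₂ e))) := by
  unfold moment
  congr 1
  ext σ
  refine Finset.prod_congr rfl fun e _ => ?_
  rw [sbmProb_eq, edgeMean_affine]
  ring

theorem edgeMean_one_sub_eq_zero (s p : ℝ) {a b : ℕ} (ha : a = 0) (hb : b = 0) :
    edgeMean s 1 (edgeFactor p a b) - edgeFactor p a b false false = 0 := by
  subst ha hb
  rw [edgeMean_zero_zero]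
  simp [edgeFactor]

/-- The centering λs/n is the density of A at the average edge probability λ/n, so a lone centered
entry has mean zero apart from its label term. -/
theorem edgeMean_one_zero (lam s : ℝ) (n : ℕ) :
    edgeMean s (lam / n) (edgeFactor (lam * s / n) 1 0) = 0 := by
  simp [edgeMean, edgeFactor, bit]; ring

theorem edgeMean_one_one (lam s : ℝ) (n : ℕ) :
    edgeMean s (lam / n) (edgeFactor (lam * s / n) 1 1) =
      lam * s / n * (s - lam * s / n) := by
  simp [edgeMean, edgeFactor, bit]; ring

theorem edgeMean_two_zero (lam s : ℝ) (n : ℕ) :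
    edgeMean s (lam / n) (edgeFactor (lam * s / n) 2 0) =
      lam * s / n * (1 - lam * s / n) := by
  simp [edgeMean, edgeFactor, bit]; ring

theorem mult_eq_zero {X Y : Finset (Pair n)} {e : Pair n} (hX : e ∉ X) (hY : e ∉ Y) :
    mult X Y e = 0 := by simp [mult, hX, hY]

/-- The leaf edge occurs once in a single graph, so its factor is a pure multiple of `omega`. No
other factor involves the label of u, and averaging that label gives zero. -/
theorem moment_eq_zero_of_isLeaf {k : ℕ} [NeZero k] (lam ε s : ℝ) {X₁ X₂ Y₁ Y₂ : Finset (Pair n)}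
    {u : Fin n} {e : Pair n} (h : IsLeaf X₁ u e) (h2 : u ∉ supp X₂) (h3 : u ∉ supp Y₁)
    (h4 : u ∉ supp Y₂) : moment k lam ε s X₁ X₂ Y₁ Y₂ = 0 := by
  have hn : ∀ {F : Finset (Pair n)}, u ∉ supp F → ∀ e', u ∈ e'.1 → e' ∉ F :=
    fun hF e' hu he => hF (mem_supp.2 ⟨e', he, hu⟩)
  rw [moment_eq]
  refine labelMean_prod_eq_zero h.2.1 _ _ ?_ fun e' hu hne => ?_
  · have e1 : mult X₁ Y₁ e = 1 := by simp [mult, h.1, hn h3 e h.2.1]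
    rw [e1, mult_eq_zero (hn h2 e h.2.1) (hn h4 e h.2.1), edgeMean_one_zero]
  · rw [edgeMean_one_sub_eq_zero, mul_zero]
    · exact mult_eq_zero (fun he => hne (h.2.2 e' he hu)) (hn h3 e' hu)
    · exact mult_eq_zero (hn h2 e' hu) (hn h4 e' hu)

/-- On a forest the label terms average out, and the edges behave as if the parent graph were
Erdős–Rényi with density λ/n. -/
theorem moment_eq_prod {k : ℕ} [NeZero k] (lam ε s : ℝ) {X₁ X₂ Y₁ Y₂ U : Finset (Pair n)}
    (hU : ∀ F ⊆ U, F.Nonempty → ∃ u e, IsLeaf F u e) (h1 : X₁ ⊆ U) (h2 : X₂ ⊆ U) (h3 : Y₁ ⊆ U)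
    (h4 : Y₂ ⊆ U) : moment k lam ε s X₁ X₂ Y₁ Y₂ =
      ∏ e ∈ U, edgeMean s (lam / n)
        (edgeFactor (lam * s / n) (mult X₁ Y₁ e) (mult X₂ Y₂ e)) := by
  rw [moment_eq, labelMean_prod_eq hU]
  · refine (Finset.prod_subset (Finset.subset_univ U) fun e _ he => ?_).symm
    rw [mult_eq_zero (fun h => he (h1 h)) (fun h => he (h3 h)),
      mult_eq_zero (fun h => he (h2 h)) (fun h => he (h4 h)), edgeMean_zero_zero]
  · intro e he
    rw [edgeMean_one_sub_eq_zero, mul_zero]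
    · exact mult_eq_zero (fun h => he (h1 h)) (fun h => he (h3 h))
    · exact mult_eq_zero (fun h => he (h2 h)) (fun h => he (h4 h))

theorem abs_bit_sub_le_one {p : ℝ} (hp : 0 ≤ p ∧ p ≤ 1) (x : Bool) : |bit x - p| ≤ 1 := by
  rw [abs_le]
  cases x <;> simp [bit] <;> constructor <;> linarith [hp.1, hp.2]

theorem abs_edgeFactor_le {p : ℝ} (hp : 0 ≤ p ∧ p ≤ 1) {a : ℕ} (b : ℕ) (ha : a ≠ 0)
    (x y : Bool) : |edgeFactor p a b x y| ≤ |bit x - p| := by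
  rw [edgeFactor, abs_mul, abs_pow, abs_pow]
  calc |bit x - p| ^ a * |bit y - p| ^ b ≤ |bit x - p| ^ 1 * 1 := by
        refine mul_le_mul ?_ (pow_le_one₀ (abs_nonneg _) (abs_bit_sub_le_one hp y))
          (by positivity) (by positivity)
        exact pow_le_pow_of_le_one (abs_nonneg _) (abs_bit_sub_le_one hp x)
          (Nat.one_le_iff_ne_zero.2 ha)
    _ = |bit x - p| := by ring

/-- In a graph where the multiplicity is positive, the factor is at most 1 if the entry is present,
which has probability q s, and at most p otherwise. -/
theorem abs_edgeMean_le {p s q : ℝ} (hp : 0 ≤ p ∧ p ≤ 1) (hs : 0 ≤ s ∧ s ≤ 1)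
    (hq : 0 ≤ q ∧ q ≤ 1) {a b : ℕ} (hab : a ≠ 0 ∨ b ≠ 0) :
    |edgeMean s q (edgeFactor p a b)| ≤ q * s + p := by
  wlog ha : a ≠ 0 generalizing a b
  · rw [edgeMean_comm]
    exact this hab.symm (hab.resolve_left ha)
  have h1 : ∀ y, |edgeFactor p a b true y| ≤ 1 := fun y =>
    (abs_edgeFactor_le hp b ha true y).trans (abs_bit_sub_le_one hp true)
  have h0 : ∀ y, |edgeFactor p a b false y| ≤ p := fun y => by
    refine (abs_edgeFactor_le hp b ha false y).trans ?_
    simp [bit, abs_of_nonneg hp.1]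
  have hs' : 0 ≤ 1 - s := by linarith [hs.2]
  have hq' : 0 ≤ 1 - q := by linarith [hq.2]
  have hconv : ∀ {c t x y : ℝ}, 0 ≤ t → 0 ≤ 1 - t → |x| ≤ c → |y| ≤ c →
      |t * x + (1 - t) * y| ≤ c := by
    intro c t x y ht ht' hx hy
    calc |t * x + (1 - t) * y| ≤ |t * x| + |(1 - t) * y| := abs_add_le _ _
      _ = t * |x| + (1 - t) * |y| := by rw [abs_mul, abs_mul, abs_of_nonneg ht, abs_of_nonneg ht']
      _ ≤ t * c + (1 - t) * c := by gcongr
      _ = c := by ring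
  have ht := hconv hs.1 hs' (h1 true) (h1 false)
  have hf := hconv hs.1 hs' (h0 true) (h0 false)
  have h00 := h0 false
  unfold edgeMean
  set x := s * edgeFactor p a b true true + (1 - s) * edgeFactor p a b true false
  set y := s * edgeFactor p a b false true + (1 - s) * edgeFactor p a b false false
  set z := edgeFactor p a b false false
  calc |q * (s * x + (1 - s) * y) + (1 - q) * z|
      ≤ |q * (s * x + (1 - s) * y)| + |(1 - q) * z| := abs_add_le _ _
    _ = q * |s * x + (1 - s) * y| + (1 - q) * |z| := by
        rw [abs_mul, abs_mul, abs_of_nonneg hq.1, abs_of_nonneg hq']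
    _ ≤ q * (|s * x| + |(1 - s) * y|) + (1 - q) * |z| := by
        gcongr
        · exact hq.1
        · exact abs_add_le _ _
    _ = q * (s * |x| + (1 - s) * |y|) + (1 - q) * |z| := by
        rw [abs_mul, abs_mul, abs_of_nonneg hs.1, abs_of_nonneg hs']
    _ ≤ q * (s * 1 + (1 - s) * p) + (1 - q) * p := by
        have := hq.1
        have := hs.1
        gcongr
    _ ≤ q * s + p := by nlinarith [mul_nonneg (mul_nonneg hq.1 hs.1) hp.1]

/-- The conditions on the parameters under which all probabilities lie in the unit interval. -/
structure Admissible (n k : ℕ) (lam ε s : ℝ) : Prop where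
  lam_pos : 0 < lam
  eps_mem : 0 < ε ∧ ε < 1
  s_mem : 0 < s ∧ s < 1
  n_pos : 0 < n
  k_pos : 0 < k
  le : k * lam ≤ n
  p_le : lam * s / n ≤ s / 2

theorem Admissible.sbmProb_mem {k : ℕ} {lam ε s : ℝ} (h : Admissible n k lam ε s)
    (σ : Fin n → Fin k) (e : Pair n) : 0 ≤ sbmProb lam ε σ e ∧ sbmProb lam ε σ e ≤ k * lam / n ∧
      sbmProb lam ε σ e ≤ 1 := by
  have hk : (1 : ℝ) ≤ k := by exact_mod_cast h.k_pos
  have hn : (0 : ℝ) < n := by exact_mod_cast h.n_pos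
  have h1 : sbmProb lam ε σ e ≤ k * lam / n := by
    unfold sbmProb
    split_ifs
    · gcongr
      · exact h.lam_pos.le
      · nlinarith [h.eps_mem.1, h.eps_mem.2]
    · gcongr
      · exact h.lam_pos.le
      · linarith [h.eps_mem.1]
  refine ⟨?_, h1, h1.trans ((div_le_one hn).2 h.le)⟩
  have := h.lam_pos
  have := h.eps_mem
  unfold sbmProb
  split_ifs
  · have : 0 ≤ ((k : ℝ) - 1) * ε := mul_nonneg (by linarith) this.1.le
    positivity
  · have : 0 ≤ 1 - ε := by linarith
    positivity

theorem Admissible.p_pos {k : ℕ} {lam ε s : ℝ} (h : Admissible n k lam ε s) :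
    0 < lam * s / n := by
  have := h.lam_pos
  have := h.s_mem.1
  have hn : (0 : ℝ) < n := by exact_mod_cast h.n_pos
  positivity

theorem Admissible.p_le_half {k : ℕ} {lam ε s : ℝ} (h : Admissible n k lam ε s) :
    lam * s / n ≤ 1 / 2 := h.p_le.trans (by linarith [h.s_mem.2])

/-- For every labeling an edge of the union contributes at most (kλ/n) s + p = (k + 1) p, and any
other edge contributes 1. -/
theorem abs_moment_le {k : ℕ} {lam ε s : ℝ} (h : Admissible n k lam ε s)
    (X₁ X₂ Y₁ Y₂ : Finset (Pair n)) : |moment k lam ε s X₁ X₂ Y₁ Y₂| ≤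
      ((k + 1) * (lam * s / n)) ^ (X₁ ∪ X₂ ∪ Y₁ ∪ Y₂).card := by
  have : NeZero k := ⟨h.k_pos.ne'⟩
  refine abs_labelMean_le fun σ => ?_
  rw [Finset.abs_prod, ← Finset.prod_const, ← Finset.prod_subset (Finset.subset_univ
    (X₁ ∪ X₂ ∪ Y₁ ∪ Y₂))]
  · refine Finset.prod_le_prod (fun _ _ => abs_nonneg _) fun e he => ?_
    have hq := h.sbmProb_mem σ e
    refine (abs_edgeMean_le ⟨h.p_pos.le, h.p_le_half.trans (by norm_num)⟩ ⟨h.s_mem.1.le, h.s_mem.2.le⟩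
      ⟨hq.1, hq.2.2⟩ ?_).trans ?_
    · simp only [Finset.mem_union] at he
      unfold mult
      by_contra! hcon
      rcases he with ((he | he) | he) | he <;> simp [he] at hcon
    · have := mul_le_mul_of_nonneg_right hq.2.1 h.s_mem.1.le
      calc _ ≤ k * lam / n * s + lam * s / n := by linarith
        _ = _ := by ring
  · intro e _ he
    simp only [Finset.mem_union, not_or] at he
    rw [mult_eq_zero he.1.1.1 he.1.2, mult_eq_zero he.1.1.2 he.2, edgeMean_zero_zero, abs_one]

end Moments

/-! ### Moments along two and four trees -/

section MomentBounds

open scoped Classical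

variable {n : ℕ}

/-- V stands for the consequence of a leaf covered by one tree only. If the excess is above one,
both pairs meet in trees, and a pair of different trees then has such a leaf. -/
theorem four_trees_of_touch {V : Prop} {X Y Z W : Finset (Pair n)} (hX : IsTreeSet X)
    (hY : IsTreeSet Y) (hZ : IsTreeSet Z) (hW : IsTreeSet W) (hXY : X.card = Y.card)
    (hZW : Z.card = W.card)
    (vX : ∀ u e, IsLeaf X u e → u ∉ supp Y → u ∉ supp Z → u ∉ supp W → V)
    (vZ : ∀ u e, IsLeaf Z u e → u ∉ supp X → u ∉ supp Y → u ∉ supp W → V)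
    (tXY : Touch X Y) (tZ : Touch Z X ∨ Touch Z Y ∨ Touch Z W)
    (tW : Touch W X ∨ Touch W Y ∨ Touch W Z) :
    V ∨ (supp (X ∪ Y ∪ Z ∪ W)).card ≤ (X ∪ Y ∪ Z ∪ W).card + 1 ∨
      (X = Y ∧ Z = W ∧ Disjoint (supp X) (supp Z)) := by
  rcases four_trees_aux hX hY hZ hW tXY tZ tW with h | ⟨tZW, hd⟩
  · exact Or.inr (Or.inl h)
  rcases pairs_aux hX hY hZ hW tXY tZW hd with h | ⟨h1, h2⟩
  · exact Or.inr (Or.inl h)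
  have hd' := hd
  simp only [supp_union, Finset.disjoint_union_left, Finset.disjoint_union_right] at hd'
  obtain ⟨⟨dXZ, dYZ⟩, dXW, dYW⟩ := hd'
  by_cases e1 : X = Y
  · by_cases e2 : Z = W
    · exact Or.inr (Or.inr ⟨e1, e2, dXZ⟩)
    · obtain ⟨u, e, hu, huW⟩ := hZ.exists_isLeaf_notMem e2 hZW h2
      have huZ : u ∈ supp Z := mem_supp.2 ⟨e, hu.1, hu.2.1⟩
      exact Or.inl (vZ u e hu (Finset.disjoint_right.1 dXZ huZ)
        (Finset.disjoint_right.1 dYZ huZ) huW)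
  · obtain ⟨u, e, hu, huY⟩ := hX.exists_isLeaf_notMem e1 hXY h1
    have huX : u ∈ supp X := mem_supp.2 ⟨e, hu.1, hu.2.1⟩
    exact Or.inl (vX u e hu huY (Finset.disjoint_left.1 dXZ huX)
      (Finset.disjoint_left.1 dXW huX))

theorem exists_leaf_of_not_touch {X Y Z W : Finset (Pair n)} (hX : IsTreeSet X)
    (h : ¬ (Touch X Y ∨ Touch X Z ∨ Touch X W)) :
    ∃ u e, IsLeaf X u e ∧ u ∉ supp Y ∧ u ∉ supp Z ∧ u ∉ supp W := by
  simp only [Touch, not_or, not_not] at h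
  obtain ⟨u, hu, e, he⟩ := hX.exists_leaf
  exact ⟨u, e, he, Finset.disjoint_left.1 h.1 hu, Finset.disjoint_left.1 h.2.1 hu,
    Finset.disjoint_left.1 h.2.2 hu⟩

/-- Four trees of equal size: either some leaf is covered only once, or the union has excess at
most one, or the trees form two disjoint pairs of equal trees. -/
theorem four_trees {V : Prop} {X Y Z W : Finset (Pair n)} {N : ℕ} (hX : IsTreeSet X)
    (hY : IsTreeSet Y) (hZ : IsTreeSet Z) (hW : IsTreeSet W) (cX : X.card = N) (cY : Y.card = N)
    (cZ : Z.card = N) (cW : W.card = N)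
    (vX : ∀ u e, IsLeaf X u e → u ∉ supp Y → u ∉ supp Z → u ∉ supp W → V)
    (vY : ∀ u e, IsLeaf Y u e → u ∉ supp X → u ∉ supp Z → u ∉ supp W → V)
    (vZ : ∀ u e, IsLeaf Z u e → u ∉ supp X → u ∉ supp Y → u ∉ supp W → V)
    (vW : ∀ u e, IsLeaf W u e → u ∉ supp X → u ∉ supp Y → u ∉ supp Z → V) :
    V ∨ (supp (X ∪ Y ∪ Z ∪ W)).card ≤ (X ∪ Y ∪ Z ∪ W).card + 1 ∨
      (X = Y ∧ Z = W ∧ Disjoint (supp X) (supp Z)) ∨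
      (X = Z ∧ Y = W ∧ Disjoint (supp X) (supp Y)) ∨
      (X = W ∧ Y = Z ∧ Disjoint (supp X) (supp Y)) := by
  by_cases tX : Touch X Y ∨ Touch X Z ∨ Touch X W
  swap
  · obtain ⟨u, e, hu, h1, h2, h3⟩ := exists_leaf_of_not_touch hX tX
    exact Or.inl (vX u e hu h1 h2 h3)
  by_cases tY : Touch Y X ∨ Touch Y Z ∨ Touch Y W
  swap
  · obtain ⟨u, e, hu, h1, h2, h3⟩ := exists_leaf_of_not_touch hY tY
    exact Or.inl (vY u e hu h1 h2 h3)
  by_cases tZ : Touch Z X ∨ Touch Z Y ∨ Touch Z W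
  swap
  · obtain ⟨u, e, hu, h1, h2, h3⟩ := exists_leaf_of_not_touch hZ tZ
    exact Or.inl (vZ u e hu h1 h2 h3)
  by_cases tW : Touch W X ∨ Touch W Y ∨ Touch W Z
  swap
  · obtain ⟨u, e, hu, h1, h2, h3⟩ := exists_leaf_of_not_touch hW tW
    exact Or.inl (vW u e hu h1 h2 h3)
  rcases tX with t | t | t
  · rcases four_trees_of_touch hX hY hZ hW (cX.trans cY.symm) (cZ.trans cW.symm) vX vZ t tZ tW
      with h | h | h
    · exact Or.inl h
    · exact Or.inr (Or.inl h)
    · exact Or.inr (Or.inr (Or.inl h))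
  · rcases four_trees_of_touch hX hZ hY hW (cX.trans cZ.symm) (cY.trans cW.symm)
      (fun u e h h1 h2 h3 => vX u e h h2 h1 h3) vY t tY (tW.imp_right Or.symm)
      with h | h | h
    · exact Or.inl h
    · right; left
      rwa [Finset.union_right_comm X Z Y] at h
    · exact Or.inr (Or.inr (Or.inr (Or.inl h)))
  · rcases four_trees_of_touch hX hW hY hZ (cX.trans cW.symm) (cY.trans cZ.symm)
      (fun u e h h1 h2 h3 => vX u e h h2 h3 h1) (fun u e h h1 h2 h3 => vY u e h h1 h3 h2) t
      (tY.imp_right Or.symm) (tZ.imp_right Or.symm)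
      with h | h | h
    · exact Or.inl h
    · right; left
      have : X ∪ W ∪ Y ∪ Z = X ∪ Y ∪ Z ∪ W := by
        rw [Finset.union_right_comm X W Y, Finset.union_right_comm (X ∪ Y) W Z]
      rwa [this] at h
    · exact Or.inr (Or.inr (Or.inr (Or.inr h)))

theorem disjoint_of_disjoint_supp {X Y : Finset (Pair n)} (h : Disjoint (supp X) (supp Y)) :
    Disjoint X Y := by
  rw [Finset.disjoint_left]
  intro e he he'
  exact Finset.disjoint_left.1 h (mem_supp.2 ⟨e, he, Sym2.out_fst_mem _⟩)
    (mem_supp.2 ⟨e, he', Sym2.out_fst_mem _⟩)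

/-- Disjoint trees form a forest, so the labels drop out. Every edge occurs once in each graph and
contributes a covariance. -/
theorem moment_pair_one {k : ℕ} [NeZero k] (lam ε s : ℝ) {X Y : Finset (Pair n)}
    (hX : IsTreeSet X) (hY : IsTreeSet Y) (hd : Disjoint (supp X) (supp Y)) :
    moment k lam ε s X X Y Y = (lam * s / n * (s - lam * s / n)) ^ (X.card + Y.card) := by
  have hd' := disjoint_of_disjoint_supp hd
  rw [moment_eq_prod lam ε s (fun F hF hne => exists_isLeaf_of_subset_union hX hY hd hF hne)
    Finset.subset_union_left Finset.subset_union_left Finset.subset_union_right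
    Finset.subset_union_right, ← Finset.card_union_of_disjoint hd']
  refine Finset.prod_eq_pow_card fun e he => ?_
  have : mult X Y e = 1 := by
    rcases Finset.mem_union.1 he with h | h
    · simp [mult, h, Finset.disjoint_left.1 hd' h]
    · simp [mult, h, Finset.disjoint_right.1 hd' h]
  rw [this, edgeMean_one_one]

/-- Here every edge occurs twice in the same graph and contributes a variance. -/
theorem moment_pair_two {k : ℕ} [NeZero k] (lam ε s : ℝ) {X Y : Finset (Pair n)}
    (hX : IsTreeSet X) (hY : IsTreeSet Y) (hd : Disjoint (supp X) (supp Y)) :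
    moment k lam ε s X Y X Y = (lam * s / n * (1 - lam * s / n)) ^ (X.card + Y.card) := by
  have hd' := disjoint_of_disjoint_supp hd
  rw [moment_eq_prod lam ε s (fun F hF hne => exists_isLeaf_of_subset_union hX hY hd hF hne)
    Finset.subset_union_left Finset.subset_union_right Finset.subset_union_left
    Finset.subset_union_right, ← Finset.card_union_of_disjoint hd']
  refine Finset.prod_eq_pow_card fun e he => ?_
  rcases Finset.mem_union.1 he with h | h
  · have h1 : mult X X e = 2 := by simp [mult, h]
    have h2 : mult Y Y e = 0 := by simp [mult, Finset.disjoint_left.1 hd' h]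
    rw [h1, h2, edgeMean_two_zero]
  · have h1 : mult X X e = 0 := by simp [mult, Finset.disjoint_right.1 hd' h]
    have h2 : mult Y Y e = 2 := by simp [mult, h]
    rw [h1, h2, edgeMean_comm, edgeMean_two_zero]

theorem moment_single {k : ℕ} [NeZero k] (lam ε s : ℝ) {X : Finset (Pair n)}
    (hX : IsTreeSet X) :
    moment k lam ε s X X ∅ ∅ = (lam * s / n * (s - lam * s / n)) ^ X.card := by
  rw [moment_eq_prod lam ε s (U := X) (fun F hF hne => by
    obtain ⟨u, _, e, h⟩ := hX.exists_isLeaf_of_subset hF hne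
    exact ⟨u, e, h⟩) subset_rfl subset_rfl (Finset.empty_subset _) (Finset.empty_subset _)]
  refine Finset.prod_eq_pow_card fun e he => ?_
  have : mult X ∅ e = 1 := by simp [mult, he]
  rw [this, edgeMean_one_one]

theorem supp_empty : supp (∅ : Finset (Pair n)) = ∅ := by simp [supp]

/-- The first moment along two different trees of the same size. -/
theorem abs_moment_two_le {k : ℕ} {lam ε s : ℝ} (h : Admissible n k lam ε s)
    {X Y : Finset (Pair n)} (hX : IsTreeSet X) (hY : IsTreeSet Y) (hc : X.card = Y.card)
    (hne : X ≠ Y) : |moment k lam ε s X Y ∅ ∅| ≤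
      if (supp (X ∪ Y)).card ≤ (X ∪ Y).card then ((k + 1) * (lam * s / n)) ^ (X ∪ Y).card
      else 0 := by
  have : NeZero k := ⟨h.k_pos.ne'⟩
  have hu : ∀ u : Fin n, u ∉ supp (∅ : Finset (Pair n)) := fun u => by simp [supp_empty]
  split_ifs with hcard
  · simpa using abs_moment_le h X Y ∅ ∅
  · refine (abs_eq_zero.2 ?_).le
    by_cases t : Touch X Y
    -- Touching trees whose union still has more vertices than edges meet in a tree, so X has a leaf
    -- outside Y.
    · obtain ⟨u, e, he, huY⟩ := hX.exists_isLeaf_notMem hne hc (by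
        have h2 := Finset.card_union_add_card_inter X Y
        have h3 := Finset.card_union_add_card_inter (supp X) (supp Y)
        have h4 := hX.card_supp
        have h5 := hY.card_supp
        rw [supp_union] at hcard
        omega)
      exact moment_eq_zero_of_isLeaf lam ε s he huY (hu u) (hu u)
    · obtain ⟨u, hu', e, he⟩ := hX.exists_leaf
      exact moment_eq_zero_of_isLeaf lam ε s he
        (Finset.disjoint_left.1 (not_not.1 t) hu') (hu u) (hu u)

/-- The second moment along four trees of the same size. -/
theorem moment_four_le {k : ℕ} {lam ε s : ℝ} (h : Admissible n k lam ε s) {N : ℕ}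
    {X₁ X₂ Y₁ Y₂ : Finset (Pair n)} (hX₁ : IsTreeSet X₁) (hX₂ : IsTreeSet X₂)
    (hY₁ : IsTreeSet Y₁) (hY₂ : IsTreeSet Y₂) (c₁ : X₁.card = N) (c₂ : X₂.card = N)
    (d₁ : Y₁.card = N) (d₂ : Y₂.card = N) :
    moment k lam ε s X₁ X₂ Y₁ Y₂ ≤
      (if X₁ = X₂ ∧ Y₁ = Y₂ then (lam * s / n * (s - lam * s / n)) ^ (N + N) else 0) +
      (if X₁ = Y₁ ∧ X₂ = Y₂ then (lam * s / n * (1 - lam * s / n)) ^ (N + N) else 0) +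
      (if X₁ = Y₂ ∧ X₂ = Y₁ then (lam * s / n * (1 - lam * s / n)) ^ (N + N) else 0) +
      if (supp (X₁ ∪ X₂ ∪ Y₁ ∪ Y₂)).card ≤ (X₁ ∪ X₂ ∪ Y₁ ∪ Y₂).card + 1 then
        ((k + 1) * (lam * s / n)) ^ (X₁ ∪ X₂ ∪ Y₁ ∪ Y₂).card else 0 := by
  have : NeZero k := ⟨h.k_pos.ne'⟩
  have hp := h.p_pos
  have hps : 0 ≤ s - lam * s / n := by linarith [h.p_le, h.s_mem.1]
  have hp1 : 0 ≤ 1 - lam * s / n := by linarith [h.p_le_half]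
  have n1 : 0 ≤ (if X₁ = X₂ ∧ Y₁ = Y₂ then (lam * s / n * (s - lam * s / n)) ^ (N + N)
    else 0) := by split_ifs <;> positivity
  have n2 : 0 ≤ (if X₁ = Y₁ ∧ X₂ = Y₂ then (lam * s / n * (1 - lam * s / n)) ^ (N + N)
    else 0) := by split_ifs <;> positivity
  have n3 : 0 ≤ (if X₁ = Y₂ ∧ X₂ = Y₁ then (lam * s / n * (1 - lam * s / n)) ^ (N + N)
    else 0) := by split_ifs <;> positivity
  have n4 : 0 ≤ (if (supp (X₁ ∪ X₂ ∪ Y₁ ∪ Y₂)).card ≤ (X₁ ∪ X₂ ∪ Y₁ ∪ Y₂).card + 1 then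
        ((k + 1) * (lam * s / n)) ^ (X₁ ∪ X₂ ∪ Y₁ ∪ Y₂).card else 0) := by
    split_ifs <;> positivity
  rcases four_trees (V := moment k lam ε s X₁ X₂ Y₁ Y₂ = 0) hX₁ hX₂ hY₁ hY₂ c₁ c₂ d₁ d₂
    (fun u e he h1 h2 h3 => moment_eq_zero_of_isLeaf lam ε s he h1 h2 h3)
    (fun u e he h1 h2 h3 => by
      rw [moment_swap]; exact moment_eq_zero_of_isLeaf lam ε s he h1 h3 h2)
    (fun u e he h1 h2 h3 => by
      rw [moment_swap_left]; exact moment_eq_zero_of_isLeaf lam ε s he h2 h1 h3)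
    (fun u e he h1 h2 h3 => by
      rw [moment_swap_right, moment_swap]; exact moment_eq_zero_of_isLeaf lam ε s he h1 h2 h3)
    with h0 | h0 | ⟨e1, e2, hd⟩ | ⟨e1, e2, hd⟩ | ⟨e1, e2, hd⟩
  · rw [h0]; linarith
  · have := (le_abs_self _).trans (abs_moment_le h X₁ X₂ Y₁ Y₂)
    rw [if_pos h0]
    linarith
  · have h1 : moment k lam ε s X₁ X₂ Y₁ Y₂ = (lam * s / n * (s - lam * s / n)) ^ (N + N) := by
      rw [← e1, ← e2, moment_pair_one lam ε s hX₁ hY₁ hd, c₁, d₁]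
    rw [if_pos ⟨e1, e2⟩]
    linarith
  · have h1 : moment k lam ε s X₁ X₂ Y₁ Y₂ = (lam * s / n * (1 - lam * s / n)) ^ (N + N) := by
      rw [← e1, ← e2, moment_pair_two lam ε s hX₁ hX₂ hd, c₁, c₂]
    rw [if_pos (show X₁ = Y₁ ∧ X₂ = Y₂ from ⟨e1, e2⟩)]
    linarith
  -- The crossed pairing again gives covariances; they are relaxed to variances through s ≤ 1, so
  -- that this case costs the same as the previous one.
  · have h1 : moment k lam ε s X₁ X₂ Y₁ Y₂ ≤ (lam * s / n * (1 - lam * s / n)) ^ (N + N) := by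
      rw [← e1, ← e2, moment_swap_right, moment_pair_one lam ε s hX₁ hX₂ hd, c₁, c₂]
      gcongr
      exact h.s_mem.2.le
    rw [if_pos (show X₁ = Y₂ ∧ X₂ = Y₁ from ⟨e1, e2⟩)]
    linarith

end MomentBounds

/-! ### Copies of a tree -/

/-- An acyclic graph extends to a spanning tree of the complete graph. -/
theorem card_edgeFinset_le_of_isAcyclic {V : Type*} [Fintype V] [Nonempty V]
    {G : SimpleGraph V} [Fintype G.edgeSet] (hG : G.IsAcyclic) :
    G.edgeFinset.card + 1 ≤ Fintype.card V := by
  classical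
  obtain ⟨T, hT, -, hT'⟩ :=
    SimpleGraph.connected_top.exists_isTree_le_of_le_of_isAcyclic (le_top : G ≤ ⊤) hG
  rw [← hT'.card_edgeFinset]
  exact Nat.succ_le_succ (Finset.card_le_card (SimpleGraph.edgeFinset_mono hT))

section Copies

open scoped Classical

variable {n m N : ℕ}

theorem mem_copies {H : SimpleGraph (Fin m)} {X : Sub n} :
    X ∈ copies n H ↔ Nonempty (X.coe ≃g H) := by
  simp [copies]

theorem mem_edges {X : Sub n} {e : Pair n} :
    e ∈ X.edges ↔ e.1 ∈ SimpleGraph.Subgraph.edgeSet X := by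
  simp [Sub.edges]

theorem mem_verts_of_mem_edges {X : Sub n} {e : Pair n} (he : e ∈ X.edges) {v : Fin n}
    (hv : v ∈ e.1) : v ∈ X.verts :=
  X.mem_verts_of_mem_edge (mem_edges.1 he) hv

theorem supp_subset_verts (X : Sub n) : (supp X.edges : Set (Fin n)) ⊆ X.verts := by
  intro v hv
  obtain ⟨e, he, hve⟩ := mem_supp.1 hv
  exact mem_verts_of_mem_edges he hve

/-- The edges in F, as a graph on their support, inject into the acyclic graph X, so the edge count
of a forest applies. -/
theorem sparse_of_isAcyclic {X : Sub n} (hX : X.coe.IsAcyclic) {F : Finset (Pair n)}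
    (hF : F ⊆ X.edges) (hne : F.Nonempty) : F.card + 1 ≤ (supp F).card := by
  let G : SimpleGraph (supp F) :=
    (SimpleGraph.fromEdgeSet (Subtype.val '' (F : Set (Pair n)))).comap Subtype.val
  have hadj : ∀ a b : supp F, G.Adj a b → X.Adj a b := by
    intro a b hab
    obtain ⟨⟨e, he, hee⟩, -⟩ := (SimpleGraph.fromEdgeSet_adj _).1 hab
    have := mem_edges.1 (hF he)
    rwa [hee] at this
  have hG : G.IsAcyclic := by
    refine hX.comap (⟨fun a => ⟨a, supp_subset_verts X (supp_mono hF a.2)⟩,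
      fun {a b} hab => hadj a b hab⟩ : G →g X.coe) fun a b hab => ?_
    exact Subtype.ext (congrArg (fun x : X.verts => (x : Fin n)) hab)
  have : Nonempty (supp F) := by
    obtain ⟨e, he⟩ := hne
    exact ⟨⟨_, mem_supp.2 ⟨e, he, Sym2.out_fst_mem _⟩⟩⟩
  have h1 := card_edgeFinset_le_of_isAcyclic hG
  rw [Fintype.card_coe] at h1
  refine le_trans (Nat.succ_le_succ ?_) h1
  have h2 : F.image Subtype.val ⊆ G.edgeFinset.image (Sym2.map Subtype.val) := by
    intro e he
    obtain ⟨⟨e, he'⟩, heF, rfl⟩ := Finset.mem_image.1 he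
    induction e with
    | h a b =>
      refine Finset.mem_image.2 ⟨s(⟨a, mem_supp.2 ⟨_, heF, Sym2.mem_mk_left a b⟩⟩,
        ⟨b, mem_supp.2 ⟨_, heF, Sym2.mem_mk_right a b⟩⟩), ?_, rfl⟩
      rw [SimpleGraph.mem_edgeFinset, SimpleGraph.mem_edgeSet]
      refine (SimpleGraph.fromEdgeSet_adj _).2 ⟨⟨_, heF, rfl⟩, fun h => he' ?_⟩
      simpa using h
  calc F.card = (F.image Subtype.val).card :=
        (Finset.card_image_of_injective _ Subtype.val_injective).symm
    _ ≤ _ := Finset.card_le_card h2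
    _ ≤ _ := Finset.card_image_le

theorem card_verts_of_mem_copies {H : SimpleGraph (Fin m)} {X : Sub n} (hX : X ∈ copies n H) :
    X.verts.toFinset.card = m := by
  obtain ⟨φ⟩ := mem_copies.1 hX
  rw [Set.toFinset_card, Fintype.card_congr φ.toEquiv, Fintype.card_fin]

/-- A squeeze: there are at least N edges, sparsity puts their number plus one below the size of the
support, and the support lies among N + 1 vertices. The condition 1 ≤ N excludes the single vertex,
which its edge set does not determine. -/
theorem edges_of_mem_copies {H : SimpleGraph (Fin (N + 1))} (hH : H.IsTree) (hN : 1 ≤ N)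
    {X : Sub n} (hX : X ∈ copies n H) :
    IsTreeSet X.edges ∧ X.edges.card = N ∧ supp X.edges = X.verts.toFinset := by
  have hcv := card_verts_of_mem_copies hX
  obtain ⟨φ⟩ := mem_copies.1 hX
  have hT : X.coe.IsTree := φ.isTree_iff.2 hH
  have h1 : X.coe.edgeFinset.card + 1 = N + 1 := by
    rw [hT.card_edgeFinset, ← hcv, Set.toFinset_card]
  have h2 : X.coe.edgeFinset.image (Sym2.map Subtype.val) ⊆ X.edges.image Subtype.val := by
    intro e he
    obtain ⟨e, hae, rfl⟩ := Finset.mem_image.1 he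
    clear he
    induction e with
    | h a b =>
      rw [SimpleGraph.mem_edgeFinset, SimpleGraph.mem_edgeSet] at hae
      have hab : X.Adj a b := hae
      exact Finset.mem_image.2 ⟨⟨s((a : Fin n), b), fun h => hab.ne (by simpa using h)⟩,
        mem_edges.2 hab, rfl⟩
  have h3 : N ≤ X.edges.card := by
    have := Finset.card_le_card h2
    rw [Finset.card_image_of_injective _ (Sym2.map.injective Subtype.val_injective),
      Finset.card_image_of_injective _ Subtype.val_injective] at this
    omega
  have hne : X.edges.Nonempty := Finset.card_pos.1 (by omega)
  have h4 := sparse_of_isAcyclic hT.isAcyclic subset_rfl hne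
  have h5 : supp X.edges ⊆ X.verts.toFinset := fun v hv =>
    Set.mem_toFinset.2 (supp_subset_verts X hv)
  have h6 := Finset.card_le_card h5
  refine ⟨⟨hne, by omega, fun F hF hF' => sparse_of_isAcyclic hT.isAcyclic hF hF'⟩, by omega,
    Finset.eq_of_subset_of_card_le h5 (by omega)⟩

theorem adj_iff_mem_edges {X : Sub n} {a b : Fin n} :
    X.Adj a b ↔ ∃ e ∈ X.edges, e.1 = s(a, b) := by
  constructor
  · intro h
    exact ⟨⟨s(a, b), fun h' => h.ne (by simpa using h')⟩, mem_edges.2 h, rfl⟩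
  · rintro ⟨e, he, hab⟩
    have := mem_edges.1 he
    rwa [hab] at this

theorem sub_ext_of_edges {X Y : Sub n} (hv : X.verts = Y.verts) (he : X.edges = Y.edges) :
    X = Y := by
  refine SimpleGraph.Subgraph.ext hv ?_
  ext a b
  rw [adj_iff_mem_edges, adj_iff_mem_edges, he]

theorem eq_of_edges_eq {H I : SimpleGraph (Fin (N + 1))} (hH : H.IsTree) (hI : I.IsTree)
    (hN : 1 ≤ N) {X Y : Sub n} (hX : X ∈ copies n H) (hY : Y ∈ copies n I)
    (h : X.edges = Y.edges) : X = Y := by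
  refine sub_ext_of_edges ?_ h
  have h1 := (edges_of_mem_copies hH hN hX).2.2
  have h2 := (edges_of_mem_copies hI hN hY).2.2
  exact Set.toFinset_inj.1 (by rw [← h1, ← h2, h])

theorem UnlabeledTree.graph_isTree (H : UnlabeledTree N) : H.graph.IsTree := (Quotient.out H).2

theorem UnlabeledTree.eq_of_iso {H I : UnlabeledTree N} (h : Nonempty (H.graph ≃g I.graph)) :
    H = I := by
  rw [← Quotient.out_eq H, ← Quotient.out_eq I]
  exact Quotient.sound h

theorem eq_of_mem_copies {H I : UnlabeledTree N} {X : Sub n} (hH : X ∈ copies n H.graph)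
    (hI : X ∈ copies n I.graph) : H = I := by
  obtain ⟨φ⟩ := mem_copies.1 hH
  obtain ⟨ψ⟩ := mem_copies.1 hI
  exact UnlabeledTree.eq_of_iso ⟨φ.symm.trans ψ⟩

/-- The image of a graph under an injective map of its vertices, as a subgraph of the complete
graph. -/
def mapSub (H : SimpleGraph (Fin m)) (f : Fin m ↪ Fin n) : Sub n where
  verts := Set.range f
  Adj := (H.map f).Adj
  adj_sub h := by
    rw [SimpleGraph.top_adj]
    exact h.ne
  edge_vert := by
    rintro a b h
    obtain ⟨u, v, -, rfl, -⟩ := (SimpleGraph.map_adj _ _ _ _).1 h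
    exact ⟨u, rfl⟩
  symm := (H.map f).symm

/-- A graph is isomorphic to its image. -/
def mapSubIso (H : SimpleGraph (Fin m)) (f : Fin m ↪ Fin n) : H ≃g (mapSub H f).coe where
  toEquiv := Equiv.ofInjective f f.injective
  map_rel_iff' {a b} := by
    change (H.map f).Adj (f a) (f b) ↔ H.Adj a b
    exact SimpleGraph.map_adj_apply

theorem mapSub_mem_copies (H : SimpleGraph (Fin m)) (f : Fin m ↪ Fin n) :
    mapSub H f ∈ copies n H := mem_copies.2 ⟨(mapSubIso H f).symm⟩

/-- The inclusion of a copy of `H`, as a map from `H`. -/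
def isoEmb {H : SimpleGraph (Fin m)} {X : Sub n} (φ : H ≃g X.coe) : Fin m ↪ Fin n :=
  φ.toEquiv.toEmbedding.trans (Function.Embedding.subtype _)

theorem mapSub_isoEmb {H : SimpleGraph (Fin m)} {X : Sub n} (φ : H ≃g X.coe) :
    mapSub H (isoEmb φ) = X := by
  have happ : ∀ u, isoEmb φ u = (φ u : Fin n) := fun u => rfl
  refine SimpleGraph.Subgraph.ext ?_ ?_
  · ext v
    constructor
    · rintro ⟨u, rfl⟩
      exact (φ u).2
    · intro hv
      exact ⟨φ.symm ⟨v, hv⟩, by rw [happ, φ.apply_symm_apply]⟩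
  · ext a b
    change (H.map (isoEmb φ)).Adj a b ↔ X.Adj a b
    rw [SimpleGraph.map_adj]
    constructor
    · rintro ⟨u, v, huv, rfl, rfl⟩
      exact φ.map_adj_iff.2 huv
    · intro hab
      have ha := X.edge_vert hab
      have hb := X.edge_vert hab.symm
      refine ⟨φ.symm ⟨a, ha⟩, φ.symm ⟨b, hb⟩, ?_, ?_, ?_⟩
      · rw [φ.symm.map_adj_iff]; exact hab
      · rw [happ, φ.apply_symm_apply]
      · rw [happ, φ.apply_symm_apply]

/-- The injective maps of the vertices of `H` correspond to the copies of `H` together with an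
isomorphism. -/
theorem card_copies_mul_autCount (H : SimpleGraph (Fin m)) :
    (copies n H).card * autCount H = n.descFactorial m := by
  have hmaps : ∀ f ∈ (Finset.univ : Finset (Fin m ↪ Fin n)), mapSub H f ∈ copies n H :=
    fun f _ => mapSub_mem_copies H f
  -- After one isomorphism onto X is fixed, the embeddings with image X correspond to the
  -- automorphisms of H.
  have hfib : ∀ X ∈ copies n H,
      (Finset.univ.filter fun f : Fin m ↪ Fin n => mapSub H f = X).card = autCount H := by
    intro X hX
    obtain ⟨φ⟩ := mem_copies.1 hX
    rw [autCount, ← Fintype.card_subtype, ← Nat.card_eq_fintype_card]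
    refine Nat.card_congr (Equiv.symm ?_)
    refine Equiv.ofBijective (fun ψ : H ≃g H => ⟨isoEmb (ψ.trans φ.symm), mapSub_isoEmb _⟩)
      ⟨fun ψ ψ' h => ?_, ?_⟩
    · have h1 : isoEmb (ψ.trans φ.symm) = isoEmb (ψ'.trans φ.symm) := congrArg Subtype.val h
      ext u
      have h2 : ((φ.symm (ψ u) : X.verts) : Fin n) = φ.symm (ψ' u) := DFunLike.congr_fun h1 u
      exact congrArg Fin.val (φ.symm.injective (Subtype.ext h2))
    · rintro ⟨f, rfl⟩
      refine ⟨(mapSubIso H f).trans φ, ?_⟩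
      apply Subtype.ext
      ext u
      simp only [isoEmb, mapSubIso]
      simp
      rfl
  have := Finset.card_eq_sum_card_fiberwise (f := mapSub H) (s := Finset.univ)
    (t := copies n H) fun f hf => hmaps f hf
  rw [Finset.sum_congr rfl hfib, Finset.sum_const, smul_eq_mul] at this
  rw [← this, Finset.card_univ, Fintype.card_embedding_eq, Fintype.card_fin, Fintype.card_fin]

/-- The image of a subgraph under a permutation of the vertices. -/
def permSub (π : Equiv.Perm (Fin n)) (X : Sub n) : Sub n where
  verts := π.symm ⁻¹' X.verts
  Adj a b := X.Adj (π.symm a) (π.symm b)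
  adj_sub h := by
    rw [SimpleGraph.top_adj]
    intro hab
    exact h.ne (by rw [hab])
  edge_vert h := X.edge_vert h
  symm := ⟨fun _ _ h => X.adj_symm h⟩

theorem permSub_permSub_symm (π : Equiv.Perm (Fin n)) (X : Sub n) :
    permSub π (permSub π.symm X) = X := by
  refine SimpleGraph.Subgraph.ext ?_ ?_
  · ext v; simp [permSub]
  · ext a b; simp [permSub]

theorem permSub_mem_copies (π : Equiv.Perm (Fin n)) {H : SimpleGraph (Fin m)} {X : Sub n}
    (hX : X ∈ copies n H) : permSub π X ∈ copies n H := by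
  obtain ⟨φ⟩ := mem_copies.1 hX
  let ψ : (permSub π X).coe ≃g X.coe :=
    { toEquiv := π.symm.subtypeEquiv fun a => Iff.rfl
      map_rel_iff' := Iff.rfl }
  exact mem_copies.2 ⟨ψ.trans φ⟩

theorem edges_permSub (π : Equiv.Perm (Fin n)) (X : Sub n) :
    (permSub π X).edges = X.edges.map (Pair.permEquiv π).toEmbedding := by
  ext e
  rw [Finset.mem_map_equiv, mem_edges, mem_edges]
  obtain ⟨e, he⟩ := e
  induction e with
  | h a b => exact Iff.rfl

theorem sum_copies_perm (π : Equiv.Perm (Fin n)) (H : SimpleGraph (Fin m))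
    (g : Finset (Pair n) → ℝ) :
    ∑ X ∈ copies n H, g (X.edges.map (Pair.permEquiv π).toEmbedding) =
      ∑ X ∈ copies n H, g X.edges := by
  refine Finset.sum_nbij' (permSub π) (permSub π.symm) (fun X hX => permSub_mem_copies π hX)
    (fun X hX => permSub_mem_copies π.symm hX) (fun X _ => ?_) (fun X _ => ?_) fun X _ => ?_
  · simpa using permSub_permSub_symm π.symm X
  · exact permSub_permSub_symm π X
  · rw [edges_permSub]

end Copies

/-! ### Moments of the statistic -/

section Statistic

open scoped Classical

variable {n N k : ℕ}

/-- The index set of the sum defining the statistic. -/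
def index (n N : ℕ) : Finset ((_ : UnlabeledTree N) × (Sub n × Sub n)) :=
  Finset.univ.sigma fun H => copies n H.graph ×ˢ copies n H.graph

theorem mem_index {x : (_ : UnlabeledTree N) × (Sub n × Sub n)} :
    x ∈ index n N ↔ x.2.1 ∈ copies n x.1.graph ∧ x.2.2 ∈ copies n x.1.graph := by
  simp [index]

/-- The weight of a tree in the statistic. -/
def weight (n N : ℕ) (s : ℝ) (H : UnlabeledTree N) : ℝ :=
  s ^ N / ((copies n H.graph).card : ℝ)

/-- The product of the centered entries along a set of edges. -/
def edgeProd (p : ℝ) (F : Finset (Pair n)) (G : Graph n) : ℝ := ∏ e ∈ F, (entry G e - p)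

theorem autCount_pos {m : ℕ} (H : SimpleGraph (Fin m)) : 0 < autCount H := by
  have : Nonempty (H ≃g H) := ⟨SimpleGraph.Iso.refl⟩
  have : Finite (H ≃g H) := Finite.of_injective (fun φ : H ≃g H => (φ : Fin m → Fin m))
    DFunLike.coe_injective
  exact Nat.card_pos

theorem card_copies_pos (hn : N + 1 ≤ n) (H : SimpleGraph (Fin (N + 1))) :
    0 < (copies n H).card := by
  have h := card_copies_mul_autCount (n := n) H
  have : 0 < n.descFactorial (N + 1) := Nat.descFactorial_pos.2 hn
  rw [← h] at this
  exact Nat.pos_of_mul_pos_right this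

/-- The embeddings of H number n!/(n - N - 1)!, and also the number of copies times that of
automorphisms; the prefactor is therefore s^N per copy count. -/
theorem coeff_eq_weight (hn : N + 1 ≤ n) (s : ℝ) (H : UnlabeledTree N) :
    s ^ N * (autCount H.graph : ℝ) * ((n - N - 1).factorial : ℝ) / (n.factorial : ℝ) =
      weight n N s H := by
  have h := card_copies_mul_autCount (n := n) H.graph
  have h2 := Nat.factorial_mul_descFactorial hn
  have h3 := card_copies_pos hn H.graph
  rw [← h] at h2
  have h4 : (n.factorial : ℝ) = ((n - N - 1).factorial : ℝ) *
      (((copies n H.graph).card : ℝ) * (autCount H.graph : ℝ)) := by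
    rw [← h2]
    push_cast
    rfl
  have h5 : (0 : ℝ) < (copies n H.graph).card := by exact_mod_cast h3
  have h6 : (0 : ℝ) < autCount H.graph := by exact_mod_cast autCount_pos H.graph
  have h7 : (0 : ℝ) < (n - N - 1).factorial := by exact_mod_cast Nat.factorial_pos _
  rw [weight, h4]
  field_simp

theorem index_edges (hN : 1 ≤ N) {x : (_ : UnlabeledTree N) × (Sub n × Sub n)}
    (hx : x ∈ index n N) : IsTreeSet x.2.1.edges ∧ IsTreeSet x.2.2.edges ∧
      x.2.1.edges.card = N ∧ x.2.2.edges.card = N := by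
  obtain ⟨h1, h2⟩ := mem_index.1 hx
  have e1 := edges_of_mem_copies x.1.graph_isTree hN h1
  have e2 := edges_of_mem_copies x.1.graph_isTree hN h2
  exact ⟨e1.1, e2.1, e1.2.1, e2.2.1⟩

theorem treeStat_eq_sum (hN : 1 ≤ N) (lam s : ℝ) (A B : Graph n) :
    treeStat n N lam s (A, B) = ∑ x ∈ index n N,
      (s ^ N * (autCount x.1.graph : ℝ) * ((n - N - 1).factorial : ℝ) / (n.factorial : ℝ) *
        ((lam * s / n) * (1 - lam * s / n)) ^ (-(N : ℝ))) *
        (edgeProd (lam * s / n) x.2.1.edges A * edgeProd (lam * s / n) x.2.2.edges B) := by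
  rw [treeStat, treePoly, index, Finset.sum_sigma]
  refine Finset.sum_congr rfl fun H _ => ?_
  rw [Finset.sum_product, Finset.mul_sum]
  refine Finset.sum_congr rfl fun X hX => ?_
  rw [Finset.mul_sum]
  refine Finset.sum_congr rfl fun Y hY => ?_
  have e1 := edges_of_mem_copies H.graph_isTree hN hX
  have e2 := edges_of_mem_copies H.graph_isTree hN hY
  rw [phi, e1.2.1, e2.2.1, add_self_div_two]
  simp only [edgeProd]
  ring

/-- The coefficient of a term of the statistic. -/
def coeff (n : ℕ) {N : ℕ} (lam s : ℝ) (x : (_ : UnlabeledTree N) × (Sub n × Sub n)) : ℝ :=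
  weight n N s x.1 * (((lam * s / n) * (1 - lam * s / n)) ^ N)⁻¹

theorem treeStat_eq (hN : 1 ≤ N) (hn : N + 1 ≤ n) {lam s : ℝ}
    (hp : 0 ≤ lam * s / n ∧ lam * s / n ≤ 1) (A B : Graph n) :
    treeStat n N lam s (A, B) = ∑ x ∈ index n N, coeff n lam s x *
        (edgeProd (lam * s / n) x.2.1.edges A * edgeProd (lam * s / n) x.2.2.edges B) := by
  rw [treeStat_eq_sum hN]
  refine Finset.sum_congr rfl fun x _ => ?_
  rw [coeff_eq_weight hn, coeff, Real.rpow_neg (mul_nonneg hp.1 (by linarith [hp.2])),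
    Real.rpow_natCast]

/-- A relabeling of the second graph permutes the copies of each tree. This is the invariance that
removes π from planted expectations. -/
theorem treeStat_perm (hN : 1 ≤ N) (lam s : ℝ) (A B : Graph n) (π : Equiv.Perm (Fin n)) :
    treeStat n N lam s (A, fun e => B (e.perm π)) = treeStat n N lam s (A, B) := by
  have h : ∀ F : Finset (Pair n), edgeProd (lam * s / n) F (fun e => B (e.perm π)) =
      edgeProd (lam * s / n) (F.map (Pair.permEquiv π).toEmbedding) B := by
    intro F
    rw [edgeProd, edgeProd, Finset.prod_map]
    rfl
  rw [treeStat_eq_sum hN, treeStat_eq_sum hN, index, Finset.sum_sigma, Finset.sum_sigma]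
  refine Finset.sum_congr rfl fun H _ => ?_
  rw [Finset.sum_product, Finset.sum_product]
  refine Finset.sum_congr rfl fun X _ => ?_
  simp only [h]
  exact sum_copies_perm π H.graph fun F =>
    (s ^ N * (autCount H.graph : ℝ) * ((n - N - 1).factorial : ℝ) / (n.factorial : ℝ) *
        ((lam * s / n) * (1 - lam * s / n)) ^ (-(N : ℝ))) *
        (edgeProd (lam * s / n) X.edges A * edgeProd (lam * s / n) F B)

theorem edgeProd_mul (p : ℝ) (X₁ X₂ Y₁ Y₂ : Finset (Pair n)) (A B : Graph n) :
    ∏ e, edgeFactor p (mult X₁ Y₁ e) (mult X₂ Y₂ e) (A e) (B e) =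
      (edgeProd p X₁ A * edgeProd p X₂ B) * (edgeProd p Y₁ A * edgeProd p Y₂ B) := by
  simp only [edgeFactor, Finset.prod_mul_distrib, prod_mult, edgeProd]
  ring

theorem integral_lawP_treeStat (hN : 1 ≤ N) (hn : N + 1 ≤ n) {lam ε s : ℝ}
    (h : Admissible n k lam ε s) : ∫ x, treeStat n N lam s x ∂(lawP n k lam ε s) =
      ∑ x ∈ index n N, coeff n lam s x *
        moment k lam ε s x.2.1.edges x.2.2.edges ∅ ∅ := by
  have : NeZero k := ⟨h.k_pos.ne'⟩
  have hp : 0 ≤ lam * s / n ∧ lam * s / n ≤ 1 := ⟨h.p_pos.le, h.p_le_half.trans (by norm_num)⟩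
  refine integral_lawP_sum ⟨h.s_mem.1.le, h.s_mem.2.le⟩
    (fun σ e => ⟨(h.sbmProb_mem σ e).1, (h.sbmProb_mem σ e).2.2⟩) _ (coeff n lam s)
    (fun x e => edgeFactor (lam * s / n) (mult x.2.1.edges ∅ e) (mult x.2.2.edges ∅ e))
    _ (fun A B => ?_) fun A B π => treeStat_perm hN lam s A B π
  rw [treeStat_eq hN hn hp]
  refine Finset.sum_congr rfl fun x _ => ?_
  rw [edgeProd_mul]
  simp [edgeProd]

theorem treeStat_sq (hN : 1 ≤ N) (hn : N + 1 ≤ n) {lam s : ℝ}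
    (hp : 0 ≤ lam * s / n ∧ lam * s / n ≤ 1) (A B : Graph n) :
    treeStat n N lam s (A, B) ^ 2 = ∑ x ∈ index n N ×ˢ index n N,
      (coeff n lam s x.1 * coeff n lam s x.2) *
        ∏ e, edgeFactor (lam * s / n) (mult x.1.2.1.edges x.2.2.1.edges e)
          (mult x.1.2.2.edges x.2.2.2.edges e) (A e) (B e) := by
  rw [treeStat_eq hN hn hp, sq, Finset.sum_mul_sum, Finset.sum_product]
  refine Finset.sum_congr rfl fun x _ => Finset.sum_congr rfl fun y _ => ?_
  rw [edgeProd_mul]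
  ring

theorem integral_lawP_treeStat_sq (hN : 1 ≤ N) (hn : N + 1 ≤ n) {lam ε s : ℝ}
    (h : Admissible n k lam ε s) : ∫ x, treeStat n N lam s x ^ 2 ∂(lawP n k lam ε s) =
      ∑ x ∈ index n N ×ˢ index n N, (coeff n lam s x.1 * coeff n lam s x.2) *
        moment k lam ε s x.1.2.1.edges x.1.2.2.edges x.2.2.1.edges x.2.2.2.edges := by
  have : NeZero k := ⟨h.k_pos.ne'⟩
  have hp : 0 ≤ lam * s / n ∧ lam * s / n ≤ 1 := ⟨h.p_pos.le, h.p_le_half.trans (by norm_num)⟩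
  have hq : ∀ (σ : Fin n → Fin k) e, 0 ≤ sbmProb lam ε σ e ∧ sbmProb lam ε σ e ≤ 1 := fun σ e =>
    ⟨(h.sbmProb_mem σ e).1, (h.sbmProb_mem σ e).2.2⟩
  exact integral_lawP_sum ⟨h.s_mem.1.le, h.s_mem.2.le⟩ hq (index n N ×ˢ index n N)
    (fun x => coeff n lam s x.1 * coeff n lam s x.2)
    (fun x e => edgeFactor (lam * s / n) (mult x.1.2.1.edges x.2.2.1.edges e)
          (mult x.1.2.2.edges x.2.2.2.edges e))
    (fun x => treeStat n N lam s x ^ 2) (fun A B => treeStat_sq hN hn hp A B)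
    fun A B π => congrArg (fun t : ℝ => t ^ 2) (treeStat_perm hN lam s A B π)

theorem integral_lawQ_treeStat (hN : 1 ≤ N) {lam s : ℝ}
    (hp : 0 ≤ lam * s / n ∧ lam * s / n ≤ 1) :
    ∫ x, treeStat n N lam s x ∂(lawQ n lam s) = 0 := by
  have h1 : ∀ x : Graph n × Graph n, treeStat n N lam s x = _ := fun x =>
    treeStat_eq_sum hN lam s x.1 x.2
  simp_rw [h1]
  rw [integral_finsetSum _ fun _ _ => Integrable.of_finite]
  refine Finset.sum_eq_zero fun x hx => ?_
  rw [integral_const_mul]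
  have h2 : ∀ (F : Finset (Pair n)) (G : Graph n), edgeProd (lam * s / n) F G =
      ∏ e, (bit (G e) - lam * s / n) ^ mult F ∅ e := by
    intro F G
    rw [prod_mult]
    simp [edgeProd]
  simp_rw [h2]
  rw [integral_lawQ_prod hp (fun e b => (bit b - lam * s / n) ^ mult x.2.1.edges ∅ e)
    fun e b => (bit b - lam * s / n) ^ mult x.2.2.edges ∅ e]
  obtain ⟨e, he⟩ := (index_edges hN hx).1.nonempty
  rw [Finset.prod_eq_zero (Finset.mem_univ e), zero_mul, mul_zero]
  simp [mult, he, bit]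
  ring

/-- Orthogonality of the edge products: if two sets of equal size differ, some edge of X is missing
from Y, and its centered factor occurs once. -/
theorem prod_mult_mean {p : ℝ} {X Y : Finset (Pair n)} (hc : X.card = N) (hXY : Y.card = N) :
    ∏ e, (p * (bit true - p) ^ mult X Y e + (1 - p) * (bit false - p) ^ mult X Y e) =
      if X = Y then (p * (1 - p)) ^ N else 0 := by
  split_ifs with h
  · subst h
    rw [← Finset.prod_subset (Finset.subset_univ X), ← hc]
    · refine Finset.prod_eq_pow_card fun e he => ?_
      simp only [mult, he, if_true, bit]
      simp
      ring
    · intro e _ he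
      simp [mult, he]
  · obtain ⟨e, he⟩ : (X \ Y).Nonempty := by
      rw [Finset.sdiff_nonempty]
      exact fun hsub => h (Finset.eq_of_subset_of_card_le hsub (by omega))
    rw [Finset.mem_sdiff] at he
    refine Finset.prod_eq_zero (Finset.mem_univ e) ?_
    simp [mult, he.1, he.2, bit]
    ring

theorem integral_lawQ_treeStat_sq (hN : 1 ≤ N) (hn : N + 1 ≤ n) {lam s : ℝ}
    (hp : 0 ≤ lam * s / n ∧ lam * s / n ≤ 1) :
    ∫ x, treeStat n N lam s x ^ 2 ∂(lawQ n lam s) =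
      ∑ x ∈ index n N ×ˢ index n N, (coeff n lam s x.1 * coeff n lam s x.2) *
        if x.1.2.1.edges = x.2.2.1.edges ∧ x.1.2.2.edges = x.2.2.2.edges then
          (lam * s / n * (1 - lam * s / n)) ^ (N + N) else 0 := by
  have h1 : ∀ x : Graph n × Graph n, treeStat n N lam s x ^ 2 = _ := fun x =>
    treeStat_sq hN hn hp x.1 x.2
  simp_rw [h1]
  rw [integral_finsetSum _ fun _ _ => Integrable.of_finite]
  refine Finset.sum_congr rfl fun x hx => ?_
  rw [integral_const_mul]
  congr 1
  simp only [edgeFactor, Finset.prod_mul_distrib]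
  rw [integral_lawQ_prod hp
    (fun e b => (bit b - lam * s / n) ^ mult x.1.2.1.edges x.2.2.1.edges e)
    fun e b => (bit b - lam * s / n) ^ mult x.1.2.2.edges x.2.2.2.edges e]
  obtain ⟨hx1, hx2⟩ := Finset.mem_product.1 hx
  obtain ⟨-, -, c1, c2⟩ := index_edges hN hx1
  obtain ⟨-, -, d1, d2⟩ := index_edges hN hx2
  rw [prod_mult_mean c1 d1, prod_mult_mean c2 d2]
  by_cases e1 : x.1.2.1.edges = x.2.2.1.edges <;> by_cases e2 : x.1.2.2.edges = x.2.2.2.edges <;>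
    simp [e1, e2, pow_add]

end Statistic

/-! ### Leading terms of the mean and of the second moments -/

section MainTerms

open scoped Classical

variable {n N k : ℕ}

theorem weight_mul_card (hn : N + 1 ≤ n) (s : ℝ) (H : UnlabeledTree N) :
    weight n N s H * ((copies n H.graph).card : ℝ) = s ^ N := by
  have : ((copies n H.graph).card : ℝ) ≠ 0 := by exact_mod_cast (card_copies_pos hn _).ne'
  rw [weight, div_mul_cancel₀ _ this]

theorem index_ext (hN : 1 ≤ N) {x y : (_ : UnlabeledTree N) × (Sub n × Sub n)}
    (hx : x ∈ index n N) (hy : y ∈ index n N) (h1 : x.2.1.edges = y.2.1.edges)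
    (h2 : x.2.2.edges = y.2.2.edges) : x = y := by
  obtain ⟨H, X₁, X₂⟩ := x
  obtain ⟨I, Y₁, Y₂⟩ := y
  obtain ⟨hx1, hx2⟩ := mem_index.1 hx
  obtain ⟨hy1, hy2⟩ := mem_index.1 hy
  obtain rfl : X₁ = Y₁ := eq_of_edges_eq H.graph_isTree I.graph_isTree hN hx1 hy1 h1
  obtain rfl : X₂ = Y₂ := eq_of_edges_eq H.graph_isTree I.graph_isTree hN hx2 hy2 h2
  obtain rfl : H = I := eq_of_mem_copies hx1 hy1
  rfl

/-- For each tree there are as many diagonal pairs as copies, which cancels the denominator of the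
weight. -/
theorem sum_weight_diag (hN : 1 ≤ N) (hn : N + 1 ≤ n) (s : ℝ) :
    ∑ x ∈ index n N, (if x.2.1.edges = x.2.2.edges then weight n N s x.1 else 0) =
      Fintype.card (UnlabeledTree N) * s ^ N := by
  rw [index, Finset.sum_sigma]
  have : ∀ H : UnlabeledTree N, ∑ X ∈ copies n H.graph ×ˢ copies n H.graph,
      (if X.1.edges = X.2.edges then weight n N s H else 0) = s ^ N := by
    intro H
    rw [Finset.sum_product, ← weight_mul_card hn s H, mul_comm, ← nsmul_eq_mul,
      ← Finset.sum_const]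
    refine Finset.sum_congr rfl fun X hX => ?_
    rw [Finset.sum_eq_single X]
    · simp
    · intro Y hY hne
      exact if_neg fun h => hne (eq_of_edges_eq H.graph_isTree H.graph_isTree hN hX hY h).symm
    · exact fun h => absurd hX h
  rw [Finset.sum_congr rfl fun H _ => this H, Finset.sum_const, Finset.card_univ, nsmul_eq_mul]

theorem sum_weight_sq (hn : N + 1 ≤ n) (s : ℝ) :
    ∑ x ∈ index n N, weight n N s x.1 * weight n N s x.1 =
      Fintype.card (UnlabeledTree N) * s ^ (N + N) := by
  rw [index, Finset.sum_sigma]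
  have : ∀ H : UnlabeledTree N, ∑ X ∈ copies n H.graph ×ˢ copies n H.graph,
      weight n N s H * weight n N s H = s ^ (N + N) := by
    intro H
    rw [Finset.sum_const, Finset.card_product, nsmul_eq_mul, pow_add, ← weight_mul_card hn s H]
    push_cast
    ring
  rw [Finset.sum_congr rfl fun H _ => this H, Finset.sum_const, Finset.card_univ, nsmul_eq_mul]

theorem sum_weight_same (hN : 1 ≤ N) (hn : N + 1 ≤ n) (s : ℝ) :
    ∑ x ∈ index n N ×ˢ index n N, (if x.1.2.1.edges = x.2.2.1.edges ∧
      x.1.2.2.edges = x.2.2.2.edges then weight n N s x.1.1 * weight n N s x.2.1 else 0) =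
      Fintype.card (UnlabeledTree N) * s ^ (N + N) := by
  rw [← sum_weight_sq hn s, Finset.sum_product]
  refine Finset.sum_congr rfl fun x hx => ?_
  rw [Finset.sum_eq_single x]
  · simp
  · intro y hy hne
    exact if_neg fun h => hne (index_ext hN hx hy h.1 h.2).symm
  · exact fun h => absurd hx h

/-- The unique partner of an index is its transpose, which carries the same tree and hence the same
weight. -/
theorem sum_weight_cross (hN : 1 ≤ N) (hn : N + 1 ≤ n) (s : ℝ) :
    ∑ x ∈ index n N ×ˢ index n N, (if x.1.2.1.edges = x.2.2.2.edges ∧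
      x.1.2.2.edges = x.2.2.1.edges then weight n N s x.1.1 * weight n N s x.2.1 else 0) =
      Fintype.card (UnlabeledTree N) * s ^ (N + N) := by
  rw [← sum_weight_sq hn s, Finset.sum_product]
  refine Finset.sum_congr rfl fun x hx => ?_
  have hx' : (⟨x.1, (x.2.2, x.2.1)⟩ : (_ : UnlabeledTree N) × (Sub n × Sub n)) ∈ index n N :=
    mem_index.2 (mem_index.1 hx).symm
  rw [Finset.sum_eq_single ⟨x.1, (x.2.2, x.2.1)⟩]
  · simp
  · intro y hy hne
    exact if_neg fun h => hne (index_ext hN hy hx' h.2.symm h.1.symm)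
  · exact fun h => absurd hx' h

theorem sum_weight_diag_sq (hN : 1 ≤ N) (hn : N + 1 ≤ n) (s : ℝ) :
    ∑ x ∈ index n N ×ˢ index n N, (if x.1.2.1.edges = x.1.2.2.edges ∧
      x.2.2.1.edges = x.2.2.2.edges then weight n N s x.1.1 * weight n N s x.2.1 else 0) =
      (Fintype.card (UnlabeledTree N) * s ^ N) ^ 2 := by
  rw [sq, ← sum_weight_diag hN hn s, Finset.sum_mul_sum, Finset.sum_product]
  refine Finset.sum_congr rfl fun x _ => Finset.sum_congr rfl fun y _ => ?_
  by_cases h1 : x.2.1.edges = x.2.2.edges <;> by_cases h2 : y.2.1.edges = y.2.2.edges <;>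
    simp [h1, h2]

/-- The bound for the contribution of the non-matching pairs to the mean. -/
def meanError (n N k : ℕ) (lam s : ℝ) : ℝ :=
  ∑ x ∈ index n N, coeff n lam s x *
    if (supp (x.2.1.edges ∪ x.2.2.edges)).card ≤ (x.2.1.edges ∪ x.2.2.edges).card then
      ((k + 1) * (lam * s / n)) ^ (x.2.1.edges ∪ x.2.2.edges).card else 0

/-- The bound for the contribution of the non-matching quadruples to the second moment. -/
def secondError (n N k : ℕ) (lam s : ℝ) : ℝ :=
  ∑ x ∈ index n N ×ˢ index n N, (coeff n lam s x.1 * coeff n lam s x.2) *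
    if (supp (x.1.2.1.edges ∪ x.1.2.2.edges ∪ x.2.2.1.edges ∪ x.2.2.2.edges)).card ≤
        (x.1.2.1.edges ∪ x.1.2.2.edges ∪ x.2.2.1.edges ∪ x.2.2.2.edges).card + 1 then
      ((k + 1) * (lam * s / n)) ^
        (x.1.2.1.edges ∪ x.1.2.2.edges ∪ x.2.2.1.edges ∪ x.2.2.2.edges).card else 0

/-- The correlation of an edge in the two graphs. -/
def corr (n : ℕ) (lam s : ℝ) : ℝ := (s - lam * s / n) / (1 - lam * s / n)

theorem Admissible.var_pos {lam ε s : ℝ} (h : Admissible n k lam ε s) :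
    0 < lam * s / n * (1 - lam * s / n) :=
  mul_pos h.p_pos (by linarith [h.p_le_half])

theorem inv_mul_corr_pow {lam ε s : ℝ} (h : Admissible n k lam ε s) (M : ℕ) :
    ((lam * s / n * (1 - lam * s / n)) ^ M)⁻¹ * (lam * s / n * (s - lam * s / n)) ^ M =
      corr n lam s ^ M := by
  have h1 := h.p_pos.ne'
  have h2 : 1 - lam * s / n ≠ 0 := by linarith [h.p_le_half]
  rw [← inv_pow, ← mul_pow, corr]
  congr 1
  generalize lam * s / n = p at h1 h2 ⊢
  field_simp

theorem weight_nonneg {s : ℝ} (hs : 0 ≤ s) (H : UnlabeledTree N) : 0 ≤ weight n N s H := by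
  unfold weight; positivity

theorem coeff_nonneg {lam ε s : ℝ} (h : Admissible n k lam ε s)
    (x : (_ : UnlabeledTree N) × (Sub n × Sub n)) : 0 ≤ coeff n lam s x := by
  have := h.var_pos
  exact mul_nonneg (weight_nonneg h.s_mem.1.le _) (by positivity)

/-- Pairs of equal copies give the main term exactly, and any other pair is bounded below by minus
its absolute bound. -/
theorem mean_ge (hN : 1 ≤ N) (hn : N + 1 ≤ n) {lam ε s : ℝ} (h : Admissible n k lam ε s) :
    Fintype.card (UnlabeledTree N) * s ^ N * corr n lam s ^ N - meanError n N k lam s ≤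
      ∫ x, treeStat n N lam s x ∂(lawP n k lam ε s) := by
  have : NeZero k := ⟨h.k_pos.ne'⟩
  rw [integral_lawP_treeStat hN hn h, ← sum_weight_diag hN hn s, Finset.sum_mul, meanError,
    ← Finset.sum_sub_distrib]
  refine Finset.sum_le_sum fun x hx => ?_
  obtain ⟨t1, t2, c1, c2⟩ := index_edges hN hx
  have hc := coeff_nonneg h x
  by_cases he : x.2.1.edges = x.2.2.edges
  · have h0 : 0 ≤ coeff n lam s x * if (supp (x.2.1.edges ∪ x.2.2.edges)).card ≤
        (x.2.1.edges ∪ x.2.2.edges).card then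
        ((k + 1) * (lam * s / n)) ^ (x.2.1.edges ∪ x.2.2.edges).card else 0 := by
      refine mul_nonneg hc ?_
      have := h.p_pos
      split_ifs <;> positivity
    have h1 : coeff n lam s x * moment k lam ε s x.2.1.edges x.2.2.edges ∅ ∅ =
        weight n N s x.1 * corr n lam s ^ N := by
      rw [← he, moment_single lam ε s t1, c1, coeff, mul_assoc, inv_mul_corr_pow h]
    rw [if_pos he, h1]
    linarith
  · have h1 := abs_moment_two_le h t1 t2 (c1.trans c2.symm) he
    have h2 := mul_le_mul_of_nonneg_left (neg_le_of_abs_le h1) hc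
    rw [if_neg he, zero_mul, zero_sub]
    linarith

/-- The pairing of each S₁ with its S₂ reproduces the square of the leading mean; the two pairings
between different terms cost |𝒯_N| s^(2N) each. -/
theorem second_le (hN : 1 ≤ N) (hn : N + 1 ≤ n) {lam ε s : ℝ} (h : Admissible n k lam ε s) :
    ∫ x, treeStat n N lam s x ^ 2 ∂(lawP n k lam ε s) ≤
      (Fintype.card (UnlabeledTree N) * s ^ N * corr n lam s ^ N) ^ 2 +
      2 * (Fintype.card (UnlabeledTree N) * s ^ (N + N)) + secondError n N k lam s := by
  rw [integral_lawP_treeStat_sq hN hn h, mul_pow, ← sum_weight_diag_sq hN hn s, two_mul]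
  nth_rw 1 [← sum_weight_same hN hn s]
  rw [← sum_weight_cross hN hn s, secondError, ← pow_mul, mul_two, Finset.sum_mul,
    ← Finset.sum_add_distrib, ← Finset.sum_add_distrib, ← Finset.sum_add_distrib]
  refine Finset.sum_le_sum fun x hx => ?_
  obtain ⟨hx1, hx2⟩ := Finset.mem_product.1 hx
  obtain ⟨t1, t2, c1, c2⟩ := index_edges hN hx1
  obtain ⟨u1, u2, d1, d2⟩ := index_edges hN hx2
  have hc := mul_nonneg (coeff_nonneg h x.1) (coeff_nonneg h x.2)
  have key := mul_le_mul_of_nonneg_left (moment_four_le h t1 t2 u1 u2 c1 c2 d1 d2) hc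
  refine key.trans (le_of_eq ?_)
  have hcc : coeff n lam s x.1 * coeff n lam s x.2 = weight n N s x.1.1 * weight n N s x.2.1 *
      ((lam * s / n * (1 - lam * s / n)) ^ (N + N))⁻¹ := by
    rw [coeff, coeff, pow_add, mul_inv]; ring
  have h1 : coeff n lam s x.1 * coeff n lam s x.2 *
      (lam * s / n * (s - lam * s / n)) ^ (N + N) =
      weight n N s x.1.1 * weight n N s x.2.1 * corr n lam s ^ (N + N) := by
    rw [hcc, mul_assoc, inv_mul_corr_pow h]
  have h2 : coeff n lam s x.1 * coeff n lam s x.2 *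
      (lam * s / n * (1 - lam * s / n)) ^ (N + N) =
      weight n N s x.1.1 * weight n N s x.2.1 := by
    rw [hcc, inv_mul_cancel_right₀ (pow_ne_zero _ h.var_pos.ne')]
  rw [mul_add, mul_add, mul_add]
  simp only [mul_ite, ite_mul, mul_zero, zero_mul, h1, h2]
  ring

theorem integral_lawQ_sq_eq (hN : 1 ≤ N) (hn : N + 1 ≤ n) {lam ε s : ℝ}
    (h : Admissible n k lam ε s) : ∫ x, treeStat n N lam s x ^ 2 ∂(lawQ n lam s) =
      Fintype.card (UnlabeledTree N) * s ^ (N + N) := by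
  rw [integral_lawQ_treeStat_sq hN hn ⟨h.p_pos.le, h.p_le_half.trans (by norm_num)⟩,
    ← sum_weight_same hN hn s]
  refine Finset.sum_congr rfl fun x _ => ?_
  rw [mul_ite, mul_zero]
  congr 1
  rw [coeff, coeff, pow_add]
  have := pow_ne_zero N h.var_pos.ne'
  generalize (lam * s / n * (1 - lam * s / n)) ^ N = P at this ⊢
  field_simp

end MainTerms

/-! ### Bounds for the error terms -/

section Crude

open scoped Classical

variable {n N k : ℕ}

/-- A map with image W is a map into W, and a set larger than the domain is not an image. -/
theorem card_filter_image_eq_le {K : Type*} [Fintype K] (W : Finset (Fin n)) :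
    (Finset.univ.filter fun g : K → Fin n => Finset.univ.image g = W).card ≤
      if W.card ≤ Fintype.card K then Fintype.card K ^ Fintype.card K else 0 := by
  split_ifs with h
  · calc _ ≤ (Fintype.piFinset fun _ : K => W).card := by
          refine Finset.card_le_card fun g hg => Fintype.mem_piFinset.2 fun a => ?_
          rw [← (Finset.mem_filter.1 hg).2]
          exact Finset.mem_image_of_mem _ (Finset.mem_univ a)
      _ = W.card ^ Fintype.card K := by
          rw [Fintype.card_piFinset, Finset.prod_const, Finset.card_univ]
      _ ≤ _ := Nat.pow_le_pow_left h _
  · rw [Finset.filter_eq_empty_iff.2, Finset.card_empty]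
    rintro g - rfl
    exact h Finset.card_image_le

/-- The sum of `n ^ (-r)` over all maps to `[n]`, where `r` is the size of the image. -/
theorem sum_inv_pow_card_image_le (K : Type*) [Fintype K] (hn : 0 < n) :
    ∑ g : K → Fin n, ((n : ℝ)⁻¹) ^ (Finset.univ.image g).card ≤
      ((Fintype.card K : ℝ) + 1) * (Fintype.card K : ℝ) ^ Fintype.card K := by
  have hn' : (0 : ℝ) < n := by exact_mod_cast hn
  set M := Fintype.card K
  rw [← Finset.sum_fiberwise_of_maps_to (t := (Finset.univ : Finset (Fin n)).powerset)
    (g := fun g : K → Fin n => Finset.univ.image g) (fun _ _ => by simp)]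
  calc _ ≤ ∑ W ∈ (Finset.univ : Finset (Fin n)).powerset,
        (if W.card ≤ M then (M : ℝ) ^ M else 0) * ((n : ℝ)⁻¹) ^ W.card := by
        refine Finset.sum_le_sum fun W _ => ?_
        have h1 : ∀ g ∈ Finset.univ.filter (fun g : K → Fin n => Finset.univ.image g = W),
            ((n : ℝ)⁻¹) ^ (Finset.univ.image g).card = ((n : ℝ)⁻¹) ^ W.card := by
          intro g hg
          rw [(Finset.mem_filter.1 hg).2]
        rw [Finset.sum_congr rfl h1, Finset.sum_const, nsmul_eq_mul]
        refine mul_le_mul_of_nonneg_right ?_ (by positivity)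
        exact_mod_cast card_filter_image_eq_le (K := K) W
    _ = ∑ v ∈ Finset.range (n + 1), (n.choose v) •
        ((if v ≤ M then (M : ℝ) ^ M else 0) * ((n : ℝ)⁻¹) ^ v) := by
        rw [Finset.sum_powerset_apply_card
          fun v => (if v ≤ M then (M : ℝ) ^ M else 0) * ((n : ℝ)⁻¹) ^ v]
        simp
    -- The n.choose v ≤ n^v possible images of size v are offset by the factor n^(-v).
    _ ≤ ∑ v ∈ Finset.range (n + 1), (if v ≤ M then (M : ℝ) ^ M else 0) := by
        refine Finset.sum_le_sum fun v _ => ?_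
        rw [nsmul_eq_mul]
        have h1 : (n.choose v : ℝ) * ((n : ℝ)⁻¹) ^ v ≤ 1 := by
          rw [inv_pow, ← div_eq_mul_inv, div_le_one (by positivity)]
          exact_mod_cast Nat.choose_le_pow n v
        have h2 : 0 ≤ (if v ≤ M then (M : ℝ) ^ M else 0) := by split_ifs <;> positivity
        nlinarith
    _ ≤ ((M : ℝ) + 1) * (M : ℝ) ^ M := by
        rw [← Finset.sum_filter, Finset.sum_const, nsmul_eq_mul]
        refine mul_le_mul_of_nonneg_right ?_ (by positivity)
        have : (Finset.range (n + 1)).filter (fun v => v ≤ M) ⊆ Finset.range (M + 1) := by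
          intro v hv
          have := (Finset.mem_filter.1 hv).2
          exact Finset.mem_range.2 (by omega)
        have := Finset.card_le_card this
        rw [Finset.card_range] at this
        exact_mod_cast this

/-- The pairs of copies are encoded by maps to `[n]`. -/
theorem exists_encoding (hN : 1 ≤ N) (hn : N + 1 ≤ n) :
    ∃ Φ : ((_ : UnlabeledTree N) × (Sub n × Sub n)) →
      UnlabeledTree N × (Fin (N + 1) ⊕ Fin (N + 1) → Fin n),
      Set.InjOn Φ (index n N) ∧
      ∀ x ∈ index n N, Finset.univ.image (Φ x).2 = supp (x.2.1.edges ∪ x.2.2.edges) := by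
  have : Nonempty (Fin (N + 1) ↪ Fin n) := ⟨Fin.castLEEmb hn⟩
  have hex : ∀ (H : UnlabeledTree N) (X : Sub n), X ∈ copies n H.graph →
      ∃ f : Fin (N + 1) ↪ Fin n, mapSub H.graph f = X := by
    intro H X hX
    obtain ⟨φ⟩ := mem_copies.1 hX
    exact ⟨isoEmb φ.symm, mapSub_isoEmb _⟩
  choose! emb hemb using hex
  have himg : ∀ (H : UnlabeledTree N) (X : Sub n), X ∈ copies n H.graph →
      Finset.univ.image (emb H X) = supp X.edges := by
    intro H X hX
    rw [(edges_of_mem_copies H.graph_isTree hN hX).2.2]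
    ext v
    rw [Set.mem_toFinset]
    nth_rw 2 [← hemb H X hX]
    simp [mapSub]
  refine ⟨fun x => (x.1, Sum.elim (emb x.1 x.2.1) (emb x.1 x.2.2)), ?_, ?_⟩
  · rintro ⟨H, X₁, X₂⟩ hx ⟨I, Y₁, Y₂⟩ hy hxy
    obtain ⟨hx1, hx2⟩ := mem_index.1 hx
    obtain ⟨hy1, hy2⟩ := mem_index.1 hy
    simp only [Prod.mk.injEq, Sum.elim_eq_iff] at hxy
    obtain ⟨rfl, h1, h2⟩ := hxy
    have e1 := DFunLike.coe_injective h1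
    have e2 := DFunLike.coe_injective h2
    simp only at hx1 hx2 hy1 hy2
    obtain rfl : X₁ = Y₁ := by rw [← hemb H X₁ hx1, e1, hemb H Y₁ hy1]
    obtain rfl : X₂ = Y₂ := by rw [← hemb H X₂ hx2, e2, hemb H Y₂ hy2]
    rfl
  · intro x hx
    obtain ⟨hx1, hx2⟩ := mem_index.1 hx
    rw [supp_union, ← himg _ _ hx1, ← himg _ _ hx2]
    ext v
    simp [Sum.exists]

theorem sum_le_sum_of_injOn {α β : Type*} [Fintype β] {Q : Finset α} {Φ : α → β}
    (hΦ : Set.InjOn Φ Q) {F : α → ℝ} {G : β → ℝ} (hG : ∀ b, 0 ≤ G b)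
    (h : ∀ x ∈ Q, F x ≤ G (Φ x)) : ∑ x ∈ Q, F x ≤ ∑ b, G b := by
  calc ∑ x ∈ Q, F x ≤ ∑ x ∈ Q, G (Φ x) := Finset.sum_le_sum h
    _ = ∑ b ∈ Q.image Φ, G b := (Finset.sum_image hΦ).symm
    _ ≤ ∑ b, G b := Finset.sum_le_sum_of_subset_of_nonneg (Finset.subset_univ _)
        fun b _ _ => hG b

theorem sum_pair_le (hN : 1 ≤ N) (hn : N + 1 ≤ n) :
    ∑ x ∈ index n N, ((n : ℝ)⁻¹) ^ (supp (x.2.1.edges ∪ x.2.2.edges)).card ≤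
      Fintype.card (UnlabeledTree N) *
        (((2 * (N + 1) : ℕ) + 1) * ((2 * (N + 1) : ℕ) : ℝ) ^ (2 * (N + 1))) := by
  obtain ⟨Φ, hΦ, himg⟩ := exists_encoding hN hn
  refine (sum_le_sum_of_injOn hΦ (G := fun b => ((n : ℝ)⁻¹) ^ (Finset.univ.image b.2).card)
    (fun b => by positivity) fun x hx => by rw [himg x hx]).trans ?_
  have h := sum_inv_pow_card_image_le (Fin (N + 1) ⊕ Fin (N + 1)) (show 0 < n by omega)
  have hK : Fintype.card (Fin (N + 1) ⊕ Fin (N + 1)) = 2 * (N + 1) := by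
    simp [two_mul]
  rw [hK] at h
  rw [Fintype.sum_prod_type]
  simp only [Finset.sum_const, Finset.card_univ, nsmul_eq_mul]
  refine mul_le_mul_of_nonneg_left ?_ (Nat.cast_nonneg _)
  refine le_trans (le_of_eq ?_) h
  congr!

theorem sum_quad_le (hN : 1 ≤ N) (hn : N + 1 ≤ n) :
    ∑ x ∈ index n N ×ˢ index n N, ((n : ℝ)⁻¹) ^
        (supp (x.1.2.1.edges ∪ x.1.2.2.edges ∪ x.2.2.1.edges ∪ x.2.2.2.edges)).card ≤
      (Fintype.card (UnlabeledTree N) : ℝ) ^ 2 *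
        (((4 * (N + 1) : ℕ) + 1) * ((4 * (N + 1) : ℕ) : ℝ) ^ (4 * (N + 1))) := by
  obtain ⟨Φ, hΦ, himg⟩ := exists_encoding hN hn
  have hinj : Set.InjOn (fun x : ((_ : UnlabeledTree N) × (Sub n × Sub n)) ×
      ((_ : UnlabeledTree N) × (Sub n × Sub n)) =>
      (((Φ x.1).1, (Φ x.2).1), Sum.elim (Φ x.1).2 (Φ x.2).2))
      ((index n N ×ˢ index n N : Finset _) : Set _) := by
    rintro ⟨x, y⟩ hxy ⟨x', y'⟩ hxy' h
    obtain ⟨hx, hy⟩ := Finset.mem_product.1 (Finset.mem_coe.1 hxy)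
    obtain ⟨hx', hy'⟩ := Finset.mem_product.1 (Finset.mem_coe.1 hxy')
    simp only [Prod.mk.injEq, Sum.elim_eq_iff] at h
    obtain ⟨⟨h1, h2⟩, h3, h4⟩ := h
    exact Prod.ext (hΦ hx hx' (Prod.ext h1 h3)) (hΦ hy hy' (Prod.ext h2 h4))
  refine (sum_le_sum_of_injOn hinj
    (G := fun b : (UnlabeledTree N × UnlabeledTree N) ×
      ((Fin (N + 1) ⊕ Fin (N + 1)) ⊕ (Fin (N + 1) ⊕ Fin (N + 1)) → Fin n) => ((n : ℝ)⁻¹) ^ (Finset.univ.image b.2).card)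
    (fun b => by positivity) fun x hx => le_of_eq ?_).trans ?_
  · obtain ⟨hx1, hx2⟩ := Finset.mem_product.1 hx
    congr 2
    rw [Finset.union_assoc (x.1.2.1.edges ∪ x.1.2.2.edges), supp_union, ← himg _ hx1,
      ← himg _ hx2]
    ext v
    simp [Sum.exists]
  have h := sum_inv_pow_card_image_le
    ((Fin (N + 1) ⊕ Fin (N + 1)) ⊕ (Fin (N + 1) ⊕ Fin (N + 1))) (show 0 < n by omega)
  have hK : Fintype.card ((Fin (N + 1) ⊕ Fin (N + 1)) ⊕ (Fin (N + 1) ⊕ Fin (N + 1))) =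
      4 * (N + 1) := by
    simp; ring
  rw [hK] at h
  rw [Fintype.sum_prod_type]
  simp only [Finset.sum_const, Finset.card_univ, nsmul_eq_mul, Fintype.card_prod]
  rw [Nat.cast_mul, ← sq]
  refine mul_le_mul_of_nonneg_left ?_ (by positivity)
  refine le_trans (le_of_eq ?_) h
  congr!

/-- A labeled tree is determined by its N edges. This crude bound suffices, since factors (N +
1)^(O(N)) are n^(o(1)) in the relevant regime. -/
theorem card_unlabeledTree_le (N : ℕ) :
    Fintype.card (UnlabeledTree N) ≤ (N + 1) ^ (2 * N) := by
  have h1 : Fintype.card (UnlabeledTree N) ≤ Fintype.card (LabeledTree N) :=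
    Fintype.card_le_of_surjective (Quotient.mk _) Quotient.mk_surjective
  have h2 : Fintype.card (LabeledTree N) ≤
      ((Finset.univ : Finset (Sym2 (Fin (N + 1)))).powersetCard N).card := by
    rw [← Finset.card_univ]
    refine Finset.card_le_card_of_injOn (fun T => T.1.edgeFinset) (fun T _ => ?_) ?_
    · refine Finset.mem_powersetCard.2 ⟨Finset.subset_univ _, ?_⟩
      have := T.2.card_edgeFinset
      rw [Fintype.card_fin] at this
      exact Nat.succ_injective this
    · intro T _ T' _ h
      exact Subtype.ext (SimpleGraph.edgeFinset_inj.1 h)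
  rw [Finset.card_powersetCard, Finset.card_univ, Sym2.card, Fintype.card_fin] at h2
  have h3 : (N + 1 + 1).choose 2 ≤ (N + 1) ^ 2 := by
    rw [Nat.choose_two_right]
    apply Nat.div_le_of_le_mul
    simp only [Nat.add_sub_cancel]
    nlinarith
  calc _ ≤ ((N + 1 + 1).choose 2).choose N := h1.trans h2
    _ ≤ ((N + 1 + 1).choose 2) ^ N := Nat.choose_le_pow _ _
    _ ≤ ((N + 1) ^ 2) ^ N := Nat.pow_le_pow_left h3 N
    _ = _ := by rw [pow_mul]

theorem autCount_le {m : ℕ} (H : SimpleGraph (Fin m)) : autCount H ≤ m ^ m := by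
  have h : Nat.card (H ≃g H) ≤ Nat.card (Fin m → Fin m) :=
    Nat.card_le_card_of_injective (fun φ : H ≃g H => (φ : Fin m → Fin m)) DFunLike.coe_injective
  simpa [autCount] using h

/-- There are at least (n/2)^(N+1)/(N+1)^(N+1) copies, so the weight is of order n^(-(N+1)); the
variance normalization returns n^N, and 1/n remains. -/
theorem coeff_le (hn : 2 * (N + 1) ≤ n) {lam ε s : ℝ} (h : Admissible n k lam ε s)
    (x : (_ : UnlabeledTree N) × (Sub n × Sub n)) :
    coeff n lam s x ≤ (2 * ((N : ℝ) + 1)) ^ (N + 1) * (2 / (lam * s)) ^ N * (n : ℝ)⁻¹ := by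
  have hn' : (0 : ℝ) < n := by exact_mod_cast h.n_pos
  have hth : 0 < lam * s := mul_pos h.lam_pos h.s_mem.1
  have h1 := card_copies_mul_autCount (n := n) x.1.graph
  have h2 := Nat.pow_sub_le_descFactorial n (N + 1)
  have hC : (0 : ℝ) < (copies n x.1.graph).card := by
    exact_mod_cast card_copies_pos (by omega) x.1.graph
  have h3 : ((n : ℝ) / 2) ^ (N + 1) ≤
      (copies n x.1.graph).card * ((N : ℝ) + 1) ^ (N + 1) := by
    have h5 : (n : ℝ) / 2 ≤ ((n + 1 - (N + 1) : ℕ) : ℝ) := by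
      rw [div_le_iff₀ (by norm_num)]
      have : n ≤ (n + 1 - (N + 1)) * 2 := by omega
      exact_mod_cast this
    calc ((n : ℝ) / 2) ^ (N + 1) ≤ ((n + 1 - (N + 1) : ℕ) : ℝ) ^ (N + 1) := by gcongr
      _ ≤ (n.descFactorial (N + 1) : ℝ) := by exact_mod_cast h2
      _ = (copies n x.1.graph).card * (autCount x.1.graph : ℝ) := by rw [← h1]; push_cast; rfl
      _ ≤ _ := by
        gcongr
        exact_mod_cast autCount_le x.1.graph
  have h4 : weight n N s x.1 ≤ (2 * ((N : ℝ) + 1)) ^ (N + 1) * ((n : ℝ)⁻¹) ^ (N + 1) := by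
    rw [weight, div_le_iff₀ hC]
    calc s ^ N ≤ 1 := pow_le_one₀ h.s_mem.1.le h.s_mem.2.le
      _ = (2 * (n : ℝ)⁻¹) ^ (N + 1) * ((n : ℝ) / 2) ^ (N + 1) := by
          rw [← mul_pow]
          field_simp
          simp
      _ ≤ (2 * (n : ℝ)⁻¹) ^ (N + 1) *
          ((copies n x.1.graph).card * ((N : ℝ) + 1) ^ (N + 1)) := by gcongr
      _ = _ := by rw [mul_pow, mul_pow]; ring
  have h6 : (((lam * s / n) * (1 - lam * s / n)) ^ N)⁻¹ ≤ (2 / (lam * s)) ^ N * (n : ℝ) ^ N := by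
    rw [← inv_pow, ← mul_pow]
    refine pow_le_pow_left₀ (inv_nonneg.2 h.var_pos.le) ?_ N
    rw [inv_le_iff_one_le_mul₀' h.var_pos]
    have := h.p_le_half
    calc (1 : ℝ) = (lam * s / n * (1 / 2)) * (2 / (lam * s) * n) := by
          field_simp
          exact (div_self hth.ne').symm
      _ ≤ _ := by
        have := h.p_pos.le
        gcongr
        linarith
  calc coeff n lam s x ≤ ((2 * ((N : ℝ) + 1)) ^ (N + 1) * ((n : ℝ)⁻¹) ^ (N + 1)) *
        ((2 / (lam * s)) ^ N * (n : ℝ) ^ N) := by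
        have := h.var_pos
        unfold coeff
        gcongr
    _ = (2 * ((N : ℝ) + 1)) ^ (N + 1) * (2 / (lam * s)) ^ N * (n : ℝ)⁻¹ *
        (((n : ℝ)⁻¹) ^ N * (n : ℝ) ^ N) := by ring
    _ = _ := by
        rw [← mul_pow, inv_mul_cancel₀ hn'.ne', one_pow, mul_one]

/-- The union of at most `4 N` edges contributes at most a power of a constant times a power of
`n` which is determined by the number of vertices. -/
theorem edge_pow_le {lam s T : ℝ} (hn : 0 < n) (hT : 1 ≤ T) (hT' : (k + 1) * (lam * s) ≤ T)
    (hpos : 0 ≤ lam * s) {U : Finset (Pair n)} {M j : ℕ} (hU : U.card ≤ M) :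
    (if (supp U).card ≤ U.card + j then ((k + 1) * (lam * s / n)) ^ U.card else 0) ≤
      T ^ M * (n : ℝ) ^ j * ((n : ℝ)⁻¹) ^ (supp U).card := by
  have hn' : (1 : ℝ) ≤ n := by exact_mod_cast hn
  have hn0 : (n : ℝ) ≠ 0 := by positivity
  split_ifs with h
  · calc ((k + 1) * (lam * s / n)) ^ U.card
        = ((k + 1) * (lam * s)) ^ U.card * ((n : ℝ)⁻¹) ^ U.card := by
          rw [← mul_pow]; congr 1; ring
      _ ≤ T ^ M * ((n : ℝ) ^ j * ((n : ℝ)⁻¹) ^ (supp U).card) := by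
          gcongr
          · calc _ ≤ T ^ U.card := by gcongr
              _ ≤ T ^ M := pow_le_pow_right₀ hT hU
          · calc ((n : ℝ)⁻¹) ^ U.card = (n : ℝ) ^ j * ((n : ℝ)⁻¹) ^ (U.card + j) := by
                  rw [pow_add, mul_comm (((n : ℝ)⁻¹) ^ U.card), ← mul_assoc, ← mul_pow,
                    mul_inv_cancel₀ hn0, one_pow, one_mul]
              _ ≤ _ := by
                  gcongr ?_ * ?_
                  exact pow_le_pow_of_le_one (by positivity) (inv_le_one_of_one_le₀ hn') h
      _ = _ := by ring
  · positivity

theorem card_union_le_of_index (hN : 1 ≤ N) {x : (_ : UnlabeledTree N) × (Sub n × Sub n)}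
    (hx : x ∈ index n N) : (x.2.1.edges ∪ x.2.2.edges).card ≤ 2 * N := by
  obtain ⟨-, -, c1, c2⟩ := index_edges hN hx
  have := Finset.card_union_le x.2.1.edges x.2.2.edges
  omega

/-- The factor 1/n is that of the coefficient: with at least as many edges as vertices, the powers
of n from placements and from edges cancel. -/
theorem meanError_le (hN : 1 ≤ N) (hn : 2 * (N + 1) ≤ n) {lam ε s T : ℝ}
    (h : Admissible n k lam ε s) (hT : 1 ≤ T) (hT' : (k + 1) * (lam * s) ≤ T) :
    meanError n N k lam s ≤
      (2 * ((N : ℝ) + 1)) ^ (N + 1) * (2 / (lam * s)) ^ N * (n : ℝ)⁻¹ * T ^ (2 * N) *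
      (Fintype.card (UnlabeledTree N) *
        (((2 * (N + 1) : ℕ) + 1) * ((2 * (N + 1) : ℕ) : ℝ) ^ (2 * (N + 1)))) := by
  have hpos : 0 < lam * s := mul_pos h.lam_pos h.s_mem.1
  refine le_trans ?_ (mul_le_mul_of_nonneg_left (sum_pair_le (n := n) hN (by omega)) (by positivity))
  rw [meanError, Finset.mul_sum]
  refine Finset.sum_le_sum fun x hx => ?_
  have h1 := edge_pow_le h.n_pos hT hT' hpos.le (j := 0) (card_union_le_of_index hN hx)
  simp only [add_zero, pow_zero, mul_one] at h1
  rw [mul_assoc _ (T ^ (2 * N))]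
  refine mul_le_mul (coeff_le hn h x) h1 ?_ (by positivity)
  have := h.p_pos
  split_ifs <;> positivity

/-- Two coefficients give n^(-2), and the one permitted extra vertex gives back a factor n. -/
theorem secondError_le (hN : 1 ≤ N) (hn : 2 * (N + 1) ≤ n) {lam ε s T : ℝ}
    (h : Admissible n k lam ε s) (hT : 1 ≤ T) (hT' : (k + 1) * (lam * s) ≤ T) :
    secondError n N k lam s ≤
      ((2 * ((N : ℝ) + 1)) ^ (N + 1) * (2 / (lam * s)) ^ N) ^ 2 * (n : ℝ)⁻¹ * T ^ (4 * N) *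
      ((Fintype.card (UnlabeledTree N) : ℝ) ^ 2 *
        (((4 * (N + 1) : ℕ) + 1) * ((4 * (N + 1) : ℕ) : ℝ) ^ (4 * (N + 1)))) := by
  have hpos : 0 < lam * s := mul_pos h.lam_pos h.s_mem.1
  have hn' : (0 : ℝ) < n := by exact_mod_cast h.n_pos
  refine le_trans ?_ (mul_le_mul_of_nonneg_left (sum_quad_le (n := n) hN (by omega)) (by positivity))
  rw [secondError, Finset.mul_sum]
  refine Finset.sum_le_sum fun x hx => ?_
  obtain ⟨hx1, hx2⟩ := Finset.mem_product.1 hx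
  have hU : (x.1.2.1.edges ∪ x.1.2.2.edges ∪ x.2.2.1.edges ∪ x.2.2.2.edges).card ≤ 4 * N := by
    have h1 := card_union_le_of_index hN hx1
    have h2 := card_union_le_of_index hN hx2
    have h3 := Finset.card_union_le (x.1.2.1.edges ∪ x.1.2.2.edges)
      (x.2.2.1.edges ∪ x.2.2.2.edges)
    rw [Finset.union_assoc (x.1.2.1.edges ∪ x.1.2.2.edges)]
    omega
  have h1 := edge_pow_le h.n_pos hT hT' hpos.le (j := 1) hU
  have h2 := mul_le_mul (mul_le_mul (coeff_le hn h x.1) (coeff_le hn h x.2) (coeff_nonneg h x.2)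
    (by positivity)) h1 (by have := h.p_pos; split_ifs <;> positivity) (by positivity)
  refine h2.trans (le_of_eq ?_)
  rw [pow_one]
  field_simp

/-- The two error terms are at most `(C (N + 1)) ^ (17 (N + 1)) / n`. -/
theorem exists_error_bound (k : ℕ) {lam s : ℝ} (hlam : 0 < lam) (hs : 0 < s) :
    ∃ C : ℝ, 1 ≤ C ∧ ∀ (n N : ℕ) (ε : ℝ), 1 ≤ N → 2 * (N + 1) ≤ n → Admissible n k lam ε s →
      meanError n N k lam s ≤ (C * ((N : ℝ) + 1)) ^ (17 * (N + 1)) * (n : ℝ)⁻¹ ∧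
      secondError n N k lam s ≤ (C * ((N : ℝ) + 1)) ^ (17 * (N + 1)) * (n : ℝ)⁻¹ := by
  have hpos : 0 < lam * s := mul_pos hlam hs
  set T : ℝ := 1 + (k + 1) * (lam * s)
  have hT : 1 ≤ T := by
    have : 0 ≤ (k + 1) * (lam * s) := by positivity
    simp only [T]; linarith
  have hT' : (k + 1) * (lam * s) ≤ T := by simp only [T]; linarith
  have hd : 0 < 2 / (lam * s) := by positivity
  -- Each summand of C dominates one base: 2/(λs) from the normalization, T from the edge bounds,
  -- and 5 = 4 + 1 from the four blocks of N + 1 vertices.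
  refine ⟨5 + 2 / (lam * s) + T, by linarith, fun n N ε hN hn h => ?_⟩
  set C : ℝ := 5 + 2 / (lam * s) + T
  set L : ℝ := (N : ℝ) + 1 with hL
  have hL1 : 1 ≤ L := by rw [hL]; linarith [(Nat.cast_nonneg N : (0 : ℝ) ≤ N)]
  have hC1 : 1 ≤ C := by simp only [C]; linarith
  have hCL : 1 ≤ C * L := by nlinarith
  have b1 : (2 * L) ^ (N + 1) ≤ (C * L) ^ (N + 1) := by
    gcongr; simp only [C]; linarith
  have hCleCL : C ≤ C * L := by nlinarith
  have b2 : (2 / (lam * s)) ^ N ≤ (C * L) ^ (N + 1) := by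
    calc _ ≤ (C * L) ^ N := by
          gcongr
          refine le_trans ?_ hCleCL
          simp only [C]; linarith
      _ ≤ _ := pow_le_pow_right₀ hCL (Nat.le_succ N)
  have b3 : ∀ j, T ^ (j * N) ≤ (C * L) ^ (j * (N + 1)) := by
    intro j
    calc _ ≤ (C * L) ^ (j * N) := by
          gcongr
          refine le_trans ?_ hCleCL
          simp only [C]; linarith
      _ ≤ _ := pow_le_pow_right₀ hCL (by gcongr; omega)
  have b4 : (Fintype.card (UnlabeledTree N) : ℝ) ≤ (C * L) ^ (2 * (N + 1)) := by
    calc (Fintype.card (UnlabeledTree N) : ℝ) ≤ L ^ (2 * N) := by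
          have := card_unlabeledTree_le N
          have h1 : (Fintype.card (UnlabeledTree N) : ℝ) ≤ ((N + 1 : ℕ) : ℝ) ^ (2 * N) := by
            exact_mod_cast this
          simpa [hL] using h1
      _ ≤ (C * L) ^ (2 * N) := by
          gcongr
          nlinarith
      _ ≤ _ := pow_le_pow_right₀ hCL (by omega)
  have b5 : ∀ j : ℕ, (j : ℝ) + 1 ≤ C → ((j * (N + 1) : ℕ) : ℝ) + 1 ≤ (C * L) ^ (N + 1) := by
    intro j hj
    calc ((j * (N + 1) : ℕ) : ℝ) + 1 ≤ (j + 1) * L := by push_cast; rw [← hL]; nlinarith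
      _ ≤ C * L := by gcongr
      _ ≤ _ := le_self_pow₀ hCL (by omega)
  have b6 : ∀ j : ℕ, (j : ℝ) ≤ C → ((j * (N + 1) : ℕ) : ℝ) ^ (j * (N + 1)) ≤
      (C * L) ^ (j * (N + 1)) := by
    intro j hj
    gcongr
    push_cast
    rw [← hL]
    gcongr
  have hn0 : (0 : ℝ) ≤ (n : ℝ)⁻¹ := by positivity
  have hC5 : 5 ≤ C := by simp only [C]; linarith
  have hCL0 : 0 ≤ C * L := by linarith
  have hpow : ∀ j, (C * L) ^ (j * (N + 1)) = ((C * L) ^ (N + 1)) ^ j := fun j => by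
    rw [Nat.mul_comm, pow_mul]
  constructor
  · calc _ ≤ _ := meanError_le hN hn h hT hT'
      _ ≤ (C * L) ^ (N + 1) * (C * L) ^ (N + 1) * (n : ℝ)⁻¹ * (C * L) ^ (2 * (N + 1)) *
          ((C * L) ^ (2 * (N + 1)) * ((C * L) ^ (N + 1) * (C * L) ^ (2 * (N + 1)))) := by
          have := b3 2
          have := b5 2 (by push_cast; linarith)
          have := b6 2 (by push_cast; linarith)
          gcongr
      _ = (C * L) ^ (9 * (N + 1)) * (n : ℝ)⁻¹ := by
          simp only [hpow]
          generalize (C * L) ^ (N + 1) = P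
          ring
      _ ≤ _ := mul_le_mul_of_nonneg_right (pow_le_pow_right₀ hCL (by omega)) hn0
  · calc _ ≤ _ := secondError_le hN hn h hT hT'
      -- Counted in multiples of N + 1, the exponents add up to 4 + 4 + 4 + 1 + 4 = 17; the mean
      -- error needs only 9.
      _ ≤ ((C * L) ^ (N + 1) * (C * L) ^ (N + 1)) ^ 2 * (n : ℝ)⁻¹ * (C * L) ^ (4 * (N + 1)) *
          (((C * L) ^ (2 * (N + 1))) ^ 2 * ((C * L) ^ (N + 1) * (C * L) ^ (4 * (N + 1)))) := by
          have := b3 4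
          have := b5 4 (by push_cast; linarith)
          have := b6 4 (by push_cast; linarith)
          gcongr
      _ = (C * L) ^ (17 * (N + 1)) * (n : ℝ)⁻¹ := by
          simp only [hpow]
          generalize (C * L) ^ (N + 1) = P
          ring

end Crude

/-! ### Growth of the number of unlabeled trees -/

section Growth

/-- Rooted labeled trees are identified if they are isomorphic. -/
def rootedSetoid (m : ℕ) : Setoid (LabeledTree m × Fin (m + 1)) where
  r x y := ∃ φ : x.1.1 ≃g y.1.1, φ x.2 = y.2
  iseqv :=
    ⟨fun _ => ⟨SimpleGraph.Iso.refl, rfl⟩,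
      fun ⟨φ, h⟩ => ⟨φ.symm, by rw [← h, φ.symm_apply_apply]⟩,
      fun ⟨φ, h⟩ ⟨ψ, h'⟩ => ⟨φ.trans ψ, by rw [← h', ← h]; rfl⟩⟩

/-- Rooted unlabeled trees with `m` edges. -/
abbrev RootedTree (m : ℕ) : Type := Quotient (rootedSetoid m)

/-- The number of rooted unlabeled trees with `m` edges. -/
def rootedCount (m : ℕ) : ℕ := Nat.card (RootedTree m)

instance (m : ℕ) : Nonempty (LabeledTree m) := by
  obtain ⟨T, -, hT⟩ :=
    (SimpleGraph.connected_top : (⊤ : SimpleGraph (Fin (m + 1))).Connected).exists_isTree_le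
  exact ⟨⟨T, hT⟩⟩

theorem rootedCount_pos (m : ℕ) : 1 ≤ rootedCount m := by
  have : Nonempty (RootedTree m) := ⟨Quotient.mk _ (Classical.arbitrary _, 0)⟩
  exact Nat.card_pos

theorem card_le_rootedCount (m : ℕ) : Fintype.card (UnlabeledTree m) ≤ rootedCount m := by
  rw [← Nat.card_eq_fintype_card]
  refine Nat.card_le_card_of_injective
    (fun H : UnlabeledTree m => (Quotient.mk (rootedSetoid m) (Quotient.out H, 0))) ?_
  intro H I h
  obtain ⟨φ, -⟩ := Quotient.exact h
  exact UnlabeledTree.eq_of_iso ⟨φ⟩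

/-- Transporting the root to the chosen representative leaves at most m + 1 rootings of each
unlabeled tree. -/
theorem rootedCount_le (m : ℕ) :
    rootedCount m ≤ Fintype.card (UnlabeledTree m) * (m + 1) := by
  have h : ∀ T : LabeledTree m, Nonempty (T.1 ≃g (Quotient.out (Quotient.mk (treeSetoid m) T)).1) :=
    fun T => Quotient.exact (Quotient.out_eq (Quotient.mk (treeSetoid m) T)).symm
  let ψ := fun T => Classical.choice (h T)
  have key : ∀ x y : LabeledTree m × Fin (m + 1),
      ((Quotient.mk (treeSetoid m) x.1, ψ x.1 x.2) : UnlabeledTree m × Fin (m + 1)) =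
        (Quotient.mk (treeSetoid m) y.1, ψ y.1 y.2) → (rootedSetoid m).r x y := by
    rintro ⟨T, v⟩ ⟨T', v'⟩ hxy
    simp only [Prod.mk.injEq] at hxy
    obtain ⟨h1, h2⟩ := hxy
    generalize ψ T = f at h2
    generalize ψ T' = f' at h2
    revert f
    rw [h1]
    intro f h2
    exact ⟨f.trans f'.symm, by
      change f'.symm (f v) = v'
      rw [h2, f'.symm_apply_apply]⟩
  have hinj : Function.Injective fun x : RootedTree m =>
      ((Quotient.mk (treeSetoid m) x.out.1, ψ x.out.1 x.out.2) :
        UnlabeledTree m × Fin (m + 1)) := by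
    intro x y hxy
    rw [← Quotient.out_eq x, ← Quotient.out_eq y]
    exact Quotient.sound (key _ _ hxy)
  have := Nat.card_le_card_of_injective _ hinj
  rwa [Nat.card_prod, Nat.card_eq_fintype_card (α := UnlabeledTree m), Nat.card_fin] at this

/-! ### Joining two rooted trees at a new root -/

section Join

variable {α β α' β' : Type*}

/-- The adjacency of the graph which is obtained from two rooted graphs by joining their roots
to a new vertex. -/
def joinAdj (A : SimpleGraph α) (B : SimpleGraph β) (x : α) (y : β) :
    Option (α ⊕ β) → Option (α ⊕ β) → Prop
  | none, none => False
  | none, some (Sum.inl u) => u = x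
  | none, some (Sum.inr v) => v = y
  | some (Sum.inl u), none => u = x
  | some (Sum.inr v), none => v = y
  | some (Sum.inl u), some (Sum.inl u') => A.Adj u u'
  | some (Sum.inr v), some (Sum.inr v') => B.Adj v v'
  | some (Sum.inl _), some (Sum.inr _) => False
  | some (Sum.inr _), some (Sum.inl _) => False

/-- Two rooted graphs whose roots are joined to a new vertex. -/
def join (A : SimpleGraph α) (B : SimpleGraph β) (x : α) (y : β) :
    SimpleGraph (Option (α ⊕ β)) where
  Adj := joinAdj A B x y
  symm := ⟨by
    rintro (_ | u | v) (_ | u' | v') h <;> simp only [joinAdj] at h ⊢ <;>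
      first | exact h | exact h.symm⟩
  loopless := ⟨by
    rintro (_ | u | v) h <;> simp [joinAdj] at h⟩

/-- All vertices are connected to the new one, and only two edges are added for one new vertex,
which is the edge count of a tree. -/
theorem join_isTree [Fintype α] [Fintype β] {A : SimpleGraph α} {B : SimpleGraph β}
    (hA : A.IsTree) (hB : B.IsTree) (x : α) (y : β) : (join A B x y).IsTree := by
  classical
  have hconn : (join A B x y).Connected := by
    have hr : ∀ z, (join A B x y).Reachable z none := by
      let fA : A →g join A B x y := ⟨fun u => some (Sum.inl u), fun h => h⟩
      let fB : B →g join A B x y := ⟨fun u => some (Sum.inr u), fun h => h⟩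
      rintro (_ | u | v)
      · exact SimpleGraph.Reachable.refl _
      · have h1 := (hA.connected u x).map fA
        have h2 : (join A B x y).Adj (some (Sum.inl x)) none := (rfl : x = x)
        exact h1.trans h2.reachable
      · have h1 := (hB.connected v y).map fB
        have h2 : (join A B x y).Adj (some (Sum.inr y)) none := (rfl : y = y)
        exact h1.trans h2.reachable
    exact (SimpleGraph.connected_iff _).2 ⟨fun z w => (hr z).trans (hr w).symm, ⟨none⟩⟩
  refine SimpleGraph.isTree_iff_connected_and_card.2 ⟨hconn, le_antisymm ?_ ?_⟩
  swap
  · exact hconn.card_vert_le_card_edgeSet_add_one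
  have hsub : (join A B x y).edgeFinset ⊆
      (A.edgeFinset.image (Sym2.map fun u => some (Sum.inl u)) ∪
        B.edgeFinset.image (Sym2.map fun v => some (Sum.inr v))) ∪
        {s(none, some (Sum.inl x)), s(none, some (Sum.inr y))} := by
    intro e he
    induction e with
    | h z w =>
      rw [SimpleGraph.mem_edgeFinset, SimpleGraph.mem_edgeSet] at he
      change joinAdj A B x y z w at he
      rcases z with _ | u | v <;> rcases w with _ | u' | v' <;> simp only [joinAdj] at he
      · subst he; simp
      · subst he; simp
      · subst he; simp [Sym2.eq_swap]
      · refine Finset.mem_union_left _ (Finset.mem_union_left _ (Finset.mem_image.2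
          ⟨s(u, u'), ?_, rfl⟩))
        rwa [SimpleGraph.mem_edgeFinset, SimpleGraph.mem_edgeSet]
      · subst he; simp [Sym2.eq_swap]
      · refine Finset.mem_union_left _ (Finset.mem_union_right _ (Finset.mem_image.2
          ⟨s(v, v'), ?_, rfl⟩))
        rwa [SimpleGraph.mem_edgeFinset, SimpleGraph.mem_edgeSet]
  have hc := Finset.card_le_card hsub
  have hA' := hA.card_edgeFinset
  have hB' := hB.card_edgeFinset
  have h1 := Finset.card_union_le
    (A.edgeFinset.image (Sym2.map fun u => (some (Sum.inl u) : Option (α ⊕ β))) ∪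
        B.edgeFinset.image (Sym2.map fun v => some (Sum.inr v)))
        {s(none, some (Sum.inl x)), s(none, some (Sum.inr y))}
  have h2 := Finset.card_union_le
    (A.edgeFinset.image (Sym2.map fun u => (some (Sum.inl u) : Option (α ⊕ β))))
    (B.edgeFinset.image (Sym2.map fun v => some (Sum.inr v)))
  have h3 : (A.edgeFinset.image
    (Sym2.map fun u => (some (Sum.inl u) : Option (α ⊕ β)))).card ≤ _ := Finset.card_image_le
  have h4 : (B.edgeFinset.image
    (Sym2.map fun u => (some (Sum.inr u) : Option (α ⊕ β)))).card ≤ _ := Finset.card_image_le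
  have h5 := Finset.card_le_two (a := s((none : Option (α ⊕ β)), some (Sum.inl x)))
    (b := s(none, some (Sum.inr y)))
  have h6 : Nat.card (join A B x y).edgeSet = (join A B x y).edgeFinset.card := by
    rw [Nat.card_eq_fintype_card, SimpleGraph.edgeFinset_card]
  rw [h6, Nat.card_eq_fintype_card, Fintype.card_option, Fintype.card_sum]
  omega

/-- An isomorphism of joins which preserves the root and maps some vertex of the first part to
the first part restricts to an isomorphism of the first parts. -/
theorem exists_iso_of_join {A : SimpleGraph α} {B : SimpleGraph β} {A' : SimpleGraph α'}
    {B' : SimpleGraph β'} {x : α} {y : β} {x' : α'} {y' : β'}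
    (φ : join A B x y ≃g join A' B' x' y') (hφ : φ none = none)
    (f : α → α') (g : α' → α) (hf : ∀ u, φ (some (Sum.inl u)) = some (Sum.inl (f u)))
    (hg : ∀ u, φ.symm (some (Sum.inl u)) = some (Sum.inl (g u))) :
    ∃ ψ : A ≃g A', ψ x = x' := by
  have h1 : ∀ u, g (f u) = u := fun u => by
    have := hg (f u)
    rw [← hf, φ.symm_apply_apply] at this
    simpa using this.symm
  have h2 : ∀ u, f (g u) = u := fun u => by
    have := hf (g u)
    rw [← hg, φ.apply_symm_apply] at this
    simpa using this.symm
  refine ⟨⟨⟨f, g, h1, h2⟩, ?_⟩, ?_⟩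
  · intro u v
    have := φ.map_adj_iff (v := some (Sum.inl u)) (w := some (Sum.inl v))
    rw [hf, hf] at this
    exact this
  · have := (φ.map_adj_iff (v := none) (w := some (Sum.inl x))).2 (rfl : x = x)
    rw [hf, hφ] at this
    exact this

/-- An isomorphism of joins which preserves the root maps the first part to one of the parts. -/
theorem join_map_inl {A : SimpleGraph α} {B : SimpleGraph β} {A' : SimpleGraph α'}
    {B' : SimpleGraph β'} (hA : A.Connected) {x : α} {y : β} {x' : α'} {y' : β'}
    (φ : join A B x y ≃g join A' B' x' y') (hφ : φ none = none) :
    (∃ f : α → α', ∀ u, φ (some (Sum.inl u)) = some (Sum.inl (f u))) ∨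
      ∃ f : α → β', ∀ u, φ (some (Sum.inl u)) = some (Sum.inr (f u)) := by
  have hne : ∀ z, φ (some z) ≠ none := fun z h => by
    rw [← hφ] at h
    exact Option.some_ne_none _ (φ.injective h)
  -- No edge joins the two parts and the root is already taken, so the image of a walk inside A
  -- cannot change parts.
  have key : ∀ (u v : α), (∃ w, φ (some (Sum.inl u)) = some (Sum.inl w)) →
      ∃ w, φ (some (Sum.inl v)) = some (Sum.inl w) := by
    intro u v hu
    obtain ⟨p⟩ := hA u v
    induction p with
    | nil => exact hu
    | @cons a b c hab p ih =>
      apply ih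
      obtain ⟨w, hw⟩ := hu
      have hadj := (φ.map_adj_iff (v := some (Sum.inl a)) (w := some (Sum.inl b))).2 hab
      rw [hw] at hadj
      rcases hb : φ (some (Sum.inl b)) with _ | w' | w'
      · exact absurd hb (hne _)
      · exact ⟨w', rfl⟩
      · rw [hb] at hadj
        exact hadj.elim
  rcases hx : φ (some (Sum.inl x)) with _ | w | w
  · exact absurd hx (hne _)
  · left
    choose f hf using fun v => key x v ⟨w, hx⟩
    exact ⟨f, hf⟩
  · right
    have : ∀ v, ∃ w, φ (some (Sum.inl v)) = some (Sum.inr w) := by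
      intro v
      rcases hv : φ (some (Sum.inl v)) with _ | w' | w'
      · exact absurd hv (hne _)
      · obtain ⟨w'', h⟩ := key v x ⟨w', hv⟩
        rw [h] at hx
        simp at hx
      · exact ⟨w', rfl⟩
    choose f hf using this
    exact ⟨f, hf⟩

/-- The two parts of a join can be exchanged. -/
def joinSwap (A : SimpleGraph α) (B : SimpleGraph β) (x : α) (y : β) :
    join A B x y ≃g join B A y x where
  toEquiv := Equiv.optionCongr (Equiv.sumComm α β)
  map_rel_iff' := by
    rintro (_ | u | v) (_ | u' | v') <;> exact Iff.rfl

end Join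

/-- An isomorphism fixing the new vertex either preserves or exchanges the two parts. Exchange is
impossible for different sizes, as the larger part does not inject into the smaller one. -/
theorem join_cancel {a b : ℕ} (hab : a ≠ b) {A A' : SimpleGraph (Fin (a + 1))}
    {B B' : SimpleGraph (Fin (b + 1))} (hA : A.Connected) (hB : B.Connected)
    (hA' : A'.Connected) (hB' : B'.Connected) {x x' : Fin (a + 1)} {y y' : Fin (b + 1)}
    (φ : join A B x y ≃g join A' B' x' y') (hφ : φ none = none) :
    (∃ ψ : A ≃g A', ψ x = x') ∧ ∃ ψ : B ≃g B', ψ y = y' := by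
  have hφ' : φ.symm none = none := by
    rw [← hφ, φ.symm_apply_apply, hφ]
  have hinj : ∀ {α β γ δ : Type} {A : SimpleGraph α} {B : SimpleGraph β} {C : SimpleGraph γ}
      {D : SimpleGraph δ} {x : α} {y : β} {z : γ} {w : δ} (φ : join A B x y ≃g join C D z w)
      (f : α → δ), (∀ u, φ (some (Sum.inl u)) = some (Sum.inr (f u))) → Function.Injective f := by
    intro _ _ _ _ _ _ _ _ _ _ _ _ φ f hf u v huv
    have : φ (some (Sum.inl u)) = φ (some (Sum.inl v)) := by rw [hf, hf, huv]
    simpa using φ.injective this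
  have hside : ∀ {a b : ℕ} {A A' : SimpleGraph (Fin (a + 1))} {B B' : SimpleGraph (Fin (b + 1))}
      {x x' : Fin (a + 1)} {y y' : Fin (b + 1)} (_ : A.Connected) (_ : B.Connected)
      (_ : A'.Connected) (_ : B'.Connected) (φ : join A B x y ≃g join A' B' x' y'),
      φ none = none → φ.symm none = none → b < a → ∃ f : Fin (a + 1) → Fin (a + 1),
        ∀ u, φ (some (Sum.inl u)) = some (Sum.inl (f u)) := by
    intro a b A A' B B' x x' y y' cA cB cA' cB' φ h h' hlt
    rcases join_map_inl cA φ h with hf | ⟨f, hf⟩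
    · exact hf
    · have := Fintype.card_le_of_injective f (hinj φ f hf)
      simp at this
      omega
  have hmain : ∀ {a b : ℕ} {A A' : SimpleGraph (Fin (a + 1))} {B B' : SimpleGraph (Fin (b + 1))}
      {x x' : Fin (a + 1)} {y y' : Fin (b + 1)} (_ : A.Connected) (_ : B.Connected)
      (_ : A'.Connected) (_ : B'.Connected) (φ : join A B x y ≃g join A' B' x' y'),
      φ none = none → φ.symm none = none → b < a →
        (∃ ψ : A ≃g A', ψ x = x') ∧ ∃ ψ : B ≃g B', ψ y = y' := by
    intro a b A A' B B' x x' y y' cA cB cA' cB' φ h h' hlt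
    obtain ⟨f, hf⟩ := hside cA cB cA' cB' φ h h' hlt
    obtain ⟨g, hg⟩ := hside cA' cB' cA cB φ.symm h' h hlt
    refine ⟨exists_iso_of_join φ h f g hf hg, ?_⟩
    -- The second part is treated as a first part after exchanging the sides. It cannot meet the
    -- first part of the target, which is already the image of the first part.
    set χ := (joinSwap B A y x).trans (φ.trans (joinSwap A' B' x' y')) with hχ
    have e0 : χ none = none := by
      change joinSwap A' B' x' y' (φ none) = none
      rw [h]; rfl
    have e0' : χ.symm none = none := by
      rw [← e0, χ.symm_apply_apply, e0]
    have eχ : ∀ v, χ (some (Sum.inl v)) = joinSwap A' B' x' y' (φ (some (Sum.inr v))) :=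
      fun v => rfl
    have eχ' : ∀ v, χ.symm (some (Sum.inl v)) =
        joinSwap A B x y (φ.symm (some (Sum.inr v))) := fun v => rfl
    have r1 : ∀ v, ∃ w, χ (some (Sum.inl v)) = some (Sum.inl w) := by
      intro v
      rcases hv : φ (some (Sum.inr v)) with _ | w | w
      · rw [← h] at hv
        exact absurd (φ.injective hv) (Option.some_ne_none _)
      · have := hg w
        rw [← hv, φ.symm_apply_apply] at this
        simp at this
      · exact ⟨w, by rw [eχ, hv]; rfl⟩
    have r2 : ∀ v, ∃ w, χ.symm (some (Sum.inl v)) = some (Sum.inl w) := by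
      intro v
      rcases hv : φ.symm (some (Sum.inr v)) with _ | w | w
      · rw [← h'] at hv
        exact absurd (φ.symm.injective hv) (Option.some_ne_none _)
      · have := hf w
        rw [← hv, φ.apply_symm_apply] at this
        simp at this
      · exact ⟨w, by rw [eχ', hv]; rfl⟩
    choose f' hf' using r1
    choose g' hg' using r2
    exact exists_iso_of_join χ e0 f' g' hf' hg'
  rcases Nat.lt_or_gt_of_ne hab with hlt | hlt
  · refine And.symm (hmain hB hA hB' hA'
      ((joinSwap B A y x).trans (φ.trans (joinSwap A' B' x' y'))) ?_ ?_ hlt)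
    · change joinSwap A' B' x' y' (φ none) = none
      rw [hφ]; rfl
    · change joinSwap A B x y (φ.symm none) = none
      rw [hφ']; rfl
  · exact hmain hA hB hA' hB' φ hφ hφ' hlt

/-- Joining at a new vertex, taken as the root, adds two edges and is injective on isomorphism
classes by `join_cancel`. -/
theorem rootedCount_mul_le {a b : ℕ} (hab : a ≠ b) :
    rootedCount a * rootedCount b ≤ rootedCount (a + b + 2) := by
  have hcard : Fintype.card (Option (Fin (a + 1) ⊕ Fin (b + 1))) = a + b + 2 + 1 := by
    simp; omega
  let e := Fintype.equivFinOfCardEq hcard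
  let J : RootedTree a × RootedTree b → RootedTree (a + b + 2) := fun z =>
    Quotient.mk (rootedSetoid (a + b + 2))
      (⟨(join z.1.out.1.1 z.2.out.1.1 z.1.out.2 z.2.out.2).map e.toEmbedding,
        (SimpleGraph.Iso.map e _).isTree_iff.1 (join_isTree z.1.out.1.2 z.2.out.1.2 _ _)⟩, e none)
  have hJ : Function.Injective J := by
    rintro ⟨p, q⟩ ⟨p', q'⟩ h
    obtain ⟨φ, hφ⟩ := Quotient.exact h
    have := join_cancel hab p.out.1.2.connected q.out.1.2.connected p'.out.1.2.connected
      q'.out.1.2.connected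
      ((SimpleGraph.Iso.map e _).trans (φ.trans (SimpleGraph.Iso.map e _).symm)) (by
        change (SimpleGraph.Iso.map e _).symm (φ (e none)) = none
        erw [hφ]
        exact e.symm_apply_apply none)
    refine Prod.ext ?_ ?_
    · change p = p'
      rw [← Quotient.out_eq p, ← Quotient.out_eq p']
      exact Quotient.sound this.1
    · change q = q'
      rw [← Quotient.out_eq q, ← Quotient.out_eq q']
      exact Quotient.sound this.2
  have := Nat.card_le_card_of_injective J hJ
  rwa [Nat.card_prod] at this

/-- Starting from a tree of size j > m keeps the accumulated tree larger than each block of size m,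
so the sizes always differ when joining. -/
theorem rootedCount_pow_le {m j : ℕ} (hj : m < j) (q : ℕ) :
    rootedCount m ^ q ≤ rootedCount (j + q * (m + 2)) := by
  induction q with
  | zero => simpa using rootedCount_pos j
  | succ q ih =>
    have h := rootedCount_mul_le (a := j + q * (m + 2)) (b := m) (by nlinarith)
    have e : j + (q + 1) * (m + 2) = j + q * (m + 2) + m + 2 := by ring
    rw [e, pow_succ]
    exact (Nat.mul_le_mul_right _ ih).trans h

/-- If it failed, the upper limit would be at most 1/s², hence s² would be at most Otter's constant.
-/
theorem exists_frequently_of_otter {s : ℝ} (hs : 0 < s)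
    (h : Real.sqrt otterConstant < s) : ∃ c : ℝ, 1 / s ^ 2 < c ∧
      ∃ᶠ m : ℕ in atTop, c ≤ (Nat.card (UnlabeledTree m) : ℝ) ^ (1 / (m : ℝ)) := by
  by_contra! hcon
  set u : ℕ → ℝ := fun m => (Nat.card (UnlabeledTree m) : ℝ) ^ (1 / (m : ℝ)) with hu
  have hlt : ∀ c, 1 / s ^ 2 < c → ∀ᶠ m in atTop, u m < c := hcon
  have hu1 : ∀ m, 1 ≤ u m := fun m => by
    refine Real.one_le_rpow ?_ (by positivity)
    have : Nonempty (UnlabeledTree m) := ⟨Quotient.mk _ (Classical.arbitrary _)⟩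
    exact_mod_cast (Nat.card_pos : 0 < Nat.card (UnlabeledTree m))
  have hcob : IsCoboundedUnder (· ≤ ·) atTop u :=
    (isBoundedUnder_of ⟨1, hu1⟩ : IsBoundedUnder (· ≥ ·) atTop u).isCoboundedUnder_le
  have hL : limsup u atTop ≤ 1 / s ^ 2 := by
    refine le_of_forall_gt_imp_ge_of_dense fun c hc => ?_
    exact limsup_le_of_le hcob ((hlt c hc).mono fun m hm => hm.le)
  -- Positivity is needed to invert the limit. The negated conclusion also supplies the boundedness
  -- without which a real `limsup` carries no information.
  have hL1 : 1 ≤ limsup u atTop := by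
    refine le_limsup_of_frequently_le (Frequently.of_forall hu1) ?_
    exact ⟨1 / s ^ 2 + 1, eventually_map.2 ((hlt _ (lt_add_one _)).mono fun m hm => hm.le)⟩
  have h1 : s ^ 2 ≤ otterConstant := by
    rw [otterConstant]
    change s ^ 2 ≤ (limsup u atTop)⁻¹
    rw [le_inv_comm₀ (by positivity) (by linarith)]
    simpa using hL
  have h2 := Real.sqrt_le_sqrt h1
  rw [Real.sqrt_sq hs.le] at h2
  linarith

/-- Above the threshold given by Otter's constant, `s ^ (2 m) * |𝒯_m|` tends to infinity. -/
theorem tendsto_card_mul_pow {s : ℝ} (hs : 0 < s ∧ s < 1)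
    (h : Real.sqrt otterConstant < s) :
    Tendsto (fun m : ℕ => (Fintype.card (UnlabeledTree m) : ℝ) * s ^ (m + m)) atTop atTop := by
  obtain ⟨c, hc, hfreq⟩ := exists_frequently_of_otter hs.1 h
  have hs2 : 0 < s ^ 2 := by have := hs.1; positivity
  have hcs : 1 < c * s ^ 2 := by rwa [div_lt_iff₀ hs2] at hc
  have hc0 : 0 < c := lt_trans (by positivity) hc
  have hev : ∀ᶠ m : ℕ in atTop, 4 / s ^ 4 ≤ (c * s ^ 2) ^ m :=
    (tendsto_pow_atTop_atTop_of_one_lt hcs).eventually_ge_atTop _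
  obtain ⟨m, hm1, hm2, hm3⟩ := (hfreq.and_eventually (hev.and (eventually_ge_atTop 1))).exists
  have hm0 : (m : ℝ) ≠ 0 := by exact_mod_cast (by omega : m ≠ 0)
  have hcm : c ^ m ≤ (rootedCount m : ℝ) := by
    have h1 : c ^ m ≤ (Nat.card (UnlabeledTree m) : ℝ) := by
      calc c ^ m ≤ ((Nat.card (UnlabeledTree m) : ℝ) ^ (1 / (m : ℝ))) ^ m := by gcongr
        _ = _ := by
          rw [← Real.rpow_natCast, ← Real.rpow_mul (by positivity), one_div,
            inv_mul_cancel₀ hm0, Real.rpow_one]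
    refine h1.trans ?_
    rw [Nat.card_eq_fintype_card]
    exact_mod_cast card_le_rootedCount m
  -- A block of m edges uses m + 2 edges when joined. The size m was chosen so that (c s²)^m also
  -- pays for the extra s^4 and leaves a gain of 4 per block.
  have hblock : 4 ≤ (rootedCount m : ℝ) * s ^ (2 * (m + 2)) := by
    rw [div_le_iff₀ (by have := hs.1; positivity)] at hm2
    calc (4 : ℝ) ≤ (c * s ^ 2) ^ m * s ^ 4 := hm2
      _ = c ^ m * s ^ (2 * (m + 2)) := by rw [mul_pow]; ring
      _ ≤ _ := by have := hs.1; gcongr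
  set δ : ℝ := s ^ (2 * (m + 1 + (m + 2))) / (2 * (m + 2)) with hδ
  have hδ0 : 0 < δ := by have := hs.1; positivity
  have hdiv : Tendsto (fun M : ℕ => (((M - (m + 1)) / (m + 2) : ℕ) : ℝ)) atTop atTop :=
    tendsto_natCast_atTop_atTop.comp
      ((Nat.tendsto_div_const_atTop (by omega)).comp (tendsto_sub_atTop_nat (m + 1)))
  refine tendsto_atTop_mono' atTop ?_ (hdiv.const_mul_atTop hδ0)
  filter_upwards [eventually_ge_atTop (m + 1)] with M hM
  -- Write M = j + q(m + 2) with m < j < 2m + 3: an initial tree of bounded size and q blocks.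
  set q := (M - (m + 1)) / (m + 2) with hq
  set j := m + 1 + (M - (m + 1)) % (m + 2) with hj
  have hMj : M = j + q * (m + 2) := by
    have := Nat.div_add_mod (M - (m + 1)) (m + 2)
    rw [hq, hj, mul_comm _ (m + 2)]
    omega
  have hjlt : j < m + 1 + (m + 2) := by
    have := Nat.mod_lt (M - (m + 1)) (show 0 < m + 2 by omega)
    omega
  have hr := rootedCount_pow_le (m := m) (j := j) (by omega) q
  rw [← hMj] at hr
  have hr' : (rootedCount m : ℝ) ^ q ≤ rootedCount M := by exact_mod_cast hr
  have ht : (rootedCount M : ℝ) ≤ Fintype.card (UnlabeledTree M) * ((M : ℝ) + 1) := by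
    exact_mod_cast rootedCount_le M
  have hq2 : (q : ℝ) + 1 ≤ 2 ^ q := by exact_mod_cast q.lt_two_pow_self
  have hM1 : (M : ℝ) + 1 ≤ ((q : ℝ) + 2) * (m + 2) := by
    have : M + 1 ≤ (q + 2) * (m + 2) := by
      rw [hMj]
      nlinarith
    exact_mod_cast this
  have hsp : (0 : ℝ) < s ^ (M + M) := by have := hs.1; positivity
  have h4 : (4 : ℝ) ^ q * s ^ (2 * (m + 1 + (m + 2))) ≤ rootedCount M * s ^ (M + M) := by
    calc (4 : ℝ) ^ q * s ^ (2 * (m + 1 + (m + 2)))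
        ≤ ((rootedCount m : ℝ) * s ^ (2 * (m + 2))) ^ q * s ^ (2 * j) := by
          have := hs.1
          refine mul_le_mul (pow_le_pow_left₀ (by norm_num) hblock q)
            (pow_le_pow_of_le_one hs.1.le hs.2.le (by omega)) (by positivity) (by positivity)
      _ = (rootedCount m : ℝ) ^ q * s ^ (M + M) := by
          rw [mul_pow, ← pow_mul, mul_assoc, ← pow_add]
          congr 2
          rw [hMj]; ring
      _ ≤ _ := by gcongr
  have h5 : (rootedCount M : ℝ) * s ^ (M + M) ≤
      Fintype.card (UnlabeledTree M) * s ^ (M + M) * (((q : ℝ) + 2) * (m + 2)) := by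
    calc _ ≤ (Fintype.card (UnlabeledTree M) * ((M : ℝ) + 1)) * s ^ (M + M) := by gcongr
      _ = Fintype.card (UnlabeledTree M) * s ^ (M + M) * ((M : ℝ) + 1) := by ring
      _ ≤ _ := by gcongr
  -- Of 4^q = 2^q · 2^q, one factor exceeds q and the other pays for the loss from forgetting the
  -- root, which is linear in q.
  have h6 : δ * q * (((q : ℝ) + 2) * (m + 2)) ≤ (4 : ℝ) ^ q * s ^ (2 * (m + 1 + (m + 2))) := by
    have e1 : (4 : ℝ) ^ q = 2 ^ q * 2 ^ q := by rw [← mul_pow]; norm_num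
    have e2 : δ * q * (((q : ℝ) + 2) * (m + 2)) =
        (q * (((q : ℝ) + 2) / 2)) * s ^ (2 * (m + 1 + (m + 2))) := by
      rw [hδ]; field_simp
    rw [e1, e2]
    have hq0 : (0 : ℝ) ≤ q := Nat.cast_nonneg _
    refine mul_le_mul_of_nonneg_right ?_ (by have := hs.1; positivity)
    exact mul_le_mul (by linarith) (by linarith) (by positivity) (by positivity)
  have h7 : 0 < ((q : ℝ) + 2) * (m + 2) := by positivity
  exact le_of_mul_le_mul_right (h6.trans (h4.trans h5)) h7

end Growth

/-! ### Asymptotics for N = o(log n / log log n) -/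

section Asymptotics

theorem tendsto_log_log_nat : Tendsto (fun n : ℕ => Real.log (Real.log n)) atTop atTop :=
  Real.tendsto_log_atTop.comp (Real.tendsto_log_atTop.comp tendsto_natCast_atTop_atTop)

theorem eventually_add_one_le {N : ℕ → ℕ} (hN : Tendsto N atTop atTop)
    (hN' : (fun n => (N n : ℝ)) =o[atTop] fun n : ℕ => Real.log n / Real.log (Real.log n)) :
    ∀ᶠ n : ℕ in atTop,
      ((N n : ℝ) + 1) * Real.log (Real.log n) ≤ Real.log n / 68 := by
  -- Here 136 = 2 · 68, as N + 1 ≤ 2N; and 68 = 2 · 2 · 17 makes the exponent 17(N + 1) · 2 log log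
  -- n at most half of log n.
  have h := hN'.bound (show (0 : ℝ) < 1 / 136 by norm_num)
  filter_upwards [h, hN.eventually_ge_atTop 1, tendsto_log_log_nat.eventually_ge_atTop 1,
    (Real.tendsto_log_atTop.comp tendsto_natCast_atTop_atTop).eventually_ge_atTop 1]
    with n h1 h2 h3 h4
  simp only [Function.comp_apply] at h4
  rw [Real.norm_of_nonneg (Nat.cast_nonneg _), Real.norm_of_nonneg (by positivity)] at h1
  have h2' : (1 : ℝ) ≤ N n := by exact_mod_cast h2
  have h5 : (N n : ℝ) * Real.log (Real.log n) ≤ 1 / 136 * Real.log n := by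
    rw [← mul_div_assoc, le_div_iff₀ (by linarith)] at h1
    exact h1
  nlinarith

theorem eventually_add_one_le_log {N : ℕ → ℕ} (hN : Tendsto N atTop atTop)
    (hN' : (fun n => (N n : ℝ)) =o[atTop] fun n : ℕ => Real.log n / Real.log (Real.log n)) :
    ∀ᶠ n : ℕ in atTop, (N n : ℝ) + 1 ≤ Real.log n := by
  filter_upwards [eventually_add_one_le hN hN', tendsto_log_log_nat.eventually_ge_atTop 1,
    (Real.tendsto_log_atTop.comp tendsto_natCast_atTop_atTop).eventually_ge_atTop 1]
    with n h1 h2 h3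
  simp only [Function.comp_apply] at h3
  have : (0 : ℝ) ≤ N n := Nat.cast_nonneg _
  nlinarith

theorem tendsto_log_div_nat : Tendsto (fun n : ℕ => Real.log n / n) atTop (𝓝 0) :=
  Real.isLittleO_log_id_atTop.tendsto_div_nhds_zero.comp tendsto_natCast_atTop_atTop

theorem tendsto_div_nat {N : ℕ → ℕ} (hN : Tendsto N atTop atTop)
    (hN' : (fun n => (N n : ℝ)) =o[atTop] fun n : ℕ => Real.log n / Real.log (Real.log n)) :
    Tendsto (fun n : ℕ => ((N n : ℝ) + 1) / n) atTop (𝓝 0) := by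
  refine tendsto_of_tendsto_of_tendsto_of_le_of_le' tendsto_const_nhds tendsto_log_div_nat
    (Eventually.of_forall fun n => by positivity) ?_
  filter_upwards [eventually_add_one_le_log hN hN'] with n hn
  gcongr

/-- Eventually log(C(N + 1)) ≤ 2 log log n, so the power is at most n^(1/2) and the product at most
n^(-1/2). -/
theorem tendsto_pow_mul_inv {N : ℕ → ℕ} (hN : Tendsto N atTop atTop)
    (hN' : (fun n => (N n : ℝ)) =o[atTop] fun n : ℕ => Real.log n / Real.log (Real.log n))
    {C : ℝ} (hC : 1 ≤ C) :
    Tendsto (fun n : ℕ => (C * ((N n : ℝ) + 1)) ^ (17 * (N n + 1)) * (n : ℝ)⁻¹) atTop (𝓝 0) := by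
  have hlim : Tendsto (fun n : ℕ => Real.exp (-(Real.log n / 2))) atTop (𝓝 0) :=
    Real.tendsto_exp_neg_atTop_nhds_zero.comp
      ((Real.tendsto_log_atTop.comp tendsto_natCast_atTop_atTop).atTop_div_const two_pos)
  refine tendsto_of_tendsto_of_tendsto_of_le_of_le' tendsto_const_nhds hlim
    (Eventually.of_forall fun n => by positivity) ?_
  filter_upwards [eventually_add_one_le hN hN', eventually_add_one_le_log hN hN',
    tendsto_log_log_nat.eventually_ge_atTop (Real.log C),
    tendsto_log_log_nat.eventually_ge_atTop 1, eventually_gt_atTop 0] with n h1 h2 h3 h4 h5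
  have hn : (0 : ℝ) < n := by exact_mod_cast h5
  have hN0 : (0 : ℝ) < (N n : ℝ) + 1 := by positivity
  have hC0 : 0 < C := by linarith
  have hlog : Real.log (C * ((N n : ℝ) + 1)) ≤ 2 * Real.log (Real.log n) := by
    rw [Real.log_mul hC0.ne' hN0.ne']
    have := Real.log_le_log hN0 h2
    linarith
  have hpow : (C * ((N n : ℝ) + 1)) ^ (17 * (N n + 1)) =
      Real.exp (17 * ((N n : ℝ) + 1) * Real.log (C * ((N n : ℝ) + 1))) := by
    rw [← Real.exp_log (show 0 < C * ((N n : ℝ) + 1) by positivity), ← Real.exp_nat_mul,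
      Real.log_exp]
    push_cast
    rfl
  have hinv : (n : ℝ)⁻¹ = Real.exp (-Real.log n) := by rw [Real.exp_neg, Real.exp_log hn]
  rw [hpow, hinv, ← Real.exp_add, Real.exp_le_exp]
  nlinarith

/-- All sufficiently large `n` are admissible. -/
theorem eventually_admissible {k : ℕ} (hk : 1 ≤ k) {lam ε s : ℝ} (hlam : 0 < lam)
    (hε : 0 < ε ∧ ε < 1) (hs : 0 < s ∧ s < 1) : ∀ᶠ n : ℕ in atTop, Admissible n k lam ε s := by
  filter_upwards [eventually_gt_atTop 0,
    tendsto_natCast_atTop_atTop.eventually_ge_atTop ((k : ℝ) * lam),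
    tendsto_natCast_atTop_atTop.eventually_ge_atTop (2 * lam)] with n h1 h2 h3
  have hn : (0 : ℝ) < n := by exact_mod_cast h1
  refine ⟨hlam, hε, hs, h1, hk, h2, ?_⟩
  rw [div_le_iff₀ hn]
  nlinarith [hs.1]

/-- The effective correlation tends to `s` fast enough for its `N`-th power. -/
theorem tendsto_corr_div_pow {lam s : ℝ} (hlam : 0 < lam) (hs : 0 < s ∧ s < 1) {N : ℕ → ℕ}
    (hN : Tendsto N atTop atTop)
    (hN' : (fun n => (N n : ℝ)) =o[atTop] fun n : ℕ => Real.log n / Real.log (Real.log n)) :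
    Tendsto (fun n => (corr n lam s / s) ^ N n) atTop (𝓝 1) := by
  have hlow : Tendsto (fun n : ℕ => 1 - 2 * lam * (((N n : ℝ) + 1) / n)) atTop (𝓝 1) := by
    simpa using ((tendsto_div_nat hN hN').const_mul (2 * lam)).const_sub 1
  have key : ∀ᶠ n : ℕ in atTop, 1 - 2 * lam / n ≤ corr n lam s / s ∧ corr n lam s / s ≤ 1 ∧
      2 * lam / n ≤ 1 := by
    filter_upwards [eventually_gt_atTop 0,
      tendsto_natCast_atTop_atTop.eventually_ge_atTop (2 * lam)] with n h1 h2
    have hn : (0 : ℝ) < n := by exact_mod_cast h1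
    have hx : 0 < lam / n := by positivity
    have hx2 : lam / n ≤ 1 / 2 := by rw [div_le_iff₀ hn]; linarith
    have e1 : lam * s / n = lam / n * s := by ring
    have e2 : 2 * lam / n = 2 * (lam / n) := by ring
    have hden : 0 < 1 - lam / n * s := by nlinarith [hs.1, hs.2]
    have hc : corr n lam s / s = (1 - lam / n) / (1 - lam / n * s) := by
      rw [corr, e1]
      have := hs.1.ne'
      have := hden.ne'
      field_simp
    rw [hc, e2]
    refine ⟨?_, ?_, by linarith⟩
    · rw [le_div_iff₀ hden]
      nlinarith [hs.1, hs.2, mul_pos hx hs.1]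
    · rw [div_le_one hden]
      nlinarith [hs.1, hs.2]
  refine tendsto_of_tendsto_of_tendsto_of_le_of_le' hlow tendsto_const_nhds ?_ ?_
  · filter_upwards [key] with n ⟨h1, h2, h3⟩
    -- Bernoulli's inequality turns the error 2λ/n of one factor into an error 2λN/n for the power,
    -- which still vanishes.
    have hb := one_add_mul_le_pow (show (-2 : ℝ) ≤ -(2 * lam / n) by linarith) (N n)
    have hp : (1 + -(2 * lam / n)) ^ N n ≤ (corr n lam s / s) ^ N n :=
      pow_le_pow_left₀ (by linarith) (by linarith) _
    have : 0 ≤ 2 * lam / n := by positivity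
    calc _ = 1 + (N n : ℝ) * -(2 * lam / n) - 2 * lam / n := by ring
      _ ≤ _ := by linarith
  · filter_upwards [key] with n ⟨h1, h2, h3⟩
    exact pow_le_one₀ (by linarith) h2

end Asymptotics

/-! ### The second moment argument -/

section Separation

/-- If the mean is at least `D r - e` and the second moment at most `(D r)² + 2 D + e`, where
`D → ∞`, `r → 1` and `e → 0`, then the mean is eventually positive, `D` is negligible compared to
its square, and so is the variance. -/
theorem second_moment_method {D r e E Q : ℕ → ℝ} (hD : Tendsto D atTop atTop)
    (hr : Tendsto r atTop (𝓝 1)) (he : Tendsto e atTop (𝓝 0))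
    (hE : ∀ᶠ n in atTop, D n * r n - e n ≤ E n)
    (hQ : ∀ᶠ n in atTop, Q n ≤ (D n * r n) ^ 2 + 2 * D n + e n)
    (hvar : ∀ᶠ n in atTop, E n ^ 2 ≤ Q n) :
    (∀ᶠ n in atTop, 0 < E n) ∧ Tendsto (fun n => D n / E n ^ 2) atTop (𝓝 0) ∧
      Tendsto (fun n => (Q n - E n ^ 2) / E n ^ 2) atTop (𝓝 0) := by
  have hDi : Tendsto (fun n => (D n)⁻¹) atTop (𝓝 0) := tendsto_inv_atTop_zero.comp hD
  have hlow : Tendsto (fun n => r n - e n * (D n)⁻¹) atTop (𝓝 1) := by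
    simpa using hr.sub (he.mul hDi)
  have hpos : ∀ᶠ n in atTop, 0 < D n ∧ 0 < r n - e n * (D n)⁻¹ ∧
      D n * (r n - e n * (D n)⁻¹) ≤ E n := by
    filter_upwards [hD.eventually_gt_atTop 0, hlow.eventually (lt_mem_nhds zero_lt_one), hE]
      with n h1 h2 h3
    refine ⟨h1, h2, ?_⟩
    have : D n * (r n - e n * (D n)⁻¹) = D n * r n - e n := by
      field_simp
    linarith
  refine ⟨?_, ?_, ?_⟩
  · filter_upwards [hpos] with n ⟨h1, h2, h3⟩
    exact (mul_pos h1 h2).trans_le h3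
  · have hlim : Tendsto (fun n => (D n)⁻¹ / (r n - e n * (D n)⁻¹) ^ 2) atTop (𝓝 0) := by
      have h := hDi.div (hlow.pow 2) (by norm_num)
      rw [one_pow, zero_div] at h
      exact h
    refine tendsto_of_tendsto_of_tendsto_of_le_of_le' tendsto_const_nhds hlim ?_ ?_
    · filter_upwards [hpos] with n ⟨h1, h2, h3⟩
      positivity
    · filter_upwards [hpos] with n ⟨h1, h2, h3⟩
      have hm := mul_pos h1 h2
      calc D n / E n ^ 2 ≤ D n / (D n * (r n - e n * (D n)⁻¹)) ^ 2 := by gcongr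
        _ = _ := by rw [mul_pow]; field_simp
  -- Dividing both bounds by D² shows that Q / E² is at most a ratio which tends to 1.
  · have hlim : Tendsto (fun n => (r n ^ 2 + 2 * (D n)⁻¹ + e n * (D n)⁻¹ ^ 2) /
        (r n - e n * (D n)⁻¹) ^ 2 - 1) atTop (𝓝 0) := by
      have h := ((((hr.pow 2).add (hDi.const_mul 2)).add (he.mul (hDi.pow 2))).div
        (hlow.pow 2) (by norm_num)).sub_const 1
      simpa using h
    refine tendsto_of_tendsto_of_tendsto_of_le_of_le' tendsto_const_nhds hlim ?_ ?_
    · filter_upwards [hvar] with n hn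
      exact div_nonneg (sub_nonneg.2 hn) (sq_nonneg _)
    · filter_upwards [hpos, hvar, hQ] with n ⟨h1, h2, h3⟩ h4 h5
      have hm := mul_pos h1 h2
      have hE0 := hm.trans_le h3
      rw [sub_div, div_self (by positivity)]
      refine sub_le_sub_right ?_ 1
      calc Q n / E n ^ 2 ≤ Q n / (D n * (r n - e n * (D n)⁻¹)) ^ 2 := by
            have : 0 ≤ Q n := (sq_nonneg _).trans h4
            gcongr
        _ ≤ ((D n * r n) ^ 2 + 2 * D n + e n) / (D n * (r n - e n * (D n)⁻¹)) ^ 2 := by gcongr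
        _ = _ := by
            rw [mul_pow, mul_pow, mul_comm (D n ^ 2) ((r n - e n * (D n)⁻¹) ^ 2), ← div_div,
              div_right_comm]
            congr 1
            field_simp

theorem memLp_two_of_finite {Ω : Type*} [Finite Ω] [MeasurableSpace Ω] [DiscreteMeasurableSpace Ω]
    (μ : Measure Ω) [IsFiniteMeasure μ] (f : Ω → ℝ) : MemLp f 2 μ := by
  rw [memLp_two_iff_integrable_sq Measurable.of_discrete.aestronglyMeasurable]
  exact Integrable.of_finite

/-- With null mean zero the gap is |E_P f|, and variances below c² (E_P f)² are the required square
root bound. -/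
theorem stronglySeparates_of_tendsto {P Q : (n : ℕ) → Measure (Graph n × Graph n)}
    {f : (n : ℕ) → Graph n × Graph n → ℝ}
    (hQ0 : ∀ᶠ n in atTop, ∫ x, f n x ∂(Q n) = 0)
    (hP0 : ∀ᶠ n in atTop, ∫ x, f n x ∂(P n) ≠ 0)
    (hQ : Tendsto (fun n => variance (f n) (Q n) / (∫ x, f n x ∂(P n)) ^ 2) atTop (𝓝 0))
    (hP : Tendsto (fun n => variance (f n) (P n) / (∫ x, f n x ∂(P n)) ^ 2) atTop (𝓝 0)) :
    StronglySeparates P Q f := by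
  rw [StronglySeparates, isLittleO_iff]
  intro c hc
  have hc2 : (0 : ℝ) < c ^ 2 := by positivity
  filter_upwards [hQ0, hP0, hQ.eventually (gt_mem_nhds hc2), hP.eventually (gt_mem_nhds hc2)]
    with n h1 h2 h3 h4
  have h5 : 0 < (∫ x, f n x ∂(P n)) ^ 2 := by positivity
  rw [div_lt_iff₀ h5] at h3 h4
  rw [h1, sub_zero, Real.norm_of_nonneg (Real.sqrt_nonneg _), Real.norm_of_nonneg (abs_nonneg _)]
  refine Real.sqrt_le_iff.2 ⟨by positivity, ?_⟩
  rw [mul_pow, sq_abs]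
  exact max_le h4.le h3.le

end Separation

end CorrSBM

end

/-! ### Assembly of the proposition -/

theorem mainTheorem3 (k : ℕ) (hk : 1 ≤ k) (lam ε s : ℝ) (hlam : 0 < lam)
    (hε : 0 < ε ∧ ε < 1) (hs : 0 < s ∧ s < 1)
    (hKS : s ≤ 1 / (lam * ε ^ 2)) (hOtter : Real.sqrt CorrSBM.otterConstant < s)
    (N : ℕ → ℕ) (hN : Tendsto N atTop atTop)
    (hN' : (fun n => (N n : ℝ)) =o[atTop] fun n : ℕ => Real.log n / Real.log (Real.log n)) :
    (∀ n : ℕ, 1 ≤ N n → lam * s ≤ n →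
      ∫ x, CorrSBM.treeStat n (N n) lam s x ∂(CorrSBM.lawQ n lam s) = 0) ∧
    (∀ᶠ n : ℕ in atTop,
      ∫ x, CorrSBM.treeStat n (N n) lam s x ∂(CorrSBM.lawP n k lam ε s) ≠ 0) ∧
    Tendsto (fun n : ℕ =>
      variance (CorrSBM.treeStat n (N n) lam s) (CorrSBM.lawQ n lam s) /
        (∫ x, CorrSBM.treeStat n (N n) lam s x ∂(CorrSBM.lawP n k lam ε s)) ^ 2)
      atTop (𝓝 0) ∧
    Tendsto (fun n : ℕ =>
      variance (CorrSBM.treeStat n (N n) lam s) (CorrSBM.lawP n k lam ε s) /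
        (∫ x, CorrSBM.treeStat n (N n) lam s x ∂(CorrSBM.lawP n k lam ε s)) ^ 2)
      atTop (𝓝 0) ∧
    CorrSBM.StronglySeparates (fun n => CorrSBM.lawP n k lam ε s) (fun n => CorrSBM.lawQ n lam s)
      (fun n => CorrSBM.treeStat n (N n) lam s) := by
  have : NeZero k := ⟨by omega⟩
  have hmean : ∀ n : ℕ, 1 ≤ N n → lam * s ≤ n →
      ∫ x, CorrSBM.treeStat n (N n) lam s x ∂(CorrSBM.lawQ n lam s) = 0 := fun n h1 h2 => by
    have hpos : 0 < lam * s := mul_pos hlam hs.1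
    exact CorrSBM.integral_lawQ_treeStat h1
      ⟨div_nonneg hpos.le (Nat.cast_nonneg n), div_le_one_of_le₀ h2 (Nat.cast_nonneg n)⟩
  obtain ⟨C, hC, herr⟩ := CorrSBM.exists_error_bound k hlam hs.1
  -- D is both the null variance and the leading order of the planted mean; r corrects for the
  -- effective correlation, which is slightly below s.
  set D : ℕ → ℝ := fun n => (Fintype.card (CorrSBM.UnlabeledTree (N n)) : ℝ) * s ^ (N n + N n)
  set r : ℕ → ℝ := fun n => (CorrSBM.corr n lam s / s) ^ N n
  have hDr : ∀ n, D n * r n = (Fintype.card (CorrSBM.UnlabeledTree (N n)) : ℝ) * s ^ N n *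
      CorrSBM.corr n lam s ^ N n := fun n => by
    have := hs.1.ne'
    simp only [D, r, div_pow, pow_add]
    field_simp
  have hD : Tendsto D atTop atTop := (CorrSBM.tendsto_card_mul_pow hs hOtter).comp hN
  have hN1 : ∀ᶠ n in atTop, 1 ≤ N n := hN.eventually_ge_atTop 1
  have hadm := CorrSBM.eventually_admissible hk hlam hε hs
  have hsmall : ∀ᶠ n : ℕ in atTop, 2 * (N n + 1) ≤ n := by
    filter_upwards [(CorrSBM.tendsto_div_nat hN hN').eventually
      (gt_mem_nhds (show (0 : ℝ) < 1 / 2 by norm_num)), eventually_gt_atTop 0] with n h1 h2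
    have hn : (0 : ℝ) < n := by exact_mod_cast h2
    rw [div_lt_iff₀ hn] at h1
    have : 2 * ((N n : ℝ) + 1) ≤ n := by linarith
    exact_mod_cast this
  have hvarP : ∀ n, variance (CorrSBM.treeStat n (N n) lam s) (CorrSBM.lawP n k lam ε s) =
      (∫ x, CorrSBM.treeStat n (N n) lam s x ^ 2 ∂(CorrSBM.lawP n k lam ε s)) -
        (∫ x, CorrSBM.treeStat n (N n) lam s x ∂(CorrSBM.lawP n k lam ε s)) ^ 2 := fun n =>
    variance_eq_sub (CorrSBM.memLp_two_of_finite _ _)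
  have hvarQ : ∀ᶠ n in atTop,
      variance (CorrSBM.treeStat n (N n) lam s) (CorrSBM.lawQ n lam s) = D n := by
    filter_upwards [hN1, hadm, hsmall,
      tendsto_natCast_atTop_atTop.eventually_ge_atTop (lam * s)] with n h1 h2 h3 h4
    rw [variance_of_integral_eq_zero Measurable.of_discrete.aemeasurable (hmean n h1 h4)]
    exact CorrSBM.integral_lawQ_sq_eq h1 (by omega) h2
  obtain ⟨hpos, hDE, hvarE⟩ := CorrSBM.second_moment_method
    (E := fun n => ∫ x, CorrSBM.treeStat n (N n) lam s x ∂(CorrSBM.lawP n k lam ε s))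
    (Q := fun n => ∫ x, CorrSBM.treeStat n (N n) lam s x ^ 2 ∂(CorrSBM.lawP n k lam ε s))
    hD (CorrSBM.tendsto_corr_div_pow hlam hs hN hN') (CorrSBM.tendsto_pow_mul_inv hN hN' hC)
    (by
      filter_upwards [hN1, hadm, hsmall] with n h1 h2 h3
      have h4 := CorrSBM.mean_ge h1 (by omega) h2
      have h5 := (herr n (N n) ε h1 h3 h2).1
      have h6 := hDr n
      simp only [r] at h6
      rw [h6]
      linarith)
    (by
      filter_upwards [hN1, hadm, hsmall] with n h1 h2 h3
      have h4 := CorrSBM.second_le h1 (by omega) h2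
      have h5 := (herr n (N n) ε h1 h3 h2).2
      have h6 := hDr n
      simp only [r] at h6
      rw [h6]
      simp only [D]
      linarith)
    (Eventually.of_forall fun n => sub_nonneg.1 (hvarP n ▸ variance_nonneg _ _))
  have hne : ∀ᶠ n : ℕ in atTop,
      ∫ x, CorrSBM.treeStat n (N n) lam s x ∂(CorrSBM.lawP n k lam ε s) ≠ 0 :=
    hpos.mono fun n hn => hn.ne'
  have hratioQ : Tendsto (fun n : ℕ =>
      variance (CorrSBM.treeStat n (N n) lam s) (CorrSBM.lawQ n lam s) /
        (∫ x, CorrSBM.treeStat n (N n) lam s x ∂(CorrSBM.lawP n k lam ε s)) ^ 2)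
      atTop (𝓝 0) := hDE.congr' (hvarQ.mono fun n hn => by simp only [hn])
  have hratioP : Tendsto (fun n : ℕ =>
      variance (CorrSBM.treeStat n (N n) lam s) (CorrSBM.lawP n k lam ε s) /
        (∫ x, CorrSBM.treeStat n (N n) lam s x ∂(CorrSBM.lawP n k lam ε s)) ^ 2)
      atTop (𝓝 0) := hvarE.congr fun n => by rw [hvarP n]
  refine ⟨hmean, hne, hratioQ, hratioP,
    CorrSBM.stronglySeparates_of_tendsto ?_ hne hratioQ hratioP⟩
  filter_upwards [hN1, tendsto_natCast_atTop_atTop.eventually_ge_atTop (lam * s)] with n h1 h2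
  exact hmean n h1 h2
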